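/- All logarithms are to base $2$. There are a single deterministic dynamic algorithm (a word-RAM program with words of $O(\log n)$ bits and zero-initialised memory) and absolute constants $C,c$ such that the following holds for all integers $n\ge 2$, all real $0<\varepsilon<1$ and all integers $\Delta_{\max}$ with $10^7\log^5 n/\varepsilon^3\le \Delta_{\max}\le n$. Set $t_1=\lfloor 2^{10\sqrt{\log n}}\rfloor$ and $t_2=\lfloor \log n/\varepsilon\rfloor$, and let $$B=2^{\,C\sqrt{\log n}\,(1+\log\log n)^c\,(1+\log \varepsilon^{-1})^c}=2^{\tilde O_{\log\varepsilon^{-1}}(\sqrt{\log n})}.$$ The algorithm is given the integers $n,\Delta_{\max},t_1,t_2,\lceil 1/\varepsilon\rceil$, and within at most $B$ steps of initialisation it is ready to process updates. Let $G$ be a simple graph on $n$ vertices that is initially empty and undergoes any sequence of insertions and deletions of edges throughout which its maximum degree is at most $\Delta_{\max}$. The algorithm maintains nonnegative integers $h,i,j$, which do not change during the updates, with $h=i+j\le 4\sqrt{\log n}$, and a hierarchy of depth $h$ over $G$: level $0$ consists of $G$, and each graph of level $k<h$ is split by an edge-colouring (not necessarily proper) with $t_1$ colours if $k<i$, and with $t_2$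 colours if $k\ge i$, into its colour classes, which are graphs of level $k+1$. After the initialisation and after every update the bottom level $\mathcal G_h$, which the algorithm maintains explicitly by a stream of insertions of edges into and deletions of edges from its graphs, satisfies (with graphs without edges not counted in 2): 1. the edge sets of the graphs in $\mathcal G_h$ partition $E(G)$; 2. $|\mathcal G_h|\le t_1^i t_2^j$; 3. every graph in $\mathcal G_h$ has maximum degree at most $(1+\frac{\varepsilon}{16})\frac{\Delta_{\max}}{t_1^i t_2^j}\le C\left(\frac{\log n}{\varepsilon}\right)^c$. Moreover, on level $k$, which is obtained from $G$ by $k_1=\min(k,i)$ splittings into $t_1$ and $k_2=k-k_1$ splittings into $t_2$ graphs, all maximum degrees are at most $(1+\frac{\varepsilon}{16})\Delta_{\max}/(t_1^{k_1}t_2^{k_2})$. For every $\sigma\ge 0$, the first $\sigma$ updates are processed in at most $\sigma B$ steps in total (amortised update time $B$) and cause at most $\sigma B$ insertions and deletions of edges in graphs of $\mathcal G_h$ in total (amortised recourse $B$). -/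

import Mathlib

/-! ### Dynamic graphs -/

/-- A single change of the edge set of a graph on the vertex type `V`. -/
inductive EdgeUpdate (V : Type) where
  | insert (u v : V)
  | delete (u v : V)

/-- The graph after the update. -/
def EdgeUpdate.apply {V : Type} (G : SimpleGraph V) : EdgeUpdate V → SimpleGraph V
  | .insert u v => G ⊔ SimpleGraph.edge u v
  | .delete u v => G.deleteEdges {s(u, v)}

/-- Only absent edges may be inserted, and only present edges may be deleted. -/
def EdgeUpdate.Legal {V : Type} (G : SimpleGraph V) : EdgeUpdate V → Prop
  | .insert u v => u ≠ v ∧ ¬ G.Adj u v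
  | .delete u v => G.Adj u v

/-- The dynamic graph after a sequence of updates, starting from the empty graph. -/
def graphAfter {V : Type} (us : List (EdgeUpdate V)) : SimpleGraph V :=
  us.foldl EdgeUpdate.apply ⊥

open scoped Classical in
/-- Every degree of `G` is at most `d`. -/
noncomputable def DegreeLE {V : Type} [Fintype V] (G : SimpleGraph V) (d : ℝ) : Prop :=
  ∀ v, (G.degree v : ℝ) ≤ d

/-- An update sequence on the empty graph all of whose updates are legal, and throughout which
the maximum degree stays at most `D`. -/
def Admissible {V : Type} [Fintype V] (D : ℕ) (us : List (EdgeUpdate V)) : Prop :=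
  (∀ (k : ℕ) (hk : k < us.length), (us[k]).Legal (graphAfter (us.take k))) ∧
    ∀ k ≤ us.length, DegreeLE (graphAfter (us.take k)) D

/-! ### The word RAM

Words are the natural numbers below `2 ^ w`. A program has finitely many registers (those that
it mentions) and a memory of words addressed by words; every instruction and every test costs
one step. -/

/-- A command of the output stream: insert the edge `uv` into, or delete it from, the graph with
index `g` of the maintained family. -/
inductive Command where
  | insert (g u v : ℕ)
  | delete (g u v : ℕ)

/-- Registers, memory, and the output stream (newest command first; it cannot be read). -/
structure State where
  reg : ℕ → ℕ
  mem : ℕ → ℕ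
  out : List Command

/-- Binary word operations. -/
inductive WordOp where
  | add | sub | mul | div | mod

/-- Addition and multiplication are modulo `2 ^ w`, subtraction is cut off at `0`, and the quotient
and remainder by `0` are `0` and the dividend. -/
def WordOp.eval (w : ℕ) : WordOp → ℕ → ℕ → ℕ
  | .add, a, b => (a + b) % 2 ^ w
  | .sub, a, b => a - b
  | .mul, a, b => (a * b) % 2 ^ w
  | .div, a, b => a / b
  | .mod, a, b => a % b

/-- Instructions. All arguments, except the constant `k`, are names of registers. -/
inductive Instr where
  | const (d k : ℕ)
  | op (o : WordOp) (d a b : ℕ)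
  | load (d a : ℕ)
  | store (a b : ℕ)
  | emitInsert (g u v : ℕ)
  | emitDelete (g u v : ℕ)

/-- The effect of an instruction. -/
def Instr.exec (w : ℕ) (s : State) : Instr → State
  | .const d k => { s with reg := Function.update s.reg d (k % 2 ^ w) }
  | .op o d a b => { s with reg := Function.update s.reg d (o.eval w (s.reg a) (s.reg b)) }
  | .load d a => { s with reg := Function.update s.reg d (s.mem (s.reg a)) }
  | .store a b => { s with mem := Function.update s.mem (s.reg a) (s.reg b) }
  | .emitInsert g u v => { s with out := .insert (s.reg g) (s.reg u) (s.reg v) :: s.out }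
  | .emitDelete g u v => { s with out := .delete (s.reg g) (s.reg u) (s.reg v) :: s.out }

/-- Programs. `branch a b p q` runs `p` if register `a` is less than register `b`, and else `q`;
`loop a b p` repeats `p` as long as register `a` is less than register `b`. -/
inductive Code where
  | instr (I : Instr)
  | seq (p q : Code)
  | branch (a b : ℕ) (p q : Code)
  | loop (a b : ℕ) (p : Code)

/-- `Exec w p s s' k`: with word length `w`, the program `p` started in the state `s` halts in the
state `s'` after exactly `k` steps. -/
inductive Exec (w : ℕ) : Code → State → State → ℕ → Prop where
  | instr (I : Instr) (s : State) : Exec w (.instr I) s (I.exec w s) 1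
  | seq {p q : Code} {s s' s'' : State} {k l : ℕ} :
      Exec w p s s' k → Exec w q s' s'' l → Exec w (.seq p q) s s'' (k + l)
  | branch_then {a b : ℕ} {p q : Code} {s s' : State} {k : ℕ} :
      s.reg a < s.reg b → Exec w p s s' k → Exec w (.branch a b p q) s s' (k + 1)
  | branch_else {a b : ℕ} {p q : Code} {s s' : State} {k : ℕ} :
      ¬ s.reg a < s.reg b → Exec w q s s' k → Exec w (.branch a b p q) s s' (k + 1)
  | loop_step {a b : ℕ} {p : Code} {s s' s'' : State} {k l : ℕ} :
      s.reg a < s.reg b → Exec w p s s' k → Exec w (.loop a b p) s' s'' l →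
        Exec w (.loop a b p) s s'' (k + l + 1)
  | loop_exit {a b : ℕ} {p : Code} {s : State} :
      ¬ s.reg a < s.reg b → Exec w (.loop a b p) s s 1

/-! ### Dynamic algorithms -/

/-- A deterministic dynamic algorithm: a program that is run once, before the first update, and
programs that process the insertion and the deletion of an edge. -/
structure DynAlg where
  init : Code
  insert : Code
  delete : Code

/-- The state in which the initialisation starts: registers `0, 1, …` hold the input words,
everything else is zero, and nothing has been output. -/
def startState (w : ℕ) (input : List ℕ) : State where
  reg := fun r => input.getD r 0 % 2 ^ w
  mem := fun _ => 0
  out := []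

/-- The program that processes the update. -/
def DynAlg.code (A : DynAlg) {n : ℕ} : EdgeUpdate (Fin n) → Code
  | .insert _ _ => A.insert
  | .delete _ _ => A.delete

/-- The end points of the updated edge are passed in registers `0` and `1`; the rest of the state
is as the previous call left it. -/
def passEdge {n : ℕ} (s : State) : EdgeUpdate (Fin n) → State
  | .insert u v => { s with reg := Function.update (Function.update s.reg 0 u) 1 v }
  | .delete u v => { s with reg := Function.update (Function.update s.reg 0 u) 1 v }

/-- `A.Run w s₀ us s T`: started in the state `s₀`, the algorithm processes the updates `us` one
after the other, in `T` steps altogether, and ends in the state `s`. -/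
inductive DynAlg.Run (A : DynAlg) (w : ℕ) {n : ℕ} (s₀ : State) :
    List (EdgeUpdate (Fin n)) → State → ℕ → Prop where
  | nil : Run A w s₀ [] s₀ 0
  | snoc {us : List (EdgeUpdate (Fin n))} {u : EdgeUpdate (Fin n)} {s s' : State} {T k : ℕ} :
      Run A w s₀ us s T → Exec w (A.code u) (passEdge s u) s' k →
        Run A w s₀ (us ++ [u]) s' (T + k)

/-- The effect of a command on a family of graphs on the vertices `0, …, n - 1`. A command that
names a number which is not a vertex has no effect. -/
def Command.apply {n : ℕ} (c : Command) (F : ℕ → SimpleGraph (Fin n)) : ℕ → SimpleGraph (Fin n) :=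
  match c with
  | .insert g u v =>
      if h : u < n ∧ v < n then
        Function.update F g ((EdgeUpdate.insert ⟨u, h.1⟩ ⟨v, h.2⟩).apply (F g))
      else F
  | .delete g u v =>
      if h : u < n ∧ v < n then
        Function.update F g ((EdgeUpdate.delete ⟨u, h.1⟩ ⟨v, h.2⟩).apply (F g))
      else F

/-- The family of graphs described by the output so far: all graphs are empty at first, and the
commands are applied in the order in which they were issued. -/
def State.family (s : State) (n : ℕ) : ℕ → SimpleGraph (Fin n) :=
  s.out.foldr Command.apply (fun _ => ⊥)

/-! ### Hierarchies of splittings -/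

/-- The edge sets of the graphs `H p`, `p ∈ P`, partition the edge set of `G` (graphs without
edges may occur in the family). -/
def PartitionsEdges {V : Type} (G : SimpleGraph V) (P : Set ℕ) (H : ℕ → SimpleGraph V) : Prop :=
  (P.PairwiseDisjoint fun p => (H p).edgeSet) ∧ ⋃ p ∈ P, (H p).edgeSet = G.edgeSet

/-- A hierarchy of depth `h` over `G`. Level `0` consists of `G`. Level `k` is indexed by the
numbers below `t 0 * ⋯ * t (k - 1)`, and its graph with index `p` is split by a `t k`-edge-colouring
(not necessarily proper) into colour classes, which are the graphs of level `k + 1` with the indices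
`p * t k + κ` for the colours `κ < t k`. The maximum degrees on level `k` are at most `D k`. -/
structure IsHierarchy {V : Type} [Fintype V] (G : SimpleGraph V) (h : ℕ) (t : ℕ → ℕ) (D : ℕ → ℝ)
    (H : ℕ → ℕ → SimpleGraph V) : Prop where
  root : H 0 0 = G
  split : ∀ k < h, ∀ p < ∏ l ∈ Finset.range k, t l,
    PartitionsEdges (H k p) {κ | κ < t k} (fun κ => H (k + 1) (p * t k + κ))
  degree : ∀ k ≤ h, ∀ p < ∏ l ∈ Finset.range k, t l, DegreeLE (H k p) (D k)

/-- The bound `2 ^ (C √(log n) (1 + log log n) ^ c (1 + log ε⁻¹) ^ c)`, logarithms to base `2`. -/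
noncomputable def subpolyBound (C : ℝ) (c : ℕ) (n : ℕ) (ε : ℝ) : ℝ :=
  2 ^ (C * √(Real.logb 2 n) * (1 + Real.logb 2 (Real.logb 2 n)) ^ c * (1 + Real.logb 2 ε⁻¹) ^ c)

/-!
The algorithm is a local search that keeps an edge colouring with `T = t₁ ^ i * t₂ ^ j` colours
in which all colours have nearly the same load (number of incident edges) at every vertex. The
colour classes are the bottom level of the hierarchy, and the levels above it arise by grouping the
colours according to the leading digits of their mixed radix representation
(`exists_isHierarchy`), so that bounds for the loads are bounds for the degrees on all levels.

*Stability.* The colours form a binary heap. An edge `uv` of colour `k` is violating if moving it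
to the parent or to a child `k'` of `k` lowers the sum of the loads at `u` and `v` that it sees by
more than `2 + A / q`, where `A` bounds the number of edges that have to be inspected again after
the move, and `q = t₂ ^ 7`. In a colouring without violating edges the loads of adjacent colours are
close: for the imbalance `x v = load v k - load v k'`, an edge of colour `k` at a vertex with
`x v ≥ a + s` leads to a vertex with `x ≤ -a`, where `s` is the slack. Summing the loads over such
vertices shows that the number of vertices with `|x| ≥ a` decreases at least by a factor `1 + a / L`
when `a` increases by `s` (`imbalanced_expansion`), `L` being the maximal load, so that imbalances
much larger than `ε * L / log n` would require more than `n` vertices. The colour tree has depth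
`O(log n)`, so the loads of any two colours at a vertex differ by at most a small fraction of
`ε * L` (`load_le_of_stable`), and as the smallest load is at most `Δ / T`, the largest one is at
most `(1 + ε / 16) * (Δ / T)` (`load_le_average`).

*Running time.* A move lowers the sum of the squares of the loads so much that `q` times the
decrease pays for the inspections that follow (`potential_recolour`). An insertion, which uses the
colour `0`, raises the potential by `O(Δ / T)`, and deletions lower it. The initialisation chooses
`i` and `j` such that `Δ / T` is between `t₂ ^ 7` and `t₂ ^ 8` (or `T = 1`), so the amortised cost
of an update is `O(t₂ ^ 15)` steps (`exists_run`). This is polylogarithmic in `n` and polynomial in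
`ε⁻¹`, and within the bound; the recourse is at most the number of steps.

*Implementation.* Programs are written in a small language of expressions and statements that is
compiled to word-RAM code; `Runs` is the resulting notion of execution, which ignores the scratch
registers from `32` on. The registers `0` and `1` hold the end points of the current edge, `5`
holds `N = 4 * n`, `6` the number `T` of colours, `7` holds `q`, `8` the height of the stack of
edges to be inspected, `9` the colour of the current edge, and `21` always holds `0`. The remaining
registers are temporary.
-/

namespace DegreeSplitting

/-! ### Edge colourings and loads -/

/-- The number of edges of colour `l` at the vertex `v`. A colouring of the edges on the vertices
`0, …, n - 1` is encoded by `χ`, where `χ u v = 0` if `uv` is not an edge, and `χ u v` is one more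
than the colour of `uv` otherwise. -/
def load (n : ℕ) (χ : ℕ → ℕ → ℕ) (v l : ℕ) : ℕ :=
  ((Finset.range n).filter fun x => χ v x = l + 1).card

/-- `χ` encodes a colouring of the edges of a simple graph with the colours below `T`. -/
structure IsColouring (T : ℕ) (χ : ℕ → ℕ → ℕ) : Prop where
  symm : ∀ u v, χ u v = χ v u
  irrefl : ∀ v, χ v v = 0
  le : ∀ u v, χ u v ≤ T

/-- `χ` with the entry at `(v, x)`, but not the one at `(x, v)`, set to `c`. -/
def halfSet (χ : ℕ → ℕ → ℕ) (v x c : ℕ) : ℕ → ℕ → ℕ :=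
  fun a b => if a = v ∧ b = x then c else χ a b

/-- `χ` with the entries at `(u, v)` and `(v, u)` set to `c`. -/
def recolour (χ : ℕ → ℕ → ℕ) (u v c : ℕ) : ℕ → ℕ → ℕ :=
  halfSet (halfSet χ u v c) v u c

theorem recolour_apply (χ : ℕ → ℕ → ℕ) (u v c a b : ℕ) :
    recolour χ u v c a b = if (a = u ∧ b = v) ∨ (a = v ∧ b = u) then c else χ a b := by
  unfold recolour halfSet
  split_ifs <;> first | rfl | omega

theorem recolour_recolour (χ : ℕ → ℕ → ℕ) (u v c d : ℕ) :
    recolour (recolour χ u v c) u v d = recolour χ u v d := by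
  funext a b
  simp only [recolour_apply]
  split_ifs <;> rfl

theorem IsColouring.recolour {T : ℕ} {χ : ℕ → ℕ → ℕ} (h : IsColouring T χ) {u v c : ℕ}
    (huv : u ≠ v) (hc : c ≤ T) : IsColouring T (recolour χ u v c) where
  symm a b := by
    simp only [recolour_apply]
    have := h.symm a b
    split_ifs <;> first | rfl | omega
  irrefl a := by
    simp only [recolour_apply]
    have := h.irrefl a
    split_ifs <;> omega
  le a b := by
    simp only [recolour_apply]
    have := h.le a b
    split_ifs <;> omega

theorem load_halfSet {n : ℕ} (χ : ℕ → ℕ → ℕ) {v x : ℕ} (c : ℕ) (hx : x < n) (w l : ℕ) :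
    load n (halfSet χ v x c) w l + (if w = v ∧ χ v x = l + 1 then 1 else 0) =
      load n χ w l + if w = v ∧ c = l + 1 then 1 else 0 := by
  unfold load
  rw [Finset.card_filter, Finset.card_filter,
    ← Finset.add_sum_erase _ _ (Finset.mem_range.2 hx),
    ← Finset.add_sum_erase (Finset.range n) (fun y => if χ w y = l + 1 then 1 else 0)
      (Finset.mem_range.2 hx)]
  have : ∀ y ∈ (Finset.range n).erase x,
      (if halfSet χ v x c w y = l + 1 then 1 else 0) = if χ w y = l + 1 then 1 else 0 := by
    intro y hy
    have hyx : y ≠ x := (Finset.mem_erase.1 hy).1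
    simp [halfSet, hyx]
  rw [Finset.sum_congr rfl this]
  unfold halfSet
  by_cases hw : w = v
  · subst hw
    simp only [true_and, if_true]
    split_ifs <;> omega
  · simp [hw]

theorem load_recolour {n : ℕ} {χ : ℕ → ℕ → ℕ} {u v : ℕ} (c : ℕ) (hu : u < n) (hv : v < n)
    (huv : u ≠ v) (hs : χ u v = χ v u) (w l : ℕ) :
    load n (recolour χ u v c) w l + (if (w = u ∨ w = v) ∧ χ u v = l + 1 then 1 else 0) =
      load n χ w l + if (w = u ∨ w = v) ∧ c = l + 1 then 1 else 0 := by
  have h1 := load_halfSet χ c hv (v := u) w l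
  have h2 := load_halfSet (halfSet χ u v c) c hu (v := v) w l
  have h3 : halfSet χ u v c v u = χ v u := by simp [halfSet, huv.symm]
  rw [h3] at h2
  unfold recolour
  split_ifs at * <;> omega

theorem load_le {n : ℕ} (χ : ℕ → ℕ → ℕ) (v l : ℕ) : load n χ v l ≤ n :=
  (Finset.card_filter_le _ _).trans (by simp)

theorem load_eq_zero {n T : ℕ} {χ : ℕ → ℕ → ℕ} (h : IsColouring T χ) {v l : ℕ} (hl : T ≤ l) :
    load n χ v l = 0 := by
  unfold load
  rw [Finset.card_eq_zero, Finset.filter_eq_empty_iff]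
  intro x _ hx
  have := h.le v x
  omega

theorem sum_load_le {n T : ℕ} (χ : ℕ → ℕ → ℕ) (v : ℕ) :
    ∑ l ∈ Finset.range T, load n χ v l ≤ ((Finset.range n).filter fun x => χ v x ≠ 0).card := by
  unfold load
  rw [← Finset.card_biUnion]
  · apply Finset.card_le_card
    intro x
    simp only [Finset.mem_biUnion, Finset.mem_filter, Finset.mem_range]
    rintro ⟨l, _, hx, h⟩
    exact ⟨hx, by omega⟩
  · intro a _ b _ hab
    rw [Function.onFun, Finset.disjoint_left]
    intro x
    simp only [Finset.mem_filter]
    omega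

/-! ### The colour tree and violations -/

/-- The colours are arranged as a binary heap: the parent of `k` is `(k - 1) / 2` and its children
are `2 * k + 1` and `2 * k + 2`. `Near k l` says that `l` is `k` or adjacent to `k`. -/
def Near (k l : ℕ) : Prop :=
  l = k ∨ l = (k - 1) / 2 ∨ l = 2 * k + 1 ∨ l = 2 * k + 2

theorem Near.symm {k l : ℕ} (h : Near k l) : Near l k := by
  unfold Near at *
  omega

/-- The sum of `f` over `k`, its parent and its children; the root counts as its own parent. -/
def nearSum (f : ℕ → ℕ) (k : ℕ) : ℕ :=
  f k + f ((k - 1) / 2) + f (2 * k + 1) + f (2 * k + 2)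

theorem nearSum_mono {f g : ℕ → ℕ} {k : ℕ} (h : ∀ l, Near k l → f l ≤ g l) :
    nearSum f k ≤ nearSum g k := by
  unfold nearSum
  have h1 := h k (.inl rfl)
  have h2 := h ((k - 1) / 2) (.inr (.inl rfl))
  have h3 := h (2 * k + 1) (.inr (.inr (.inl rfl)))
  have h4 := h (2 * k + 2) (.inr (.inr (.inr rfl)))
  omega

/-- The number of edges that are inspected again after an edge `uv` has lost the colour `k`. -/
def inspectCost (n : ℕ) (χ : ℕ → ℕ → ℕ) (u v k : ℕ) : ℕ :=
  nearSum (load n χ u) k + nearSum (load n χ v) k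

/-- The edge `uv` of colour `k` should better get the adjacent colour `k'`. The larger the cost of
the inspections that follow, the larger the required gain. -/
def Improves (n T q : ℕ) (χ : ℕ → ℕ → ℕ) (u v k k' : ℕ) : Prop :=
  k' < T ∧ load n χ u k' + load n χ v k' + inspectCost n χ u v k / q + 2 <
    load n χ u k + load n χ v k

/-- Some recolouring of the edge `uv` is an improvement. -/
def Violating (n T q : ℕ) (χ : ℕ → ℕ → ℕ) (u v : ℕ) : Prop :=
  ∃ k k', χ u v = k + 1 ∧ Near k k' ∧ Improves n T q χ u v k k'

theorem Violating.symm {n T q : ℕ} {χ : ℕ → ℕ → ℕ} (hs : ∀ u v, χ u v = χ v u) {u v : ℕ}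
    (h : Violating n T q χ u v) : Violating n T q χ v u := by
  obtain ⟨k, k', h1, h2, h3, h4⟩ := h
  refine ⟨k, k', by rw [hs, h1], h2, h3, ?_⟩
  unfold inspectCost at *
  rw [add_comm (nearSum (load n χ v) k)]
  omega

/-- If only loads at `u` and `v` change, and of these only the one of colour `k` may decrease and
only those of colours near `k` may increase, then a new violating edge is incident to `u` or `v`
and its colour is near `k`. -/
theorem Violating.of_recolour {n T q : ℕ} {χ χ' : ℕ → ℕ → ℕ} {u v k : ℕ}
    (hload : ∀ w l, (w = u ∨ w = v) → ¬ Near k l → load n χ' w l = load n χ w l)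
    (hload' : ∀ w l, (w = u ∨ w = v) → l ≠ k → load n χ w l ≤ load n χ' w l)
    (hother : ∀ w l, w ≠ u → w ≠ v → load n χ' w l = load n χ w l)
    {x y l : ℕ} (hl : χ' x y = l + 1) (hxy : χ x y = l + 1)
    (hx : ¬ ((x = u ∨ x = v) ∧ Near k l)) (hy : ¬ ((y = u ∨ y = v) ∧ Near k l))
    (h : Violating n T q χ' x y) : Violating n T q χ x y := by
  obtain ⟨l', m, h1, h2, h3, h4⟩ := h
  obtain rfl : l = l' := by omega
  have key : ∀ w, ¬ ((w = u ∨ w = v) ∧ Near k l) →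
      load n χ' w l = load n χ w l ∧ ∀ p, Near l p → load n χ w p ≤ load n χ' w p := by
    intro w hw
    by_cases hwuv : w = u ∨ w = v
    · have hk : ¬ Near k l := fun hk => hw ⟨hwuv, hk⟩
      refine ⟨hload w l hwuv hk, fun p hp => hload' w p hwuv ?_⟩
      rintro rfl
      exact hk hp.symm
    · rw [not_or] at hwuv
      exact ⟨hother w l hwuv.1 hwuv.2, fun p _ => (hother w p hwuv.1 hwuv.2).ge⟩
  obtain ⟨hx1, hx2⟩ := key x hx
  obtain ⟨hy1, hy2⟩ := key y hy
  refine ⟨l, m, hxy, h2, h3, ?_⟩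
  have hc : inspectCost n χ x y l / q ≤ inspectCost n χ' x y l / q :=
    Nat.div_le_div_right (Nat.add_le_add (nearSum_mono hx2) (nearSum_mono hy2))
  have := hx2 m h2
  have := hy2 m h2
  omega

/-! ### The quadratic potential -/

/-- The sum of the squares of all loads. -/
def potential (n T : ℕ) (χ : ℕ → ℕ → ℕ) : ℕ :=
  ∑ w ∈ Finset.range n, ∑ l ∈ Finset.range T, load n χ w l ^ 2

theorem potential_le {n T : ℕ} (χ : ℕ → ℕ → ℕ) : potential n T χ ≤ n ^ 3 := by
  have : ∀ w ∈ Finset.range n, ∑ l ∈ Finset.range T, load n χ w l ^ 2 ≤ n ^ 2 := by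
    intro w _
    calc ∑ l ∈ Finset.range T, load n χ w l ^ 2
        ≤ ∑ l ∈ Finset.range T, n * load n χ w l :=
          Finset.sum_le_sum fun l _ => by
            rw [pow_two]; exact Nat.mul_le_mul_right _ (load_le _ _ _)
      _ = n * ∑ l ∈ Finset.range T, load n χ w l := by rw [Finset.mul_sum]
      _ ≤ n * n := Nat.mul_le_mul_left _ ((sum_load_le χ w).trans
          ((Finset.card_filter_le _ _).trans (by simp)))
      _ = n ^ 2 := by ring
  calc potential n T χ ≤ ∑ w ∈ Finset.range n, n ^ 2 := Finset.sum_le_sum this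
    _ = n ^ 3 := by simp; ring

theorem potential_mono {n T : ℕ} {χ χ' : ℕ → ℕ → ℕ} (h : ∀ w l, load n χ w l ≤ load n χ' w l) :
    potential n T χ ≤ potential n T χ' :=
  Finset.sum_le_sum fun w _ => Finset.sum_le_sum fun l _ => Nat.pow_le_pow_left (h w l) 2

/-- Adding one edge `uv` of colour `k`. -/
theorem potential_of_add {n T : ℕ} {χ χ' : ℕ → ℕ → ℕ} {u v k : ℕ} (hu : u < n) (hv : v < n)
    (huv : u ≠ v) (hk : k < T)
    (h : ∀ w l, load n χ' w l = load n χ w l + if (w = u ∨ w = v) ∧ l = k then 1 else 0) :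
    potential n T χ' = potential n T χ + 2 * (load n χ u k + load n χ v k) + 2 := by
  have h1 : ∀ w l, load n χ' w l ^ 2 = load n χ w l ^ 2 +
      ((if w = u then (if l = k then 2 * load n χ w l + 1 else 0) else 0) +
        if w = v then (if l = k then 2 * load n χ w l + 1 else 0) else 0) := by
    intro w l
    rw [h]
    by_cases hwu : w = u
    · subst hwu
      by_cases hl : l = k
      · simp [hl, huv]; ring
      · simp [hl]
    · by_cases hwv : w = v
      · subst hwv
        by_cases hl : l = k
        · simp [hl, hwu]; ring
        · simp [hl]
      · simp [hwu, hwv]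
  have h2 : ∀ w, (∑ l ∈ Finset.range T, if l = k then 2 * load n χ w l + 1 else 0) =
      2 * load n χ w k + 1 := by
    intro w
    rw [Finset.sum_ite_eq' (Finset.range T) k]
    simp [hk]
  have h3 : ∀ u < n, (∑ w ∈ Finset.range n, ∑ l ∈ Finset.range T,
      if w = u then (if l = k then 2 * load n χ w l + 1 else 0) else 0) =
      2 * load n χ u k + 1 := by
    intro u hu
    rw [Finset.sum_eq_single u]
    · simp [h2]
    · intro w _ hw
      simp [hw]
    · intro h; exact absurd (Finset.mem_range.2 hu) h
  unfold potential
  simp only [h1, Finset.sum_add_distrib]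
  rw [h3 u hu, h3 v hv]
  ring

theorem load_recolour_of_absent {n : ℕ} {χ : ℕ → ℕ → ℕ} {u v k : ℕ} (hu : u < n) (hv : v < n)
    (huv : u ≠ v) (h : χ u v = 0) (h' : χ v u = 0) (w l : ℕ) :
    load n (recolour χ u v (k + 1)) w l =
      load n χ w l + if (w = u ∨ w = v) ∧ l = k then 1 else 0 := by
  have := load_recolour (k + 1) hu hv huv (h.trans h'.symm) w l
  have e : k + 1 = l + 1 ↔ l = k := by omega
  have e0 : 0 = l + 1 ↔ False := iff_false_intro (Nat.succ_ne_zero l).symm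
  simpa only [h, e, e0, and_false, if_false, add_zero] using this

theorem load_eq_recolour_zero {n : ℕ} {χ : ℕ → ℕ → ℕ} {u v k : ℕ} (hu : u < n) (hv : v < n)
    (huv : u ≠ v) (h : χ u v = k + 1) (h' : χ v u = k + 1) (w l : ℕ) :
    load n χ w l =
      load n (recolour χ u v 0) w l + if (w = u ∨ w = v) ∧ l = k then 1 else 0 := by
  have := load_recolour 0 hu hv huv (h.trans h'.symm) w l
  have e : k + 1 = l + 1 ↔ l = k := by omega
  have e0 : 0 = l + 1 ↔ False := iff_false_intro (Nat.succ_ne_zero l).symm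
  simpa only [h, e, e0, and_false, if_false, add_zero] using this.symm

theorem load_recolour_eq {n : ℕ} {χ : ℕ → ℕ → ℕ} {u v k k' : ℕ} (hu : u < n) (hv : v < n)
    (huv : u ≠ v) (h : χ u v = k + 1) (h' : χ v u = k + 1) (w l : ℕ) :
    load n (recolour χ u v (k' + 1)) w l + (if (w = u ∨ w = v) ∧ l = k then 1 else 0) =
      load n χ w l + if (w = u ∨ w = v) ∧ l = k' then 1 else 0 := by
  have := load_recolour (k' + 1) hu hv huv (h.trans h'.symm) w l
  have e : k + 1 = l + 1 ↔ l = k := by omega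
  have e' : k' + 1 = l + 1 ↔ l = k' := by omega
  simpa only [h, e, e'] using this

/-- The potential falls by twice the gain in load, less `4`; so the fall, multiplied by `q`, pays
for the inspections that follow. -/
theorem potential_recolour {n T q : ℕ} {χ : ℕ → ℕ → ℕ} (hχ : IsColouring T χ) {u v k k' : ℕ}
    (hq : 0 < q) (hu : u < n) (hv : v < n) (huv : u ≠ v) (h : χ u v = k + 1)
    (hi : Improves n T q χ u v k k') :
    q * potential n T (recolour χ u v (k' + 1)) + inspectCost n χ u v k + q ≤
      q * potential n T χ := by
  have h' : χ v u = k + 1 := by rw [hχ.symm, h]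
  have hkT : k < T := by have := hχ.le u v; omega
  have hloss := potential_of_add (T := T) hu hv huv hkT (load_eq_recolour_zero hu hv huv h h')
  have h0 : recolour χ u v 0 u v = 0 := by simp [recolour_apply]
  have h0' : recolour χ u v 0 v u = 0 := by simp [recolour_apply]
  have hgain := potential_of_add (T := T) hu hv huv hi.1
    (load_recolour_of_absent (k := k') hu hv huv h0 h0')
  rw [recolour_recolour] at hgain
  have e1 := load_eq_recolour_zero hu hv huv h h' u k
  have e2 := load_eq_recolour_zero hu hv huv h h' v k
  have e3 := load_eq_recolour_zero hu hv huv h h' u k'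
  have e4 := load_eq_recolour_zero hu hv huv h h' v k'
  simp only [true_or, or_true, true_and, if_true] at e1 e2 e3 e4
  obtain ⟨_, hlt⟩ := hi
  have hdiv : inspectCost n χ u v k ≤ q * (inspectCost n χ u v k / q) + q := by
    have h1 := Nat.div_add_mod (inspectCost n χ u v k) q
    have h2 := Nat.mod_lt (inspectCost n χ u v k) hq
    omega
  generalize inspectCost n χ u v k / q = d at hlt hdiv
  have hne : k' ≠ k := by rintro rfl; omega
  rw [if_neg hne] at e3 e4
  have hdrop : potential n T (recolour χ u v (k' + 1)) + (d + 2) ≤ potential n T χ := by omega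
  calc _ ≤ q * (potential n T (recolour χ u v (k' + 1)) + (d + 2)) := by
        ring_nf; ring_nf at hdiv; omega
    _ ≤ _ := Nat.mul_le_mul_left _ hdrop

/-- The colour lost weighs at least as much in `nearSum` as the adjacent colour gained. -/
theorem inspectCost_recolour_le {n T : ℕ} {χ : ℕ → ℕ → ℕ} (hχ : IsColouring T χ) {u v k k' : ℕ}
    (hu : u < n) (hv : v < n) (huv : u ≠ v) (h : χ u v = k + 1) :
    inspectCost n (recolour χ u v (k' + 1)) u v k ≤ inspectCost n χ u v k := by
  have h' : χ v u = k + 1 := by rw [hχ.symm, h]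
  have key : ∀ w, (w = u ∨ w = v) →
      nearSum (load n (recolour χ u v (k' + 1)) w) k ≤ nearSum (load n χ w) k := by
    intro w hw
    unfold nearSum
    have e0 := load_recolour_eq (k' := k') hu hv huv h h' w k
    have e1 := load_recolour_eq (k' := k') hu hv huv h h' w ((k - 1) / 2)
    have e2 := load_recolour_eq (k' := k') hu hv huv h h' w (2 * k + 1)
    have e3 := load_recolour_eq (k' := k') hu hv huv h h' w (2 * k + 2)
    simp only [hw, true_and, if_true] at e0 e1 e2 e3
    split_ifs at * <;> omega
  exact Nat.add_le_add (key u (.inl rfl)) (key v (.inr rfl))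

/-! ### Colourings without violations are balanced -/

theorem sum_load_mul_le {n : ℕ} {χ : ℕ → ℕ → ℕ} (hs : ∀ u v, χ u v = χ v u) (l : ℕ)
    (f g : ℕ → ℤ) (h : ∀ u < n, ∀ v < n, χ u v = l + 1 → f u + f v ≤ g u + g v) :
    ∑ v ∈ Finset.range n, (load n χ v l : ℤ) * f v ≤
      ∑ v ∈ Finset.range n, (load n χ v l : ℤ) * g v := by
  have key : ∀ f : ℕ → ℤ, 2 * ∑ v ∈ Finset.range n, (load n χ v l : ℤ) * f v =
      ∑ u ∈ Finset.range n, ∑ v ∈ Finset.range n, if χ u v = l + 1 then f u + f v else 0 := by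
    intro f
    have h1 : ∑ v ∈ Finset.range n, (load n χ v l : ℤ) * f v =
        ∑ u ∈ Finset.range n, ∑ v ∈ Finset.range n, if χ u v = l + 1 then f u else 0 := by
      refine Finset.sum_congr rfl fun u _ => ?_
      rw [load, ← Finset.sum_filter, Finset.sum_const, nsmul_eq_mul]
    have h2 : ∑ v ∈ Finset.range n, (load n χ v l : ℤ) * f v =
        ∑ u ∈ Finset.range n, ∑ v ∈ Finset.range n, if χ u v = l + 1 then f v else 0 := by
      rw [h1, Finset.sum_comm]
      refine Finset.sum_congr rfl fun u _ => Finset.sum_congr rfl fun v _ => ?_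
      rw [hs u v]
    rw [two_mul]
    nth_rw 1 [h1]
    rw [h2, ← Finset.sum_add_distrib]
    refine Finset.sum_congr rfl fun u _ => ?_
    rw [← Finset.sum_add_distrib]
    refine Finset.sum_congr rfl fun v _ => ?_
    split_ifs <;> simp
  have : 2 * ∑ v ∈ Finset.range n, (load n χ v l : ℤ) * f v ≤
      2 * ∑ v ∈ Finset.range n, (load n χ v l : ℤ) * g v := by
    rw [key f, key g]
    refine Finset.sum_le_sum fun u hu => Finset.sum_le_sum fun v hv => ?_
    split_ifs with hc
    · exact h u (Finset.mem_range.1 hu) v (Finset.mem_range.1 hv) hc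
    · rfl
  linarith

/-- The number of vertices at which the loads of the colours `a` and `b` differ by at least `k`. -/
def imbalanced (n : ℕ) (χ : ℕ → ℕ → ℕ) (a b k : ℕ) : ℕ :=
  ((Finset.range n).filter fun v =>
    (k : ℤ) ≤ (load n χ v a : ℤ) - load n χ v b ∨
      (load n χ v a : ℤ) - load n χ v b ≤ -(k : ℤ)).card

/-- Recolouring an edge between the colours `a` and `b` gains at most `s` in load, whichever of
the two colours it has. -/
def PairStable (n : ℕ) (χ : ℕ → ℕ → ℕ) (a b s : ℕ) : Prop :=
  ∀ u < n, ∀ v < n,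
    (χ u v = a + 1 → load n χ u a + load n χ v a ≤ load n χ u b + load n χ v b + s) ∧
    (χ u v = b + 1 → load n χ u b + load n χ v b ≤ load n χ u a + load n χ v a + s)

/-- Expansion. An edge of colour `a` at a vertex with a surplus of at least `k + s` of the colour
`a` leads to a vertex with a deficit of at least `k`; the edges that lead to a deficit of at least
`k + s` cancel in the total surplus and deficit, and the number of the others is bounded by the
number of vertices whose imbalance is between `k` and `k + s`. -/
theorem imbalanced_expansion {n : ℕ} {χ : ℕ → ℕ → ℕ} (hs : ∀ u v, χ u v = χ v u) {a b s L : ℕ}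
    (hp : PairStable n χ a b s) (hL : ∀ v < n, ∀ l, load n χ v l ≤ L) {k : ℕ} (hk : 0 < k) :
    (k + s + L) * imbalanced n χ a b (k + s) ≤ L * imbalanced n χ a b k := by
  set x : ℕ → ℤ := fun v => (load n χ v a : ℤ) - load n χ v b with hx
  let sg : ℕ → ℤ := fun v => if (k + s : ℤ) ≤ x v then 1 else if x v ≤ -(k + s : ℤ) then -1 else 0
  let bn : ℕ → ℤ := fun v => if -(k + s : ℤ) < x v ∧ x v ≤ -(k : ℤ) then 1 else 0
  let bp : ℕ → ℤ := fun v => if x v < (k + s : ℤ) ∧ (k : ℤ) ≤ x v then 1 else 0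
  have ha : ∑ v ∈ Finset.range n, (load n χ v a : ℤ) * sg v ≤
      ∑ v ∈ Finset.range n, (load n χ v a : ℤ) * bn v := by
    refine sum_load_mul_le hs a sg bn fun u hu v hv huv => ?_
    have := (hp u hu v hv).1 huv
    have : x u + x v ≤ s := by simp only [hx]; omega
    simp only [sg, bn]
    split_ifs <;> omega
  have hb : ∑ v ∈ Finset.range n, (load n χ v b : ℤ) * (-sg v) ≤
      ∑ v ∈ Finset.range n, (load n χ v b : ℤ) * bp v := by
    refine sum_load_mul_le hs b (fun v => -sg v) bp fun u hu v hv huv => ?_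
    have := (hp u hu v hv).2 huv
    have : -(s : ℤ) ≤ x u + x v := by simp only [hx]; omega
    simp only [sg, bp]
    split_ifs <;> omega
  have hM : ∀ k : ℕ, (imbalanced n χ a b k : ℤ) =
      ∑ v ∈ Finset.range n, if (k : ℤ) ≤ x v ∨ x v ≤ -(k : ℤ) then 1 else 0 := by
    intro k
    rw [imbalanced, Finset.card_filter]
    push_cast
    rfl
  have h1 : ((k + s : ℕ) : ℤ) * imbalanced n χ a b (k + s) ≤
      ∑ v ∈ Finset.range n, x v * sg v := by
    rw [hM, Finset.mul_sum]
    refine Finset.sum_le_sum fun v _ => ?_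
    simp only [sg]
    push_cast
    split_ifs <;> omega
  have h2 : ∑ v ∈ Finset.range n, x v * sg v =
      (∑ v ∈ Finset.range n, (load n χ v a : ℤ) * sg v) +
        ∑ v ∈ Finset.range n, (load n χ v b : ℤ) * (-sg v) := by
    rw [← Finset.sum_add_distrib]
    refine Finset.sum_congr rfl fun v _ => ?_
    simp only [hx]; ring
  have h3 : (∑ v ∈ Finset.range n, (load n χ v a : ℤ) * bn v) +
        (∑ v ∈ Finset.range n, (load n χ v b : ℤ) * bp v) ≤
      L * ((imbalanced n χ a b k : ℤ) - imbalanced n χ a b (k + s)) := by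
    rw [hM, hM, ← Finset.sum_sub_distrib, ← Finset.sum_add_distrib, Finset.mul_sum]
    refine Finset.sum_le_sum fun v hv => ?_
    have hLa : (load n χ v a : ℤ) ≤ L := by exact_mod_cast hL v (Finset.mem_range.1 hv) a
    have hLb : (load n χ v b : ℤ) ≤ L := by exact_mod_cast hL v (Finset.mem_range.1 hv) b
    simp only [bn, bp]
    push_cast
    split_ifs <;> omega
  have h4 : ((k + s + L : ℕ) : ℤ) * imbalanced n χ a b (k + s) ≤ L * imbalanced n χ a b k := by
    have : ((k + s : ℕ) : ℤ) * imbalanced n χ a b (k + s) ≤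
      L * ((imbalanced n χ a b k : ℤ) - imbalanced n χ a b (k + s)) := by linarith
    push_cast at this ⊢
    linarith
  exact_mod_cast h4

/-- An imbalance of `k + r * s` at one vertex forces `n` to be exponentially large in `r`. -/
theorem pow_le_of_imbalance {n : ℕ} {χ : ℕ → ℕ → ℕ} (hs : ∀ u v, χ u v = χ v u) {a b s L : ℕ}
    (hp : PairStable n χ a b s) (hL : ∀ v < n, ∀ l, load n χ v l ≤ L) {k : ℕ} (hk : 0 < k) (r : ℕ)
    {v : ℕ} (hv : v < n) (h : load n χ v b + (k + r * s) ≤ load n χ v a) :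
    (k + L) ^ r ≤ L ^ r * n := by
  have h1 : ∀ j, (k + L) ^ j * imbalanced n χ a b (k + j * s) ≤ L ^ j * imbalanced n χ a b k := by
    intro j
    induction j with
    | zero => simp
    | succ j ih =>
      have := imbalanced_expansion hs hp hL (k := k + j * s) (by omega)
      have e : k + (j + 1) * s = k + j * s + s := by ring
      rw [e]
      calc (k + L) ^ (j + 1) * imbalanced n χ a b (k + j * s + s)
          = (k + L) ^ j * ((k + L) * imbalanced n χ a b (k + j * s + s)) := by ring
        _ ≤ (k + L) ^ j * ((k + j * s + s + L) * imbalanced n χ a b (k + j * s + s)) := by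
            gcongr; omega
        _ ≤ (k + L) ^ j * (L * imbalanced n χ a b (k + j * s)) := by gcongr
        _ = L * ((k + L) ^ j * imbalanced n χ a b (k + j * s)) := by ring
        _ ≤ L * (L ^ j * imbalanced n χ a b k) := by gcongr
        _ = L ^ (j + 1) * imbalanced n χ a b k := by ring
  have h2 : 1 ≤ imbalanced n χ a b (k + r * s) := by
    refine Finset.card_pos.2 ⟨v, Finset.mem_filter.2 ⟨Finset.mem_range.2 hv, .inl ?_⟩⟩
    push_cast
    have : (load n χ v b : ℤ) + (k + r * s) ≤ load n χ v a := by exact_mod_cast h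
    linarith
  have h3 : imbalanced n χ a b k ≤ n := (Finset.card_filter_le _ _).trans (by simp)
  calc (k + L) ^ r ≤ (k + L) ^ r * imbalanced n χ a b (k + r * s) := Nat.le_mul_of_pos_right _ h2
    _ ≤ L ^ r * imbalanced n χ a b k := h1 r
    _ ≤ L ^ r * n := Nat.mul_le_mul_left _ h3

theorem load_lt_of_pairStable {n : ℕ} {χ : ℕ → ℕ → ℕ} (hs : ∀ u v, χ u v = χ v u) {a b s L : ℕ}
    (hp : PairStable n χ a b s) (hL : ∀ v < n, ∀ l, load n χ v l ≤ L) {k y m : ℕ} (hk : 0 < k)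
    (hL0 : 0 < L) (hy : L ≤ y * k) (hm : n < 2 ^ m) {v : ℕ} (hv : v < n) :
    load n χ v a < load n χ v b + (k + y * m * s) := by
  by_contra! h
  have h1 := pow_le_of_imbalance hs hp hL hk (y * m) hv h
  have hy0 : y ≠ 0 := by rintro rfl; omega
  -- Bernoulli's inequality
  have h2 : 2 * L ^ y ≤ (k + L) ^ y := by
    have := one_add_mul_le_pow (a := (k : ℝ) / L) (by
      have : (0 : ℝ) ≤ (k : ℝ) / L := by positivity
      linarith) y
    have hLr : (0 : ℝ) < L := by exact_mod_cast hL0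
    have h3 : (2 : ℝ) ≤ 1 + y * ((k : ℝ) / L) := by
      have : (1 : ℝ) ≤ y * ((k : ℝ) / L) := by
        rw [← mul_div_assoc, le_div_iff₀ hLr, one_mul]
        exact_mod_cast hy
      linarith
    have h4 : (2 : ℝ) * L ^ y ≤ (k + L) ^ y := by
      calc (2 : ℝ) * L ^ y ≤ (1 + (k : ℝ) / L) ^ y * L ^ y := by gcongr; linarith
        _ = (k + L) ^ y := by
          rw [← mul_pow]; congr 1; field_simp; ring
    exact_mod_cast h4
  have h5 : 2 ^ m * L ^ (y * m) ≤ L ^ (y * m) * n := by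
    calc 2 ^ m * L ^ (y * m) = (2 * L ^ y) ^ m := by rw [mul_pow, pow_mul]
      _ ≤ ((k + L) ^ y) ^ m := Nat.pow_le_pow_left h2 m
      _ = (k + L) ^ (y * m) := by rw [pow_mul]
      _ ≤ _ := h1
  rw [mul_comm] at h5
  have := Nat.le_of_mul_le_mul_left h5 (by positivity)
  omega

/-- Walking up the colour tree, from `a` to the root takes at most `m` steps if `a < 2 ^ m`. -/
theorem load_dist_root {f : ℕ → ℕ} {T K : ℕ}
    (h : ∀ a < T, f a ≤ f ((a - 1) / 2) + K ∧ f ((a - 1) / 2) ≤ f a + K) :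
    ∀ m a, a < T → a + 1 < 2 ^ (m + 1) → f a ≤ f 0 + m * K ∧ f 0 ≤ f a + m * K := by
  intro m
  induction m with
  | zero =>
    intro a _ ham
    obtain rfl : a = 0 := by simp at ham; omega
    simp
  | succ m ih =>
    intro a haT ham
    rw [pow_succ] at ham
    have h1 := ih ((a - 1) / 2) (by omega) (by omega)
    have h2 := h a haT
    have e : (m + 1) * K = m * K + K := by ring
    rw [e]
    omega

/-- In a colouring without violations the loads of all colours at a vertex are nearly equal. -/
theorem load_le_of_stable {n T q L : ℕ} {χ : ℕ → ℕ → ℕ} (hχ : IsColouring T χ)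
    (hstable : ∀ u < n, ∀ v < n, ¬ Violating n T q χ u v)
    (hL : ∀ v < n, ∀ l, load n χ v l ≤ L) {y m k : ℕ} (hk : 0 < k)
    (hL0 : 0 < L) (hy : L ≤ y * k) (hm : n < 2 ^ m) (hTm : T < 2 ^ (m + 1))
    {v : ℕ} (hv : v < n) {a b : ℕ} (ha : a < T) (hb : b < T) :
    load n χ v a ≤ load n χ v b + 2 * m * (k + y * m * (2 + 8 * L / q)) := by
  have hcost : ∀ u < n, ∀ v < n, ∀ l, inspectCost n χ u v l ≤ 8 * L := by
    intro u hu v hv l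
    have h1 := hL u hu l
    have h2 := hL u hu ((l - 1) / 2)
    have h3 := hL u hu (2 * l + 1)
    have h4 := hL u hu (2 * l + 2)
    have h5 := hL v hv l
    have h6 := hL v hv ((l - 1) / 2)
    have h7 := hL v hv (2 * l + 1)
    have h8 := hL v hv (2 * l + 2)
    unfold inspectCost nearSum
    omega
  have hedge : ∀ u < n, ∀ v < n, ∀ l l', χ u v = l + 1 → Near l l' → l' < T →
      load n χ u l + load n χ v l ≤ load n χ u l' + load n χ v l' + (2 + 8 * L / q) := by
    intro u hu v hv l l' hl hll hlT
    by_contra! hcon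
    refine hstable u hu v hv ⟨l, l', hl, hll, hlT, ?_⟩
    have := Nat.div_le_div_right (c := q) (hcost u hu v hv l)
    generalize 8 * L / q = d at *
    generalize inspectCost n χ u v l / q = d' at *
    omega
  have hpair : ∀ l < T, PairStable n χ l ((l - 1) / 2) (2 + 8 * L / q) := by
    intro l hl u hu v hv
    refine ⟨fun h => hedge u hu v hv _ _ h (.inr (.inl rfl)) (by omega), fun h => ?_⟩
    exact hedge u hu v hv _ _ h (Near.symm (.inr (.inl rfl))) hl
  have hpair' : ∀ l < T, PairStable n χ ((l - 1) / 2) l (2 + 8 * L / q) :=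
    fun l hl u hu v hv => (hpair l hl u hu v hv).symm
  have hroot := load_dist_root (f := load n χ v) (T := T)
    (K := k + y * m * (2 + 8 * L / q)) (fun l hl =>
      ⟨(load_lt_of_pairStable hχ.symm (hpair l hl) hL hk hL0 hy hm hv).le,
        (load_lt_of_pairStable hχ.symm (hpair' l hl) hL hk hL0 hy hm hv).le⟩)
  have h1 := (hroot m a ha (by omega)).1
  have h2 := (hroot m b hb (by omega)).2
  rw [mul_assoc, two_mul]
  omega

/-! ### A compiler from expressions to word-RAM code -/

/-- Expressions over registers and memory. -/
inductive Ex where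
  | reg (x : ℕ)
  | const (k : ℕ)
  | op (o : WordOp) (a b : Ex)
  | load (a : Ex)

/-- The value of an expression, with the wrap-around of the word operations. -/
def Ex.eval (w : ℕ) (σ : State) : Ex → ℕ
  | .reg x => σ.reg x
  | .const k => k % 2 ^ w
  | .op o a b => o.eval w (a.eval w σ) (b.eval w σ)
  | .load a => σ.mem (a.eval w σ)

/-- The registers below `32` are the variables; the others are scratch space for the evaluation
of expressions. An expression may only mention variables. -/
def Ex.Wf : Ex → Prop
  | .reg x => x < 32
  | .const _ => True
  | .op _ a b => a.Wf ∧ b.Wf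
  | .load a => a.Wf

/-- Code that leaves the value of the expression in register `d` and otherwise changes only
registers above `d`. A move from register `x` is a subtraction of `0`, which never wraps around. -/
def Ex.compile : Ex → ℕ → Code
  | .reg x, d => .seq (.instr (.const d 0)) (.instr (.op .sub d x d))
  | .const k, d => .instr (.const d k)
  | .op o a b, d => .seq (a.compile d) (.seq (b.compile (d + 1)) (.instr (.op o d d (d + 1))))
  | .load a, d => .seq (a.compile d) (.instr (.load d d))

/-- The running time of the compiled expression. -/
def Ex.cost : Ex → ℕ
  | .reg _ => 2
  | .const _ => 1
  | .op _ a b => a.cost + (b.cost + 1)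
  | .load a => a.cost + 1

/-- Two states agree up to the scratch registers. -/
def Sim (s σ : State) : Prop :=
  (∀ r < 32, s.reg r = σ.reg r) ∧ s.mem = σ.mem ∧ s.out = σ.out

theorem Sim.refl (s : State) : Sim s s := ⟨fun _ _ => rfl, rfl, rfl⟩

theorem Ex.eval_congr {w : ℕ} {s σ : State} (h : Sim s σ) :
    ∀ e : Ex, e.Wf → e.eval w s = e.eval w σ
  | .reg x, hx => h.1 x hx
  | .const _, _ => rfl
  | .op o a b, hx => by
      simp only [Ex.eval]; rw [Ex.eval_congr h a hx.1, Ex.eval_congr h b hx.2]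
  | .load a, hx => by simp only [Ex.eval]; rw [Ex.eval_congr h a hx, h.2.1]

theorem Ex.compile_exec (w : ℕ) : ∀ (e : Ex) (d : ℕ) (s : State), 32 ≤ d → e.Wf →
    ∃ s', Exec w (e.compile d) s s' e.cost ∧ s'.reg d = e.eval w s ∧
      (∀ r < d, s'.reg r = s.reg r) ∧ s'.mem = s.mem ∧ s'.out = s.out
  | .reg x, d, s, hd, hx => by
      refine ⟨_, Exec.seq (Exec.instr _ _) (Exec.instr _ _), ?_, ?_, rfl, rfl⟩
      · have hx : x < 32 := hx
        have : x ≠ d := by omega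
        simp [Instr.exec, WordOp.eval, Ex.eval, this]
      · intro r hr
        have : r ≠ d := by omega
        simp [Instr.exec, this]
  | .const k, d, s, hd, _ => by
      refine ⟨_, Exec.instr _ _, ?_, ?_, rfl, rfl⟩
      · simp [Instr.exec, Ex.eval]
      · intro r hr
        have : r ≠ d := by omega
        simp [Instr.exec, this]
  | .op o a b, d, s, hd, hx => by
      obtain ⟨s1, e1, v1, r1, m1, o1⟩ := Ex.compile_exec w a d s hd hx.1
      obtain ⟨s2, e2, v2, r2, m2, o2⟩ := Ex.compile_exec w b (d + 1) s1 (by omega) hx.2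
      have hsim : Sim s1 s := ⟨fun r hr => r1 r (by omega), m1, o1⟩
      refine ⟨_, Exec.seq e1 (Exec.seq e2 (Exec.instr _ _)), ?_, ?_, ?_, ?_⟩
      · simp [Instr.exec, Ex.eval, v2, r2 d (by omega), v1, Ex.eval_congr hsim b hx.2]
      · intro r hr
        have : r ≠ d := by omega
        simp [Instr.exec, this, r2 r (by omega), r1 r hr]
      · simp [Instr.exec, m2, m1]
      · simp [Instr.exec, o2, o1]
  | .load a, d, s, hd, hx => by
      obtain ⟨s1, e1, v1, r1, m1, o1⟩ := Ex.compile_exec w a d s hd hx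
      refine ⟨_, Exec.seq e1 (Exec.instr _ _), ?_, ?_, m1, o1⟩
      · simp [Instr.exec, Ex.eval, v1, m1]
      · intro r hr
        have : r ≠ d := by omega
        simp [Instr.exec, this, r1 r hr]

/-- `Runs w p σ σ' k`: started in `σ`, the code halts in `σ'` after at most `k` steps, up to the
contents of the scratch registers. -/
def Runs (w : ℕ) (p : Code) (σ σ' : State) (k : ℕ) : Prop :=
  ∀ s, Sim s σ → ∃ s' k', Exec w p s s' k' ∧ k' ≤ k ∧ Sim s' σ'

theorem Runs.mono {w : ℕ} {p : Code} {σ σ' : State} {k l : ℕ} (h : Runs w p σ σ' k) (hkl : k ≤ l) :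
    Runs w p σ σ' l := fun s hs =>
  let ⟨s', k', h1, h2, h3⟩ := h s hs
  ⟨s', k', h1, h2.trans hkl, h3⟩

theorem Runs.seq {w : ℕ} {p q : Code} {σ σ' σ'' : State} {k l : ℕ} (h1 : Runs w p σ σ' k)
    (h2 : Runs w q σ' σ'' l) : Runs w (.seq p q) σ σ'' (k + l) := fun s hs =>
  let ⟨_, _, e1, t1, hs1⟩ := h1 s hs
  let ⟨s2, _, e2, t2, hs2⟩ := h2 _ hs1
  ⟨s2, _, Exec.seq e1 e2, by omega, hs2⟩

/-- `if a < b then p else q`. -/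
def ite (a b : Ex) (p q : Code) : Code :=
  .seq (a.compile 32) (.seq (b.compile 33) (.branch 32 33 p q))

theorem compile_two (w : ℕ) (a b : Ex) (ha : a.Wf) (hb : b.Wf) (s σ : State) (hs : Sim s σ) :
    ∃ s1 s2, Exec w (a.compile 32) s s1 a.cost ∧ Exec w (b.compile 33) s1 s2 b.cost ∧ Sim s2 σ ∧
      s2.reg 32 = a.eval w σ ∧ s2.reg 33 = b.eval w σ := by
  obtain ⟨s1, e1, v1, r1, m1, o1⟩ := Ex.compile_exec w a 32 s le_rfl ha
  obtain ⟨s2, e2, v2, r2, m2, o2⟩ := Ex.compile_exec w b 33 s1 (by omega) hb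
  have h1 : Sim s1 σ := ⟨fun r hr => (r1 r hr).trans (hs.1 r hr), m1.trans hs.2.1, o1.trans hs.2.2⟩
  refine ⟨s1, s2, e1, e2, ⟨fun r hr => (r2 r (by omega)).trans (h1.1 r hr), m2.trans h1.2.1,
    o2.trans h1.2.2⟩, ?_, ?_⟩
  · rw [r2 32 (by omega), v1, Ex.eval_congr hs a ha]
  · rw [v2, Ex.eval_congr h1 b hb]

theorem Runs.ite_pos {w : ℕ} {a b : Ex} {p q : Code} {σ σ' : State} {k : ℕ} (ha : a.Wf) (hb : b.Wf)
    (h : a.eval w σ < b.eval w σ) (hp : Runs w p σ σ' k) :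
    Runs w (ite a b p q) σ σ' (a.cost + b.cost + k + 1) := by
  intro s hs
  obtain ⟨s1, s2, e1, e2, hs2, v1, v2⟩ := compile_two w a b ha hb s σ hs
  obtain ⟨s3, k3, e3, t3, hs3⟩ := hp s2 hs2
  exact ⟨s3, _, Exec.seq e1 (Exec.seq e2 (Exec.branch_then (by rw [v1, v2]; exact h) e3)),
    by omega, hs3⟩

theorem Runs.ite_neg {w : ℕ} {a b : Ex} {p q : Code} {σ σ' : State} {k : ℕ} (ha : a.Wf) (hb : b.Wf)
    (h : ¬ a.eval w σ < b.eval w σ) (hp : Runs w q σ σ' k) :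
    Runs w (ite a b p q) σ σ' (a.cost + b.cost + k + 1) := by
  intro s hs
  obtain ⟨s1, s2, e1, e2, hs2, v1, v2⟩ := compile_two w a b ha hb s σ hs
  obtain ⟨s3, k3, e3, t3, hs3⟩ := hp s2 hs2
  exact ⟨s3, _, Exec.seq e1 (Exec.seq e2 (Exec.branch_else (by rw [v1, v2]; exact h) e3)),
    by omega, hs3⟩

theorem Runs.loop_exit {w a b : ℕ} {p : Code} {σ : State} (ha : a < 32) (hb : b < 32)
    (h : ¬ σ.reg a < σ.reg b) : Runs w (.loop a b p) σ σ 1 := fun s hs =>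
  ⟨s, 1, Exec.loop_exit (by rwa [hs.1 a ha, hs.1 b hb]), le_rfl, hs⟩

theorem Runs.loop_step {w a b : ℕ} {p : Code} {σ σ' σ'' : State} {k l : ℕ} (ha : a < 32)
    (hb : b < 32) (h : σ.reg a < σ.reg b) (hp : Runs w p σ σ' k)
    (hl : Runs w (.loop a b p) σ' σ'' l) : Runs w (.loop a b p) σ σ'' (k + l + 1) := fun s hs =>
  let ⟨_, _, e1, t1, hs1⟩ := hp s hs
  let ⟨s2, _, e2, t2, hs2⟩ := hl _ hs1
  ⟨s2, _, Exec.loop_step (by rwa [hs.1 a ha, hs.1 b hb]) e1 e2, by omega, hs2⟩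

/-- Statements without control flow: assignments, writes to the memory, and output. -/
inductive Stm where
  | set (x : ℕ) (e : Ex)
  | store (a e : Ex)
  | insert (g u v : ℕ)
  | delete (g u v : ℕ)

/-- The effect of a statement, apart from the scratch registers. -/
def Stm.exec (w : ℕ) (σ : State) : Stm → State
  | .set x e => { σ with reg := Function.update σ.reg x (e.eval w σ) }
  | .store a e => { σ with mem := Function.update σ.mem (a.eval w σ) (e.eval w σ) }
  | .insert g u v => { σ with out := .insert (σ.reg g) (σ.reg u) (σ.reg v) :: σ.out }
  | .delete g u v => { σ with out := .delete (σ.reg g) (σ.reg u) (σ.reg v) :: σ.out }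

/-- A statement may only mention variables. -/
def Stm.Wf : Stm → Prop
  | .set x e => x < 32 ∧ e.Wf
  | .store a e => a.Wf ∧ e.Wf
  | .insert g u v => g < 32 ∧ u < 32 ∧ v < 32
  | .delete g u v => g < 32 ∧ u < 32 ∧ v < 32

/-- The code of a statement. -/
def Stm.compile : Stm → Code
  | .set x e => .seq (e.compile 32) (.seq (.instr (.const 33 0)) (.instr (.op .sub x 32 33)))
  | .store a e => .seq (a.compile 32) (.seq (e.compile 33) (.instr (.store 32 33)))
  | .insert g u v => .instr (.emitInsert g u v)
  | .delete g u v => .instr (.emitDelete g u v)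

/-- The running time of a statement. -/
def Stm.cost : Stm → ℕ
  | .set _ e => e.cost + 2
  | .store a e => a.cost + (e.cost + 1)
  | .insert _ _ _ => 1
  | .delete _ _ _ => 1

theorem Stm.runs (w : ℕ) (σ : State) : ∀ c : Stm, c.Wf → Runs w c.compile σ (c.exec w σ) c.cost
  | .set x e, hx => fun s hs => by
      have h32 : x < 32 := hx.1
      obtain ⟨s1, e1, v1, r1, m1, o1⟩ := Ex.compile_exec w e 32 s le_rfl hx.2
      refine ⟨_, _, Exec.seq e1 (Exec.seq (Exec.instr _ _) (Exec.instr _ _)), le_rfl,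
        fun r hr => ?_, m1.trans hs.2.1, o1.trans hs.2.2⟩
      by_cases hrx : r = x
      · subst hrx
        simp [Instr.exec, WordOp.eval, Stm.exec, v1, Ex.eval_congr hs e hx.2]
      · have : r ≠ 33 := by omega
        simp [Instr.exec, Stm.exec, hrx, this, r1 r hr, hs.1 r hr]
  | .store a e, hx => fun s hs => by
      obtain ⟨s1, s2, e1, e2, hs2, v1, v2⟩ := compile_two w a e hx.1 hx.2 s σ hs
      refine ⟨_, _, Exec.seq e1 (Exec.seq e2 (Exec.instr _ _)), le_rfl, hs2.1, ?_, hs2.2.2⟩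
      simp [Instr.exec, Stm.exec, v1, v2, hs2.2.1]
  | .insert g u v, hx => fun s hs => by
      refine ⟨_, _, Exec.instr _ _, le_rfl, hs.1, hs.2.1, ?_⟩
      simp [Instr.exec, Stm.exec, hs.1 g hx.1, hs.1 u hx.2.1, hs.1 v hx.2.2, hs.2.2]
  | .delete g u v, hx => fun s hs => by
      refine ⟨_, _, Exec.instr _ _, le_rfl, hs.1, hs.2.1, ?_⟩
      simp [Instr.exec, Stm.exec, hs.1 g hx.1, hs.1 u hx.2.1, hs.1 v hx.2.2, hs.2.2]

/-- The effect of a list of statements. -/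
def execBlock (w : ℕ) : List Stm → State → State
  | [], σ => σ
  | c :: cs, σ => execBlock w cs (c.exec w σ)

/-- The code of a list of statements. -/
def block : List Stm → Code
  | [] => .instr (.const 32 0)
  | c :: cs => .seq c.compile (block cs)

/-- The running time of a list of statements. -/
def blockCost : List Stm → ℕ
  | [] => 1
  | c :: cs => c.cost + blockCost cs

theorem block_runs (w : ℕ) : ∀ (cs : List Stm) (σ : State), (∀ c ∈ cs, c.Wf) →
    Runs w (block cs) σ (execBlock w cs σ) (blockCost cs)
  | [], σ, _ => fun s hs => by
      refine ⟨_, _, Exec.instr _ _, le_rfl, fun r hr => ?_, hs.2.1, hs.2.2⟩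
      have : r ≠ 32 := by omega
      simp [Instr.exec, this, execBlock, hs.1 r hr]
  | c :: cs, σ, h =>
      (c.runs w σ (h c List.mem_cons_self)).seq
        (block_runs w cs _ fun c' hc' => h c' (List.mem_cons_of_mem _ hc'))

theorem execBlock_append (w : ℕ) (cs ds : List Stm) (σ : State) :
    execBlock w (cs ++ ds) σ = execBlock w ds (execBlock w cs σ) := by
  induction cs generalizing σ with
  | nil => rfl
  | cons c cs ih => exact ih _

/-- Every step issues at most one command. -/
theorem Exec.out_length_le {w : ℕ} {p : Code} {s s' : State} {k : ℕ} (h : Exec w p s s' k) :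
    s'.out.length ≤ s.out.length + k := by
  induction h with
  | instr I s => cases I <;> simp [Instr.exec]
  | seq _ _ ih1 ih2 => omega
  | branch_then _ _ ih => omega
  | branch_else _ _ ih => omega
  | loop_step _ _ _ ih1 ih2 => omega
  | loop_exit _ => simp

/-! ### Memory layout -/

/-- The address of the number of edges of colour `l` at `v`. -/
def cntAt (N v l : ℕ) : ℕ := 8 * (v * N + l) + 3

/-- The address of entry `i` of the list of the neighbours of `v` by edges of colour `l`. -/
def lstAt (N v l i : ℕ) : ℕ := 8 * ((v * N + l) * N + i) + 4

/-- The address of the colour, increased by one, of the edge `vx`, or `0` if it is absent. -/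
def colAt (N v x : ℕ) : ℕ := 8 * (v * N + x) + 5

/-- The address of the position of `x` in the list of `v` in which it occurs. -/
def posAt (N v x : ℕ) : ℕ := 8 * (v * N + x) + 6

/-- The address of entry `j` of the stack of edges to be inspected. -/
def stkAt (j : ℕ) : ℕ := 8 * j + 7

theorem index_inj {N v l v' l' : ℕ} (hl : l < N) (hl' : l' < N) :
    v * N + l = v' * N + l' ↔ v = v' ∧ l = l' := by
  constructor
  · intro h
    have hN : 0 < N := by omega
    have h1 : (v * N + l) / N = v := by
      rw [mul_comm, Nat.mul_add_div hN, Nat.div_eq_of_lt hl, add_zero]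
    have h2 : (v' * N + l') / N = v' := by
      rw [mul_comm, Nat.mul_add_div hN, Nat.div_eq_of_lt hl', add_zero]
    have h3 : v = v' := by rw [← h1, ← h2, h]
    subst h3
    exact ⟨rfl, by omega⟩
  · rintro ⟨rfl, rfl⟩
    rfl

theorem cntAt_inj {N v l v' l' : ℕ} (hl : l < N) (hl' : l' < N) :
    cntAt N v l = cntAt N v' l' ↔ v = v' ∧ l = l' := by
  rw [← index_inj hl hl']; unfold cntAt; omega

theorem colAt_inj {N v l v' l' : ℕ} (hl : l < N) (hl' : l' < N) :
    colAt N v l = colAt N v' l' ↔ v = v' ∧ l = l' := by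
  rw [← index_inj hl hl']; unfold colAt; omega

theorem posAt_inj {N v l v' l' : ℕ} (hl : l < N) (hl' : l' < N) :
    posAt N v l = posAt N v' l' ↔ v = v' ∧ l = l' := by
  rw [← index_inj hl hl']; unfold posAt; omega

theorem lstAt_inj {N v l i v' l' i' : ℕ} (hl : l < N) (hl' : l' < N) (hi : i < N) (hi' : i' < N) :
    lstAt N v l i = lstAt N v' l' i' ↔ v = v' ∧ l = l' ∧ i = i' := by
  rw [← and_assoc, ← index_inj hl hl', ← index_inj hi hi']; unfold lstAt; omega

/-- The memory `m` represents the colouring `χ` by colours, lists of edges by end point and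
colour, and the positions in these lists. -/
structure Represents (n N : ℕ) (m : ℕ → ℕ) (χ : ℕ → ℕ → ℕ) : Prop where
  col : ∀ v < n, ∀ x < n, m (colAt N v x) = χ v x
  lst : ∀ v < n, ∀ l < N, ∀ i < m (cntAt N v l),
    m (lstAt N v l i) < n ∧ χ v (m (lstAt N v l i)) = l + 1 ∧ m (posAt N v (m (lstAt N v l i))) = i
  pos : ∀ v < n, ∀ x < n, ∀ l < N, χ v x = l + 1 →
    m (posAt N v x) < m (cntAt N v l) ∧ m (lstAt N v l (m (posAt N v x))) = x

theorem Represents.cnt {n N : ℕ} {m : ℕ → ℕ} {χ : ℕ → ℕ → ℕ} (h : Represents n N m χ) {v l : ℕ}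
    (hv : v < n) (hl : l < N) : m (cntAt N v l) = load n χ v l := by
  rw [load, ← Finset.card_range (m (cntAt N v l))]
  refine Finset.card_nbij' (fun i => m (lstAt N v l i)) (fun x => m (posAt N v x)) ?_ ?_ ?_ ?_
  · intro i hi
    have := h.lst v hv l hl i (by simpa using hi)
    simpa using ⟨this.1, this.2.1⟩
  · intro x hx
    have hx : x < n ∧ χ v x = l + 1 := by simpa using hx
    simpa using (h.pos v hv x hx.1 l hl hx.2).1
  · intro i hi
    exact (h.lst v hv l hl i (by simpa using hi)).2.2
  · intro x hx
    have hx : x < n ∧ χ v x = l + 1 := by simpa using hx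
    exact (h.pos v hv x hx.1 l hl hx.2).2

/-- Appending `x` to the list of `v` of colour `k`. -/
def memAdd (N : ℕ) (m : ℕ → ℕ) (v x k : ℕ) : ℕ → ℕ :=
  Function.update (Function.update (Function.update (Function.update m
    (lstAt N v k (m (cntAt N v k))) x) (posAt N v x) (m (cntAt N v k)))
    (cntAt N v k) (m (cntAt N v k) + 1)) (colAt N v x) (k + 1)

/-- Removing `x` from the list of `v` of colour `k`; the last entry of the list takes its place. -/
def memRemove (N : ℕ) (m : ℕ → ℕ) (v x k : ℕ) : ℕ → ℕ :=
  Function.update (Function.update (Function.update (Function.update m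
    (lstAt N v k (m (posAt N v x))) (m (lstAt N v k (m (cntAt N v k) - 1))))
    (posAt N v (m (lstAt N v k (m (cntAt N v k) - 1)))) (m (posAt N v x)))
    (cntAt N v k) (m (cntAt N v k) - 1)) (colAt N v x) 0

/-- The two memories agree on the stack and on the parameters in the cells `0`, `1`, `2`. -/
def AgreeAux (m m' : ℕ → ℕ) : Prop := ∀ a, a % 8 = 7 ∨ a < 3 → m' a = m a

/-- The two memories agree on the representation of the colouring. -/
def AgreeRep (m m' : ℕ → ℕ) : Prop := ∀ a, a % 8 ≠ 7 → m' a = m a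

theorem AgreeAux.trans {m m' m'' : ℕ → ℕ} (h : AgreeAux m m') (h' : AgreeAux m' m'') :
    AgreeAux m m'' := fun a ha => (h' a ha).trans (h a ha)

theorem AgreeRep.trans {m m' m'' : ℕ → ℕ} (h : AgreeRep m m') (h' : AgreeRep m' m'') :
    AgreeRep m m'' := fun a ha => (h' a ha).trans (h a ha)

theorem AgreeRep.represents {n N : ℕ} {m m' : ℕ → ℕ} {χ : ℕ → ℕ → ℕ} (h : AgreeRep m m')
    (hr : Represents n N m χ) : Represents n N m' χ := by
  have h1 : ∀ v l, m' (cntAt N v l) = m (cntAt N v l) := fun v l => h _ (by unfold cntAt; omega)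
  have h2 : ∀ v l i, m' (lstAt N v l i) = m (lstAt N v l i) :=
    fun v l i => h _ (by unfold lstAt; omega)
  have h3 : ∀ v l, m' (colAt N v l) = m (colAt N v l) := fun v l => h _ (by unfold colAt; omega)
  have h4 : ∀ v l, m' (posAt N v l) = m (posAt N v l) := fun v l => h _ (by unfold posAt; omega)
  constructor
  · simpa only [h3] using hr.col
  · simpa only [h1, h2, h4] using hr.lst
  · simpa only [h1, h2, h4] using hr.pos

theorem agreeAux_memAdd (N : ℕ) (m : ℕ → ℕ) (v x k : ℕ) : AgreeAux m (memAdd N m v x k) := by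
  intro a ha
  unfold memAdd
  have h1 : a ≠ lstAt N v k (m (cntAt N v k)) := by unfold lstAt; omega
  have h2 : a ≠ posAt N v x := by unfold posAt; omega
  have h3 : a ≠ cntAt N v k := by unfold cntAt; omega
  have h4 : a ≠ colAt N v x := by unfold colAt; omega
  simp [h1, h2, h3, h4]

theorem agreeAux_memRemove (N : ℕ) (m : ℕ → ℕ) (v x k : ℕ) :
    AgreeAux m (memRemove N m v x k) := by
  intro a ha
  unfold memRemove
  have h1 : ∀ i, a ≠ lstAt N v k i := fun i => by unfold lstAt; omega
  have h2 : ∀ x, a ≠ posAt N v x := fun x => by unfold posAt; omega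
  have h3 : a ≠ cntAt N v k := by unfold cntAt; omega
  have h4 : a ≠ colAt N v x := by unfold colAt; omega
  simp [h1, h2, h3, h4]

/-- Reading after one write to each of the four arrays. -/
theorem read_update {N : ℕ} (m : ℕ → ℕ) {v k i z x : ℕ} (a b c d : ℕ) (hk : k < N) (hi : i < N)
    (hz : z < N) (hx : x < N) {m' : ℕ → ℕ}
    (hm' : m' = Function.update (Function.update (Function.update (Function.update m
      (lstAt N v k i) a) (posAt N v z) b) (cntAt N v k) c) (colAt N v x) d) :
    (∀ v' l', l' < N → m' (cntAt N v' l') = if v' = v ∧ l' = k then c else m (cntAt N v' l')) ∧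
    (∀ v' l' i', l' < N → i' < N → m' (lstAt N v' l' i') =
      if v' = v ∧ l' = k ∧ i' = i then a else m (lstAt N v' l' i')) ∧
    (∀ v' x', x' < N → m' (colAt N v' x') = if v' = v ∧ x' = x then d else m (colAt N v' x')) ∧
    (∀ v' x', x' < N → m' (posAt N v' x') = if v' = v ∧ x' = z then b else m (posAt N v' x')) := by
  subst hm'
  refine ⟨fun v' l' hl' => ?_, fun v' l' i' hl' hi' => ?_, fun v' x' hx' => ?_,
    fun v' x' hx' => ?_⟩
  · have h1 : cntAt N v' l' ≠ lstAt N v k i := by unfold cntAt lstAt; omega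
    have h2 : cntAt N v' l' ≠ posAt N v z := by unfold cntAt posAt; omega
    have h4 : cntAt N v' l' ≠ colAt N v x := by unfold cntAt colAt; omega
    simp [Function.update_apply, h1, h2, h4, cntAt_inj hl' hk]
  · have h1 : lstAt N v' l' i' ≠ cntAt N v k := by unfold cntAt lstAt; omega
    have h2 : lstAt N v' l' i' ≠ posAt N v z := by unfold lstAt posAt; omega
    have h4 : lstAt N v' l' i' ≠ colAt N v x := by unfold lstAt colAt; omega
    simp [Function.update_apply, h1, h2, h4, lstAt_inj hl' hk hi' hi]
  · have h1 : colAt N v' x' ≠ lstAt N v k i := by unfold colAt lstAt; omega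
    have h2 : colAt N v' x' ≠ posAt N v z := by unfold colAt posAt; omega
    have h4 : colAt N v' x' ≠ cntAt N v k := by unfold cntAt colAt; omega
    simp [Function.update_apply, h1, h2, h4, colAt_inj hx' hx]
  · have h1 : posAt N v' x' ≠ lstAt N v k i := by unfold posAt lstAt; omega
    have h2 : posAt N v' x' ≠ cntAt N v k := by unfold cntAt posAt; omega
    have h4 : posAt N v' x' ≠ colAt N v x := by unfold posAt colAt; omega
    simp [Function.update_apply, h1, h2, h4, posAt_inj hx' hz]

theorem Represents.memAdd {n N : ℕ} {m : ℕ → ℕ} {χ : ℕ → ℕ → ℕ} (h : Represents n N m χ)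
    (hnN : n < N) {v x k : ℕ} (hv : v < n) (hx : x < n) (hk : k < N) (hvx : χ v x = 0) :
    Represents n N (memAdd N m v x k) (halfSet χ v x (k + 1)) := by
  have hle : ∀ v < n, ∀ l < N, m (cntAt N v l) ≤ n := fun v hv l hl =>
    (h.cnt hv hl).trans_le (load_le _ _ _)
  obtain ⟨hC, hL, hK, hP⟩ := read_update m (v := v) (k := k) (i := m (cntAt N v k)) (z := x)
    (x := x)
    x (m (cntAt N v k)) (m (cntAt N v k) + 1) (k + 1) hk ((hle v hv k hk).trans_lt hnN)
    (hx.trans hnN) (hx.trans hnN) rfl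
  change ∀ v' l', l' < N → DegreeSplitting.memAdd N m v x k (cntAt N v' l') = _ at hC
  change ∀ v' l' i', l' < N → i' < N →
    DegreeSplitting.memAdd N m v x k (lstAt N v' l' i') = _ at hL
  change ∀ v' x', x' < N → DegreeSplitting.memAdd N m v x k (colAt N v' x') = _ at hK
  change ∀ v' x', x' < N → DegreeSplitting.memAdd N m v x k (posAt N v' x') = _ at hP
  generalize DegreeSplitting.memAdd N m v x k = m' at *
  constructor
  · intro v' hv' x' hx'
    rw [hK v' x' (hx'.trans hnN), h.col v' hv' x' hx']
    simp only [halfSet]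
  · intro v' hv' l' hl' i' hi'
    rw [hC v' l' hl'] at hi'
    have hcnt := hle v' hv' l' hl'
    have hcnt2 := hle v hv k hk
    have hi'N : i' < N := by split_ifs at hi' with hc <;> omega
    rw [hL v' l' i' hl' hi'N]
    by_cases hnew : v' = v ∧ l' = k ∧ i' = m (cntAt N v k)
    · obtain ⟨rfl, rfl, rfl⟩ := hnew
      simp only [and_self, if_true]
      rw [hP _ _ (hx.trans hnN)]
      simp [halfSet, hx]
    · have hi2 : i' < m (cntAt N v' l') := by
        split_ifs at hi' with hc
        · obtain ⟨rfl, rfl⟩ := hc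
          have : i' ≠ m (cntAt N v' l') := fun e => hnew ⟨rfl, rfl, e⟩
          omega
        · exact hi'
      obtain ⟨h1, h2, h3⟩ := h.lst v' hv' l' hl' i' hi2
      rw [if_neg hnew, hP _ _ (h1.trans hnN)]
      have hne : ¬ (v' = v ∧ m (lstAt N v' l' i') = x) := by
        rintro ⟨rfl, e⟩
        rw [e] at h2
        omega
      simp only [halfSet, if_neg hne]
      exact ⟨h1, h2, h3⟩
  · intro v' hv' x' hx' l' hl' hc
    rw [hP v' x' (hx'.trans hnN), hC v' l' hl']
    simp only [halfSet] at hc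
    by_cases hnew : v' = v ∧ x' = x
    · obtain ⟨rfl, rfl⟩ := hnew
      simp only [and_self, if_true] at hc
      obtain rfl : k = l' := by omega
      simp only [and_self, if_true]
      rw [hL _ _ _ hk ((hle _ hv' k hk).trans_lt hnN)]
      simp
    · rw [if_neg hnew] at hc ⊢
      obtain ⟨h1, h2⟩ := h.pos v' hv' x' hx' l' hl' hc
      have hb := hle v' hv' l' hl'
      rw [hL _ _ _ hl' (by omega)]
      refine ⟨by split_ifs with hh <;> [(obtain ⟨rfl, rfl⟩ := hh; omega); exact h1], ?_⟩
      rw [if_neg, h2]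
      rintro ⟨rfl, rfl, e⟩
      omega

theorem Represents.memRemove {n N : ℕ} {m : ℕ → ℕ} {χ : ℕ → ℕ → ℕ} (h : Represents n N m χ)
    (hnN : n < N) {v x k : ℕ} (hv : v < n) (hx : x < n) (hk : k < N) (hvx : χ v x = k + 1) :
    Represents n N (memRemove N m v x k) (halfSet χ v x 0) := by
  have hle : ∀ v < n, ∀ l < N, m (cntAt N v l) ≤ n := fun v hv l hl =>
    (h.cnt hv hl).trans_le (load_le _ _ _)
  have hlevk := hle v hv k hk
  obtain ⟨hpos, hlst⟩ := h.pos v hv x hx k hk hvx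
  obtain ⟨hz1, hz2, hz3⟩ := h.lst v hv k hk (m (cntAt N v k) - 1) (by omega)
  obtain ⟨hC, hL, hK, hP⟩ := read_update m (v := v) (k := k) (i := m (posAt N v x))
    (z := m (lstAt N v k (m (cntAt N v k) - 1))) (x := x)
    (m (lstAt N v k (m (cntAt N v k) - 1))) (m (posAt N v x)) (m (cntAt N v k) - 1) 0 hk
    (by omega) (hz1.trans hnN) (hx.trans hnN) rfl
  change ∀ v' l', l' < N → DegreeSplitting.memRemove N m v x k (cntAt N v' l') = _ at hC
  change ∀ v' l' i', l' < N → i' < N →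
    DegreeSplitting.memRemove N m v x k (lstAt N v' l' i') = _ at hL
  change ∀ v' x', x' < N → DegreeSplitting.memRemove N m v x k (colAt N v' x') = _ at hK
  change ∀ v' x', x' < N → DegreeSplitting.memRemove N m v x k (posAt N v' x') = _ at hP
  generalize DegreeSplitting.memRemove N m v x k = m' at *
  set z := m (lstAt N v k (m (cntAt N v k) - 1)) with hz
  constructor
  · intro v' hv' x' hx'
    rw [hK v' x' (hx'.trans hnN), h.col v' hv' x' hx']
    simp only [halfSet]
  · intro v' hv' l' hl' i' hi'
    rw [hC v' l' hl'] at hi'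
    have hcnt := hle v' hv' l' hl'
    have hi2 : i' < m (cntAt N v' l') := by
      split_ifs at hi' with hc
      · obtain ⟨rfl, rfl⟩ := hc; omega
      · exact hi'
    rw [hL v' l' i' hl' (by omega)]
    obtain ⟨h1, h2, h3⟩ := h.lst v' hv' l' hl' i' hi2
    by_cases hmoved : v' = v ∧ l' = k ∧ i' = m (posAt N v x)
    · obtain ⟨rfl, rfl, rfl⟩ := hmoved
      simp only [and_self, if_true] at hi' ⊢
      rw [hP _ _ (hz1.trans hnN)]
      have hzx : z ≠ x := by
        intro e
        rw [e] at hz3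
        omega
      simp [halfSet, hz1, hzx, hz2]
    · rw [if_neg hmoved, hP _ _ (h1.trans hnN)]
      have hne : ¬ (v' = v ∧ m (lstAt N v' l' i') = x) := by
        rintro ⟨rfl, e⟩
        rw [e] at h2 h3
        exact hmoved ⟨rfl, by omega, h3.symm⟩
      have hne2 : ¬ (v' = v ∧ m (lstAt N v' l' i') = z) := by
        rintro ⟨rfl, e⟩
        rw [e] at h2 h3
        obtain rfl : l' = k := by omega
        rw [if_pos ⟨rfl, rfl⟩] at hi'
        omega
      simp only [halfSet, if_neg hne, if_neg hne2]
      exact ⟨h1, h2, h3⟩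
  · intro v' hv' x' hx' l' hl' hc
    simp only [halfSet] at hc
    have hne : ¬ (v' = v ∧ x' = x) := by
      intro e
      rw [if_pos e] at hc
      omega
    rw [if_neg hne] at hc
    obtain ⟨h1, h2⟩ := h.pos v' hv' x' hx' l' hl' hc
    have hb := hle v' hv' l' hl'
    rw [hP v' x' (hx'.trans hnN), hC v' l' hl']
    by_cases hmoved : v' = v ∧ x' = z
    · obtain ⟨rfl, rfl⟩ := hmoved
      obtain rfl : l' = k := by omega
      simp only [and_self, if_true]
      rw [hL _ _ _ hk (by omega)]
      have : m (posAt N v' x) ≠ m (cntAt N v' l') - 1 := by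
        intro e
        have : z = x := by rw [hz, ← e, hlst]
        exact hne ⟨rfl, this⟩
      simp
      omega
    · rw [if_neg hmoved, hL _ _ _ hl' (by omega)]
      have hnp : ¬ (v' = v ∧ l' = k ∧ m (posAt N v' x') = m (posAt N v x)) := by
        rintro ⟨rfl, rfl, e⟩
        rw [e, hlst] at h2
        exact hne ⟨rfl, h2.symm⟩
      rw [if_neg hnp]
      refine ⟨?_, h2⟩
      split_ifs with hh
      · obtain ⟨rfl, rfl⟩ := hh
        have : m (posAt N v' x') ≠ m (cntAt N v' l') - 1 := by
          intro e
          rw [e] at h2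
          exact hmoved ⟨rfl, h2.symm⟩
        omega
      · exact h1

/-! ### Address computations and straight-line programs -/

/-- `a * N + b`. -/
def idxE (a b : Ex) : Ex := .op .add (.op .mul a (.reg 5)) b

/-- `8 * e + t`. -/
def tagE (t : ℕ) (e : Ex) : Ex := .op .add (.op .mul (.const 8) e) (.const t)

/-- The address computed by `cntAt`. -/
def cntE (v l : Ex) : Ex := tagE 3 (idxE v l)

/-- The address computed by `lstAt`. -/
def lstE (v l i : Ex) : Ex := tagE 4 (idxE (idxE v l) i)

/-- The address computed by `colAt`. -/
def colE (v x : Ex) : Ex := tagE 5 (idxE v x)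

/-- The address computed by `posAt`. -/
def posE (v x : Ex) : Ex := tagE 6 (idxE v x)

/-- `e + 1`. -/
def succE (e : Ex) : Ex := .op .add e (.const 1)

/-- `e - 1`. -/
def predE (e : Ex) : Ex := .op .sub e (.const 1)

/-- Append the vertex in register `x` to the list of the vertex in `v` and the colour in `k`. -/
def addHalf (v x k : ℕ) : List Stm :=
  [.set 12 (.load (cntE (.reg v) (.reg k))),
    .store (lstE (.reg v) (.reg k) (.reg 12)) (.reg x),
    .store (posE (.reg v) (.reg x)) (.reg 12),
    .store (cntE (.reg v) (.reg k)) (succE (.reg 12)),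
    .store (colE (.reg v) (.reg x)) (succE (.reg k))]

/-- Remove the vertex in register `x` from the list of the vertex in `v` and the colour in `k`. -/
def removeHalf (v x k : ℕ) : List Stm :=
  [.set 12 (predE (.load (cntE (.reg v) (.reg k)))),
    .set 13 (.load (posE (.reg v) (.reg x))),
    .set 14 (.load (lstE (.reg v) (.reg k) (.reg 12))),
    .store (lstE (.reg v) (.reg k) (.reg 13)) (.reg 14),
    .store (posE (.reg v) (.reg 14)) (.reg 13),
    .store (cntE (.reg v) (.reg k)) (.reg 12),
    .store (colE (.reg v) (.reg x)) (.const 0)]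

/-- Give the current edge, which is absent, the colour in register `k`. -/
def addEdge (k : ℕ) : List Stm := addHalf 0 1 k ++ (addHalf 1 0 k ++ [.insert k 0 1])

/-- Remove the current edge. -/
def removeEdge : List Stm := removeHalf 0 1 9 ++ (removeHalf 1 0 9 ++ [.delete 9 0 1])

section Eval

variable {w N : ℕ} {σ : State}

theorem index_lt {N a b : ℕ} (ha : a < N) (hb : b < N) : a * N + b < N * N := by
  calc a * N + b < a * N + N := by omega
    _ = (a + 1) * N := by ring
    _ ≤ N * N := Nat.mul_le_mul_right _ ha

theorem sq_le_cube (N : ℕ) : N * N ≤ N * N * N := by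
  rcases Nat.eq_zero_or_pos N with h | h
  · simp [h]
  · exact Nat.le_mul_of_pos_right _ h

theorem le_sq (N : ℕ) : N ≤ N * N := by
  rcases Nat.eq_zero_or_pos N with h | h
  · simp [h]
  · exact Nat.le_mul_of_pos_right _ h

theorem eval_tagE {t : ℕ} {e : Ex} (ht : t < 8) (h : 8 * e.eval w σ + 8 < 2 ^ w) :
    (tagE t e).eval w σ = 8 * e.eval w σ + t := by
  have h1 : 8 % 2 ^ w = 8 := Nat.mod_eq_of_lt (by omega)
  have h2 : t % 2 ^ w = t := Nat.mod_eq_of_lt (by omega)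
  simp only [tagE, Ex.eval, WordOp.eval]
  rw [h1, h2, Nat.mod_eq_of_lt (by omega : 8 * e.eval w σ < 2 ^ w), Nat.mod_eq_of_lt (by omega)]

theorem eval_idxE {a b : Ex} (h5 : σ.reg 5 = N)
    (h : a.eval w σ * N + b.eval w σ < 2 ^ w) :
    (idxE a b).eval w σ = a.eval w σ * N + b.eval w σ := by
  simp only [idxE, Ex.eval, WordOp.eval]
  rw [h5, Nat.mod_eq_of_lt (a := a.eval w σ * N) (by omega), Nat.mod_eq_of_lt h]

theorem eval_pairE (hR : 8 * (N * N * N) < 2 ^ w) (h5 : σ.reg 5 = N) {t : ℕ} (ht : t < 8)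
    {a b : Ex} {va vb : ℕ} (ha : a.eval w σ = va) (hb : b.eval w σ = vb) (hva : va < N)
    (hvb : vb < N) : (tagE t (idxE a b)).eval w σ = 8 * (va * N + vb) + t := by
  have h1 := index_lt hva hvb
  have h2 := sq_le_cube N
  have e := eval_idxE (w := w) h5 (a := a) (b := b) (by rw [ha, hb]; omega)
  rw [ha, hb] at e
  rw [eval_tagE ht (by rw [e]; omega), e]

theorem eval_reg {x v : ℕ} (h : σ.reg x = v) : (Ex.reg x).eval w σ = v := h

theorem eval_cntE (hR : 8 * (N * N * N) < 2 ^ w) (h5 : σ.reg 5 = N) {a b : Ex} {va vb : ℕ}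
    (ha : a.eval w σ = va) (hb : b.eval w σ = vb) (hva : va < N) (hvb : vb < N) :
    (cntE a b).eval w σ = cntAt N va vb :=
  eval_pairE hR h5 (by omega) ha hb hva hvb

theorem eval_colE (hR : 8 * (N * N * N) < 2 ^ w) (h5 : σ.reg 5 = N) {a b : Ex} {va vb : ℕ}
    (ha : a.eval w σ = va) (hb : b.eval w σ = vb) (hva : va < N) (hvb : vb < N) :
    (colE a b).eval w σ = colAt N va vb :=
  eval_pairE hR h5 (by omega) ha hb hva hvb

theorem eval_posE (hR : 8 * (N * N * N) < 2 ^ w) (h5 : σ.reg 5 = N) {a b : Ex} {va vb : ℕ}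
    (ha : a.eval w σ = va) (hb : b.eval w σ = vb) (hva : va < N) (hvb : vb < N) :
    (posE a b).eval w σ = posAt N va vb :=
  eval_pairE hR h5 (by omega) ha hb hva hvb

theorem eval_lstE (hR : 8 * (N * N * N) < 2 ^ w) (h5 : σ.reg 5 = N) {a b c : Ex}
    {va vb vc : ℕ} (ha : a.eval w σ = va) (hb : b.eval w σ = vb) (hc : c.eval w σ = vc)
    (hva : va < N) (hvb : vb < N) (hvc : vc < N) :
    (lstE a b c).eval w σ = lstAt N va vb vc := by
  have h1 := index_lt hva hvb
  have h2 := sq_le_cube N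
  have h3 : (va * N + vb) * N + vc < N * N * N := by
    calc (va * N + vb) * N + vc < (va * N + vb) * N + N := by omega
      _ = (va * N + vb + 1) * N := by ring
      _ ≤ N * N * N := Nat.mul_le_mul_right _ h1
  have e := eval_idxE (w := w) h5 (a := a) (b := b) (by rw [ha, hb]; omega)
  rw [ha, hb] at e
  have e' := eval_idxE (w := w) h5 (a := idxE a b) (b := c) (by rw [e, hc]; omega)
  rw [e, hc] at e'
  rw [lstE, eval_tagE (by omega) (by rw [e']; omega), e', lstAt]

end Eval

theorem execBlock_addHalf {w N n : ℕ} {σ : State} (hR : 8 * (N * N * N) < 2 ^ w)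
    (h5 : σ.reg 5 = N) (hnN : n < N) {χ : ℕ → ℕ → ℕ} (hr : Represents n N σ.mem χ) {v x k : ℕ}
    (hv : v < 12) (hx : x < 12) (hk : k < 12) (hvn : σ.reg v < n) (hxn : σ.reg x < n)
    (hkN : σ.reg k < N) :
    execBlock w (addHalf v x k) σ =
      { reg := Function.update σ.reg 12 (σ.mem (cntAt N (σ.reg v) (σ.reg k)))
        mem := memAdd N σ.mem (σ.reg v) (σ.reg x) (σ.reg k)
        out := σ.out } := by
  have hNw : N + 1 < 2 ^ w := by
    have := sq_le_cube N
    have := le_sq N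
    omega
  have hv' : v ≠ 12 := by omega
  have hx' : x ≠ 12 := by omega
  have hk' : k ≠ 12 := by omega
  have hc : σ.mem (cntAt N (σ.reg v) (σ.reg k)) ≤ n :=
    (hr.cnt hvn hkN).trans_le (load_le _ _ _)
  have h1 : 1 % 2 ^ w = 1 := Nat.mod_eq_of_lt (by omega)
  simp only [addHalf, execBlock, Stm.exec]
  -- every address is computed without wrap-around
  have e1 : (cntE (.reg v) (.reg k)).eval w σ = cntAt N (σ.reg v) (σ.reg k) :=
    eval_cntE hR h5 (eval_reg rfl) (eval_reg rfl) (hvn.trans hnN) hkN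
  have e1' : (Ex.load (cntE (.reg v) (.reg k))).eval w σ =
      σ.mem (cntAt N (σ.reg v) (σ.reg k)) := by rw [Ex.eval, e1]
  rw [e1']
  set c := σ.mem (cntAt N (σ.reg v) (σ.reg k)) with hcdef
  set R := Function.update σ.reg 12 c with hRdef
  have Rv : R v = σ.reg v := by simp [hRdef, hv']
  have Rx : R x = σ.reg x := by simp [hRdef, hx']
  have Rk : R k = σ.reg k := by simp [hRdef, hk']
  have Rc : R 12 = c := by simp [hRdef]
  have R5 : R 5 = N := by simp [hRdef, h5]
  clear_value R
  have cntE' : ∀ m o, (cntE (.reg v) (.reg k)).eval w ⟨R, m, o⟩ = cntAt N (σ.reg v) (σ.reg k) := by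
    intro m o
    exact eval_cntE (σ := ⟨R, m, o⟩) hR R5 (eval_reg Rv) (eval_reg Rk) (by omega) (by omega)
  have lstE' : ∀ m o, (lstE (.reg v) (.reg k) (.reg 12)).eval w ⟨R, m, o⟩ =
      lstAt N (σ.reg v) (σ.reg k) c := by
    intro m o
    exact eval_lstE (σ := ⟨R, m, o⟩) hR R5 (eval_reg Rv) (eval_reg Rk) (eval_reg Rc) (by omega)
      (by omega) (by omega)
  have posE' : ∀ m o, (posE (.reg v) (.reg x)).eval w ⟨R, m, o⟩ = posAt N (σ.reg v) (σ.reg x) := by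
    intro m o
    exact eval_posE (σ := ⟨R, m, o⟩) hR R5 (eval_reg Rv) (eval_reg Rx) (by omega) (by omega)
  have colE' : ∀ m o, (colE (.reg v) (.reg x)).eval w ⟨R, m, o⟩ = colAt N (σ.reg v) (σ.reg x) := by
    intro m o
    exact eval_colE (σ := ⟨R, m, o⟩) hR R5 (eval_reg Rv) (eval_reg Rx) (by omega) (by omega)
  simp only [cntE', lstE', posE', colE', succE, Ex.eval, WordOp.eval, Rc, Rx, Rk, h1]
  rw [Nat.mod_eq_of_lt (by omega : c + 1 < 2 ^ w),
    Nat.mod_eq_of_lt (by omega : σ.reg k + 1 < 2 ^ w)]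
  rfl

theorem execBlock_removeHalf {w N n : ℕ} {σ : State} (hR : 8 * (N * N * N) < 2 ^ w)
    (h5 : σ.reg 5 = N) (hnN : n < N) {χ : ℕ → ℕ → ℕ} (hr : Represents n N σ.mem χ) {v x k : ℕ}
    (hv : v < 12) (hx : x < 12) (hk : k < 12) (hvn : σ.reg v < n) (hxn : σ.reg x < n)
    (hkN : σ.reg k < N) (hvx : χ (σ.reg v) (σ.reg x) = σ.reg k + 1) :
    ∃ reg', (∀ r, r ≠ 12 → r ≠ 13 → r ≠ 14 → reg' r = σ.reg r) ∧
    execBlock w (removeHalf v x k) σ =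
      { reg := reg'
        mem := memRemove N σ.mem (σ.reg v) (σ.reg x) (σ.reg k)
        out := σ.out } := by
  have hNw : N + 1 < 2 ^ w := by
    have := sq_le_cube N
    have := le_sq N
    omega
  have hc : σ.mem (cntAt N (σ.reg v) (σ.reg k)) ≤ n :=
    (hr.cnt hvn hkN).trans_le (load_le _ _ _)
  obtain ⟨hpos, -⟩ := hr.pos _ hvn _ hxn _ hkN hvx
  obtain ⟨hz, -, -⟩ := hr.lst _ hvn _ hkN (σ.mem (cntAt N (σ.reg v) (σ.reg k)) - 1) (by omega)
  have h1 : 1 % 2 ^ w = 1 := Nat.mod_eq_of_lt (by omega)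
  have h0 : 0 % 2 ^ w = 0 := Nat.zero_mod _
  simp only [removeHalf, execBlock, Stm.exec]
  have e1 : (predE (.load (cntE (.reg v) (.reg k)))).eval w σ =
      σ.mem (cntAt N (σ.reg v) (σ.reg k)) - 1 := by
    rw [predE, Ex.eval, Ex.eval, Ex.eval, h1,
      eval_cntE hR h5 (eval_reg rfl) (eval_reg rfl) (hvn.trans hnN) hkN]
    rfl
  rw [e1]
  set c := σ.mem (cntAt N (σ.reg v) (σ.reg k)) - 1 with hcdef
  set R1 := Function.update σ.reg 12 c with hR1
  have R1' : ∀ r, r ≠ 12 → R1 r = σ.reg r := fun r hr => by simp [hR1, hr]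
  have e2 : (Ex.load (posE (.reg v) (.reg x))).eval w ⟨R1, σ.mem, σ.out⟩ =
      σ.mem (posAt N (σ.reg v) (σ.reg x)) := by
    rw [Ex.eval, eval_posE (σ := ⟨R1, σ.mem, σ.out⟩) hR ((R1' 5 (by omega)).trans h5)
      (eval_reg (R1' v (by omega))) (eval_reg (R1' x (by omega))) (by omega) (by omega)]
  rw [e2]
  set i := σ.mem (posAt N (σ.reg v) (σ.reg x)) with hidef
  set R2 := Function.update R1 13 i with hR2
  have R2' : ∀ r, r ≠ 12 → r ≠ 13 → R2 r = σ.reg r := fun r hr hr' => by simp [hR2, hr', R1' r hr]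
  have R212 : R2 12 = c := by simp [hR2, hR1]
  have e3 : (Ex.load (lstE (.reg v) (.reg k) (.reg 12))).eval w ⟨R2, σ.mem, σ.out⟩ =
      σ.mem (lstAt N (σ.reg v) (σ.reg k) c) := by
    rw [Ex.eval, eval_lstE (σ := ⟨R2, σ.mem, σ.out⟩) hR ((R2' 5 (by omega) (by omega)).trans h5)
      (eval_reg (R2' v (by omega) (by omega))) (eval_reg (R2' k (by omega) (by omega)))
      (eval_reg R212)
      (by omega) (by omega) (by omega)]
  rw [e3]
  set z := σ.mem (lstAt N (σ.reg v) (σ.reg k) c) with hzdef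
  set R := Function.update R2 14 z with hRdef
  have R' : ∀ r, r ≠ 12 → r ≠ 13 → r ≠ 14 → R r = σ.reg r := fun r hr hr' hr'' => by
    simp [hRdef, hr'', R2' r hr hr']
  have Rv : R v = σ.reg v := R' v (by omega) (by omega) (by omega)
  have Rx : R x = σ.reg x := R' x (by omega) (by omega) (by omega)
  have Rk : R k = σ.reg k := R' k (by omega) (by omega) (by omega)
  have R5 : R 5 = N := by rw [R' 5 (by omega) (by omega) (by omega), h5]
  have Rc : R 12 = c := by simp [hRdef, R212]
  have Ri : R 13 = i := by simp [hRdef, hR2]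
  have Rz : R 14 = z := by simp [hRdef]
  clear_value R
  have cntE' : ∀ m o, (cntE (.reg v) (.reg k)).eval w ⟨R, m, o⟩ = cntAt N (σ.reg v) (σ.reg k) := by
    intro m o
    exact eval_cntE (σ := ⟨R, m, o⟩) hR R5 (eval_reg Rv) (eval_reg Rk) (by omega) (by omega)
  have lstE' : ∀ m o, (lstE (.reg v) (.reg k) (.reg 13)).eval w ⟨R, m, o⟩ =
      lstAt N (σ.reg v) (σ.reg k) i := by
    intro m o
    exact eval_lstE (σ := ⟨R, m, o⟩) hR R5 (eval_reg Rv) (eval_reg Rk) (eval_reg Ri) (by omega)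
      (by omega) (by omega)
  have posE' : ∀ m o, (posE (.reg v) (.reg 14)).eval w ⟨R, m, o⟩ = posAt N (σ.reg v) z := by
    intro m o
    exact eval_posE (σ := ⟨R, m, o⟩) hR R5 (eval_reg Rv) (eval_reg Rz) (by omega) (by omega)
  have colE' : ∀ m o, (colE (.reg v) (.reg x)).eval w ⟨R, m, o⟩ = colAt N (σ.reg v) (σ.reg x) := by
    intro m o
    exact eval_colE (σ := ⟨R, m, o⟩) hR R5 (eval_reg Rv) (eval_reg Rx) (by omega) (by omega)
  refine ⟨R, R', ?_⟩
  simp only [cntE', lstE', posE', colE', Ex.eval, Rc, Ri, Rz, h0]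
  rfl

/-! ### Recolouring an edge -/

/-- The output describes the colour classes of `χ`. -/
def Describes (n : ℕ) (out : List Command) (χ : ℕ → ℕ → ℕ) : Prop :=
  ∀ (g : ℕ) (u v : Fin n),
    ((out.foldr Command.apply (fun _ => ⊥) : ℕ → SimpleGraph (Fin n)) g).Adj u v ↔
      χ u v = g + 1

theorem Describes.delete {n : ℕ} {out : List Command} {χ : ℕ → ℕ → ℕ} (h : Describes n out χ)
    {u v k : ℕ} (hu : u < n) (hv : v < n) (hk : χ u v = k + 1) (hs : χ u v = χ v u) :
    Describes n (.delete k u v :: out) (recolour χ u v 0) := by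
  intro g a b
  unfold Describes at h
  rw [List.foldr_cons]
  generalize (out.foldr Command.apply (fun _ => ⊥) : ℕ → SimpleGraph (Fin n)) = F at h
  have hF : ∀ g (a b : Fin n), (F g).Adj a b ↔ χ a b = g + 1 := h
  have hab : s(a, b) = s((⟨u, hu⟩ : Fin n), ⟨v, hv⟩) ↔
      ((a : ℕ) = u ∧ (b : ℕ) = v) ∨ ((a : ℕ) = v ∧ (b : ℕ) = u) := by
    rw [Sym2.eq_iff]
    simp only [Fin.ext_iff]
  simp only [Command.apply, hu, hv, and_self, dite_true, EdgeUpdate.apply, recolour_apply]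
  by_cases hg : g = k
  · subst hg
    rw [Function.update_self, SimpleGraph.deleteEdges_adj, Set.mem_singleton_iff, hab, hF]
    split_ifs with hc
    · simp [hc]
    · simp [hc]
  · rw [Function.update_of_ne hg, hF]
    split_ifs with hc
    · have : χ a b = k + 1 := by
        rcases hc with ⟨h1, h2⟩ | ⟨h1, h2⟩
        · rw [h1, h2, hk]
        · rw [h1, h2, ← hs, hk]
      rw [iff_false]
      omega
    · rfl

theorem Describes.insert {n : ℕ} {out : List Command} {χ : ℕ → ℕ → ℕ} (h : Describes n out χ)
    {u v k : ℕ} (hu : u < n) (hv : v < n) (huv : u ≠ v) (hk : χ u v = 0) (hs : χ u v = χ v u) :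
    Describes n (.insert k u v :: out) (recolour χ u v (k + 1)) := by
  intro g a b
  unfold Describes at h
  rw [List.foldr_cons]
  generalize (out.foldr Command.apply (fun _ => ⊥) : ℕ → SimpleGraph (Fin n)) = F at h
  have hF : ∀ g (a b : Fin n), (F g).Adj a b ↔ χ a b = g + 1 := h
  have hab : (SimpleGraph.edge (⟨u, hu⟩ : Fin n) ⟨v, hv⟩).Adj a b ↔
      ((a : ℕ) = u ∧ (b : ℕ) = v) ∨ ((a : ℕ) = v ∧ (b : ℕ) = u) := by
    rw [SimpleGraph.edge_adj]
    simp only [Fin.ext_iff, ne_eq]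
    omega
  simp only [Command.apply, hu, hv, and_self, dite_true, EdgeUpdate.apply, recolour_apply]
  have h0 : ((a : ℕ) = u ∧ (b : ℕ) = v) ∨ ((a : ℕ) = v ∧ (b : ℕ) = u) → χ a b = 0 := by
    rintro (⟨h1, h2⟩ | ⟨h1, h2⟩)
    · rw [h1, h2, hk]
    · rw [h1, h2, ← hs, hk]
  by_cases hg : g = k
  · subst hg
    rw [Function.update_self, SimpleGraph.sup_adj, hab, hF]
    split_ifs with hc
    · simp [hc]
    · simp [hc]
  · rw [Function.update_of_ne hg, hF]
    split_ifs with hc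
    · have := h0 hc
      constructor <;> intro <;> omega
    · rfl

/-- The numerical assumptions: the words are long enough for all addresses of the arrays, and all
colours that occur in address computations, including the children of a colour in the tree, are
below `4 * n`. -/
structure Fits (w n T q : ℕ) : Prop where
  room : 8 * (4 * n * (4 * n) * (4 * n)) < 2 ^ w
  le : T ≤ n
  pos : 0 < T
  qpos : 0 < q

/-- The registers hold the parameters. -/
structure Ready (n T q : ℕ) (σ : State) : Prop where
  hN : σ.reg 5 = 4 * n
  hT : σ.reg 6 = T
  hq : σ.reg 7 = q
  hzero : σ.reg 21 = 0

/-- The state stores the colouring `χ`, and its output describes it. -/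
structure Stores (n T : ℕ) (σ : State) (χ : ℕ → ℕ → ℕ) : Prop where
  colouring : IsColouring T χ
  represents : Represents n (4 * n) σ.mem χ
  describes : Describes n σ.out χ

theorem execBlock_removeEdge {w n T q : ℕ} {σ : State} {χ : ℕ → ℕ → ℕ} (hf : Fits w n T q)
    (hr : Ready n T q σ) (hs : Stores n T σ χ) {u v k : ℕ} (hu : σ.reg 0 = u) (hv : σ.reg 1 = v)
    (hk : σ.reg 9 = k) (hun : u < n) (hvn : v < n) (huv : u ≠ v) (hc : χ u v = k + 1) :
    Stores n T (execBlock w removeEdge σ) (recolour χ u v 0) ∧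
      AgreeAux σ.mem (execBlock w removeEdge σ).mem ∧
      ∀ r, r ≠ 12 → r ≠ 13 → r ≠ 14 → (execBlock w removeEdge σ).reg r = σ.reg r := by
  have hT := hf.le
  have hcT : χ u v ≤ T := hs.colouring.le u v
  obtain ⟨R1, hR1, e1⟩ := execBlock_removeHalf hf.room hr.hN (by omega) hs.represents (v := 0)
    (x := 1) (k := 9) (by omega) (by omega) (by omega) (by omega) (by omega) (by omega)
    (by rw [hu, hv, hk, hc])
  have hs1 := hs.represents.memRemove (by omega) hun hvn (by omega : k < 4 * n) hc
  rw [hu, hv, hk] at e1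
  have hc' : halfSet χ u v 0 v u = k + 1 := by
    simp only [halfSet]
    rw [if_neg (by omega), hs.colouring.symm, hc]
  obtain ⟨R2, hR2, e2⟩ := execBlock_removeHalf
    (σ := ⟨R1, memRemove (4 * n) σ.mem u v k, σ.out⟩) hf.room
    ((hR1 5 (by omega) (by omega) (by omega)).trans hr.hN) (by omega) hs1 (v := 1)
    (x := 0) (k := 9) (by omega) (by omega) (by omega)
    (by simpa [hR1, hv] using hvn) (by simpa [hR1, hu] using hun) (by simp [hR1, hk]; omega)
    (by simpa [hR1, hu, hv, hk] using hc')
  have hs2 := hs1.memRemove (by omega) hvn hun (by omega : k < 4 * n) hc'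
  simp only [hR1 0 (by omega) (by omega) (by omega), hR1 1 (by omega) (by omega) (by omega),
    hR1 9 (by omega) (by omega) (by omega), hu, hv, hk] at e2
  have hR : ∀ r, r ≠ 12 → r ≠ 13 → r ≠ 14 → R2 r = σ.reg r := fun r h1 h2 h3 => by
    rw [hR2 r h1 h2 h3]; exact hR1 r h1 h2 h3
  have e : execBlock w removeEdge σ =
      ⟨R2, memRemove (4 * n) (memRemove (4 * n) σ.mem u v k) v u k, .delete k u v :: σ.out⟩ := by
    rw [removeEdge, execBlock_append, execBlock_append, e1, e2]
    simp [execBlock, Stm.exec, hR, hu, hv, hk]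
  rw [e]
  exact ⟨⟨hs.colouring.recolour huv (Nat.zero_le _), hs2,
    hs.describes.delete hun hvn hc (hs.colouring.symm u v)⟩,
    (agreeAux_memRemove _ _ _ _ _).trans (agreeAux_memRemove _ _ _ _ _), hR⟩

theorem execBlock_addEdge {w n T q : ℕ} {σ : State} {χ : ℕ → ℕ → ℕ} (hf : Fits w n T q)
    (hr : Ready n T q σ) (hs : Stores n T σ χ) {r u v k : ℕ} (hr12 : r < 12) (hu : σ.reg 0 = u)
    (hv : σ.reg 1 = v) (hk : σ.reg r = k) (hun : u < n) (hvn : v < n) (huv : u ≠ v) (hkT : k < T)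
    (hc : χ u v = 0) :
    Stores n T (execBlock w (addEdge r) σ) (recolour χ u v (k + 1)) ∧
      AgreeAux σ.mem (execBlock w (addEdge r) σ).mem ∧
      ∀ r', r' ≠ 12 → (execBlock w (addEdge r) σ).reg r' = σ.reg r' := by
  have hT := hf.le
  have e1 := execBlock_addHalf hf.room hr.hN (by omega) hs.represents (v := 0)
    (x := 1) (k := r) (by omega) (by omega) (by omega) (by omega) (by omega) (by omega)
  have hs1 := hs.represents.memAdd (by omega) hun hvn (by omega : k < 4 * n) hc
  rw [hu, hv, hk] at e1
  have hc' : halfSet χ u v (k + 1) v u = 0 := by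
    simp only [halfSet]
    rw [if_neg (by omega), hs.colouring.symm, hc]
  set R1 := Function.update σ.reg 12 (σ.mem (cntAt (4 * n) u k)) with hR1def
  have hR1 : ∀ r, r ≠ 12 → R1 r = σ.reg r := fun r h => by simp [hR1def, h]
  have e2 := execBlock_addHalf
    (σ := ⟨R1, memAdd (4 * n) σ.mem u v k, σ.out⟩) hf.room
    ((hR1 5 (by omega)).trans hr.hN) (by omega) hs1 (v := 1)
    (x := 0) (k := r) (by omega) (by omega) (by omega)
    (by simpa [hR1, hv] using hvn) (by simpa [hR1, hu] using hun)
    (by simp only [hR1 r (by omega), hk]; omega)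
  have hs2 := hs1.memAdd (by omega) hvn hun (by omega : k < 4 * n) hc'
  simp only [hR1 0 (by omega), hR1 1 (by omega), hR1 r (by omega), hu, hv, hk] at e2
  set R2 := Function.update R1 12 (memAdd (4 * n) σ.mem u v k (cntAt (4 * n) v k)) with hR2def
  have hR : ∀ r, r ≠ 12 → R2 r = σ.reg r := fun r h => by
    rw [hR2def, Function.update_of_ne h, hR1 r h]
  have e : execBlock w (addEdge r) σ =
      ⟨R2, memAdd (4 * n) (memAdd (4 * n) σ.mem u v k) v u k, .insert k u v :: σ.out⟩ := by
    rw [addEdge, execBlock_append, execBlock_append, e1, e2]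
    simp [execBlock, Stm.exec, hR, hu, hv, hk, hR r (by omega)]
  rw [e]
  exact ⟨⟨hs.colouring.recolour huv hkT, hs2,
    hs.describes.insert hun hvn huv hc (hs.colouring.symm u v)⟩,
    (agreeAux_memAdd _ _ _ _ _).trans (agreeAux_memAdd _ _ _ _ _), hR⟩

/-! ### The stack -/

/-- The code `c` of an edge is on the stack. -/
def OnStack (σ : State) (c : ℕ) : Prop := ∃ j < σ.reg 8, σ.mem (stkAt j) = c

/-- The only difference between the states are new entries on the stack, which are codes of pairs
of vertices, and the contents of the registers `12`, `15` and `16`. -/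
structure Pushed (n : ℕ) (σ σ' : State) : Prop where
  reg : ∀ r, r ≠ 8 → r ≠ 12 → r ≠ 15 → r ≠ 16 → σ'.reg r = σ.reg r
  out : σ'.out = σ.out
  rep : AgreeRep σ.mem σ'.mem
  keep : ∀ c, OnStack σ c → OnStack σ' c
  valid : ∀ c, OnStack σ' c → OnStack σ c ∨ ∃ x < n, ∃ y < n, c = x * (4 * n) + y

theorem Pushed.trans {n : ℕ} {σ σ' σ'' : State} (h : Pushed n σ σ') (h' : Pushed n σ' σ'') :
    Pushed n σ σ'' where
  reg r h1 h2 h3 h4 := (h'.reg r h1 h2 h3 h4).trans (h.reg r h1 h2 h3 h4)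
  out := h'.out.trans h.out
  rep := h.rep.trans h'.rep
  keep c hc := h'.keep c (h.keep c hc)
  valid c hc := (h'.valid c hc).elim (h.valid c) .inr

theorem Pushed.ready {n T q : ℕ} {σ σ' : State} (h : Pushed n σ σ') (hr : Ready n T q σ) :
    Ready n T q σ' where
  hN := (h.reg 5 (by omega) (by omega) (by omega) (by omega)).trans hr.hN
  hT := (h.reg 6 (by omega) (by omega) (by omega) (by omega)).trans hr.hT
  hq := (h.reg 7 (by omega) (by omega) (by omega) (by omega)).trans hr.hq
  hzero := (h.reg 21 (by omega) (by omega) (by omega) (by omega)).trans hr.hzero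

theorem Pushed.stores {n T : ℕ} {σ σ' : State} {χ : ℕ → ℕ → ℕ} (h : Pushed n σ σ')
    (hs : Stores n T σ χ) : Stores n T σ' χ where
  colouring := hs.colouring
  represents := h.rep.represents hs.represents
  describes := by rw [h.out]; exact hs.describes

/-- Push the next edge of the list of the vertex in register `v` and the colour in register `15`. -/
def pushStep (v : ℕ) : List Stm :=
  [.store (tagE 7 (.reg 8)) (idxE (.reg v) (.load (lstE (.reg v) (.reg 15) (.reg 16)))),
    .set 8 (succE (.reg 8)), .set 16 (succE (.reg 16))]

/-- Push all edges at the vertex in register `v` that have the colour `e`. -/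
def pushList (v : ℕ) (e : Ex) : Code :=
  .seq (block [.set 15 e, .set 16 (.const 0), .set 12 (.load (cntE (.reg v) (.reg 15)))])
    (.loop 16 12 (block (pushStep v)))

theorem pushStep_runs {w n T : ℕ} {σ : State} {χ : ℕ → ℕ → ℕ} {v a l : ℕ}
    (hR : 8 * (4 * n * (4 * n) * (4 * n)) < 2 ^ w) (hs : Stores n T σ χ)
    (h5 : σ.reg 5 = 4 * n) (hv12 : v < 8) (hv : σ.reg v = a) (h15 : σ.reg 15 = l) (ha : a < n)
    (hl : l < 4 * n) (h16 : σ.reg 16 < load n χ a l)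
    (hsp : 8 * (σ.reg 8 + 1) + 8 < 2 ^ w) :
    ∃ σ', Runs w (block (pushStep v)) σ σ' 60 ∧ Pushed n σ σ' ∧ σ'.reg 12 = σ.reg 12 ∧
      σ'.reg 15 = σ.reg 15 ∧ σ'.reg 16 = σ.reg 16 + 1 ∧ σ'.reg 8 = σ.reg 8 + 1 ∧
      OnStack σ' (a * (4 * n) + σ.mem (lstAt (4 * n) a l (σ.reg 16))) := by
  have hle := load_le (n := n) χ a l
  have hx := (hs.represents.lst a ha l hl (σ.reg 16) (by
    rwa [hs.represents.cnt ha hl])).1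
  have e1 : (lstE (.reg v) (.reg 15) (.reg 16)).eval w σ = lstAt (4 * n) a l (σ.reg 16) :=
    eval_lstE hR h5 (eval_reg hv) (eval_reg h15) (eval_reg rfl) (by omega) (by omega) (by omega)
  set x := σ.mem (lstAt (4 * n) a l (σ.reg 16)) with hxdef
  have hidx := index_lt (by omega : a < 4 * n) (by omega : x < 4 * n)
  have hsq := sq_le_cube (4 * n)
  have hsq' := le_sq (4 * n)
  have e2 : (idxE (.reg v) (.load (lstE (.reg v) (.reg 15) (.reg 16)))).eval w σ =
      a * (4 * n) + x := by
    have e3 : (Ex.load (lstE (.reg v) (.reg 15) (.reg 16))).eval w σ = x := by rw [Ex.eval, e1]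
    have e4 : (Ex.reg v).eval w σ = a := hv
    rw [eval_idxE h5 (by rw [e3, e4]; omega), e3, e4]
  have e3 : (tagE 7 (.reg 8)).eval w σ = stkAt (σ.reg 8) :=
    eval_tagE (by omega) (by simp only [Ex.eval]; omega)
  have h1 : 1 % 2 ^ w = 1 := Nat.mod_eq_of_lt (by omega)
  have hrun := block_runs w (pushStep v) σ (by
    simp [pushStep, Stm.Wf, Ex.Wf, tagE, idxE, lstE, succE]; omega)
  have he : execBlock w (pushStep v) σ =
      ⟨Function.update (Function.update σ.reg 8 (σ.reg 8 + 1)) 16 (σ.reg 16 + 1),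
        Function.update σ.mem (stkAt (σ.reg 8)) (a * (4 * n) + x), σ.out⟩ := by
    simp only [pushStep, execBlock, Stm.exec, e2, e3]
    simp only [succE, Ex.eval, WordOp.eval, h1]
    rw [Nat.mod_eq_of_lt (by omega : σ.reg 8 + 1 < 2 ^ w),
      Function.update_of_ne (by omega : (16 : ℕ) ≠ 8),
      Nat.mod_eq_of_lt (by omega : σ.reg 16 + 1 < 2 ^ w)]
  rw [he] at hrun
  refine ⟨_, hrun.mono (by
      simp [pushStep, blockCost, Stm.cost, Ex.cost, tagE, idxE, lstE, succE]),
    ⟨?_, rfl, ?_, ?_, ?_⟩, by simp, by simp, by simp, by simp, ⟨σ.reg 8, by simp, by simp⟩⟩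
  · intro r h8 h12 h15 h16
    simp [h8, h16]
  · intro b hb
    have : b ≠ stkAt (σ.reg 8) := by unfold stkAt; omega
    simp [this]
  · rintro c ⟨j, hj, hc⟩
    have : stkAt j ≠ stkAt (σ.reg 8) := by unfold stkAt; omega
    exact ⟨j, by simp; omega, by simp [this, hc]⟩
  · rintro c ⟨j, hj, hc⟩
    simp at hj
    by_cases hj8 : j = σ.reg 8
    · subst hj8
      simp at hc
      exact .inr ⟨a, ha, x, hx, hc.symm⟩
    · have : stkAt j ≠ stkAt (σ.reg 8) := by unfold stkAt; omega
      simp [this] at hc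
      exact .inl ⟨j, by omega, hc⟩

theorem pushLoop_runs {w n T : ℕ} {χ : ℕ → ℕ → ℕ} {v a l : ℕ}
    (hR : 8 * (4 * n * (4 * n) * (4 * n)) < 2 ^ w) (hv12 : v < 8) (ha : a < n) (hl : l < 4 * n) :
    ∀ (d : ℕ) (σ : State), Stores n T σ χ → σ.reg 5 = 4 * n → σ.reg v = a → σ.reg 15 = l →
      σ.reg 12 = load n χ a l → σ.reg 16 + d = load n χ a l → 8 * (σ.reg 8 + d) + 8 < 2 ^ w →
      ∃ σ', Runs w (.loop 16 12 (block (pushStep v))) σ σ' (61 * d + 1) ∧ Pushed n σ σ' ∧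
        σ'.reg 8 = σ.reg 8 + d ∧ ∀ i, σ.reg 16 ≤ i → i < load n χ a l →
          OnStack σ' (a * (4 * n) + σ.mem (lstAt (4 * n) a l i)) := by
  intro d
  induction d with
  | zero =>
    intro σ hs h5 hv h15 h12 h16 hsp
    refine ⟨σ, (Runs.loop_exit (by omega) (by omega) (by omega)).mono (by omega),
      ⟨fun _ _ _ _ _ => rfl, rfl, fun _ _ => rfl, fun _ h => h, fun _ h => .inl h⟩, rfl, ?_⟩
    intro i h1 h2
    omega
  | succ d ih =>
    intro σ hs h5 hv h15 h12 h16 hsp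
    obtain ⟨σ1, hrun1, hp1, h12', h15', h16', h8', hon⟩ :=
      pushStep_runs hR hs h5 hv12 hv h15 ha hl (by omega) (by omega)
    obtain ⟨σ2, hrun2, hp2, h8'', hon2⟩ := ih σ1 (hp1.stores hs)
      ((hp1.reg 5 (by omega) (by omega) (by omega) (by omega)).trans h5)
      ((hp1.reg v (by omega) (by omega) (by omega) (by omega)).trans hv)
      (h15'.trans h15) (h12'.trans h12) (by omega) (by omega)
    refine ⟨σ2, (Runs.loop_step (by omega) (by omega) (by omega) hrun1 hrun2).mono (by omega),
      hp1.trans hp2, by omega, ?_⟩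
    intro i hi hi2
    rcases hi.eq_or_lt with rfl | hlt
    · exact hp2.keep _ hon
    · have := hon2 i (by omega) hi2
      rwa [hp1.rep _ (by unfold lstAt; omega)] at this

theorem pushList_runs {w n T q : ℕ} {σ : State} {χ : ℕ → ℕ → ℕ} {v a l : ℕ} {e : Ex}
    (hf : Fits w n T q) (hs : Stores n T σ χ) (h5 : σ.reg 5 = 4 * n) (hv12 : v < 8)
    (hv : σ.reg v = a) (ha : a < n) (hl : l < 4 * n) (hwf : e.Wf) (he : e.eval w σ = l)
    (hsp : 8 * (σ.reg 8 + load n χ a l) + 8 < 2 ^ w) :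
    ∃ σ', Runs w (pushList v e) σ σ' (e.cost + 30 + 61 * load n χ a l) ∧ Pushed n σ σ' ∧
      σ'.reg 8 = σ.reg 8 + load n χ a l ∧
      ∀ y < n, χ a y = l + 1 → OnStack σ' (a * (4 * n) + y) := by
  set cs : List Stm := [.set 15 e, .set 16 (.const 0), .set 12 (.load (cntE (.reg v) (.reg 15)))]
    with hcs
  have hrun := block_runs w cs σ (by
    simp [hcs, Stm.Wf, Ex.Wf, tagE, idxE, cntE, hwf]; omega)
  have hx : execBlock w cs σ = ⟨Function.update (Function.update (Function.update σ.reg 15 l) 16 0)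
      12 (load n χ a l), σ.mem, σ.out⟩ := by
    simp only [hcs, execBlock, Stm.exec, he]
    rw [show (Ex.const 0).eval w _ = 0 from Nat.zero_mod _]
    congr 2
    rw [Ex.eval, eval_cntE hf.room (va := a) (vb := l)]
    · exact hs.represents.cnt ha hl
    · simpa using h5
    · simp only [Ex.eval]
      rw [Function.update_of_ne (by omega), Function.update_of_ne (by omega), hv]
    · simp [Ex.eval]
    · omega
    · omega
  rw [hx] at hrun
  obtain ⟨σ', hrun', hp, h8, hon⟩ := pushLoop_runs hf.room hv12 ha hl (load n χ a l)
    ⟨Function.update (Function.update (Function.update σ.reg 15 l) 16 0)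
      12 (load n χ a l), σ.mem, σ.out⟩ ⟨hs.colouring, hs.represents, hs.describes⟩
    (by simpa using h5)
    (by rw [← hv]; simp only
        rw [Function.update_of_ne (by omega), Function.update_of_ne (by omega),
          Function.update_of_ne (by omega)])
    (by simp) (by simp) (by simp) (by simpa using hsp)
  refine ⟨σ', (hrun.seq hrun').mono ?_, ⟨?_, hp.out, hp.rep, ?_, ?_⟩, by simpa using h8, ?_⟩
  · simp only [hcs, blockCost, Stm.cost, Ex.cost, tagE, idxE, cntE]
    omega
  · intro r h1 h2 h3 h4
    rw [hp.reg r h1 h2 h3 h4]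
    simp [h2, h3, h4]
  · rintro c ⟨j, hj, hc⟩
    exact hp.keep c ⟨j, by simpa using hj, hc⟩
  · intro c hc
    refine (hp.valid c hc).imp (fun h => ?_) id
    obtain ⟨j, hj, hc⟩ := h
    exact ⟨j, by simpa using hj, hc⟩
  · intro y hy hc
    obtain ⟨h1, h2⟩ := hs.represents.pos a ha y hy l hl hc
    rw [hs.represents.cnt ha hl] at h1
    have := hon (σ.mem (posAt (4 * n) a y)) (by simp) h1
    simp only [h2] at this
    exact this

/-- `(k - 1) / 2` for the colour `k` in register `9`. -/
def parE : Ex := .op .div (predE (.reg 9)) (.const 2)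

/-- `2 * k + c` for the colour `k` in register `9`. -/
def childE (c : ℕ) : Ex := .op .add (.op .mul (.const 2) (.reg 9)) (.const c)

theorem eval_parE {w k : ℕ} {σ : State} (hw : 2 < 2 ^ w) (hk : σ.reg 9 = k) :
    parE.eval w σ = (k - 1) / 2 := by
  simp [parE, predE, Ex.eval, WordOp.eval, hk, Nat.mod_eq_of_lt hw,
    Nat.mod_eq_of_lt (by omega : 1 < 2 ^ w)]

theorem eval_childE {w k c : ℕ} {σ : State} (hw : 2 * k + c < 2 ^ w) (h2 : 2 < 2 ^ w)
    (hk : σ.reg 9 = k) : (childE c).eval w σ = 2 * k + c := by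
  simp only [childE, Ex.eval, WordOp.eval, hk]
  rw [Nat.mod_eq_of_lt h2, Nat.mod_eq_of_lt (by omega : 2 * k < 2 ^ w),
    Nat.mod_eq_of_lt (by omega : c < 2 ^ w), Nat.mod_eq_of_lt hw]

/-- Push all edges at the vertex in register `v` whose colour is near the one in register `9`. -/
def pushNear (v : ℕ) : Code :=
  .seq (pushList v (.reg 9)) (.seq (pushList v parE)
    (.seq (pushList v (childE 1)) (pushList v (childE 2))))

theorem Fits.lt_pow {w n T q : ℕ} (hf : Fits w n T q) : 16 * n + 8 < 2 ^ w := by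
  have := hf.room
  have := sq_le_cube (4 * n)
  have := le_sq (4 * n)
  have := hf.le
  have := hf.pos
  omega

theorem pushNear_runs {w n T q : ℕ} {σ : State} {χ : ℕ → ℕ → ℕ} {v a k : ℕ}
    (hf : Fits w n T q) (hr : Ready n T q σ) (hs : Stores n T σ χ) (hv12 : v < 8)
    (hv : σ.reg v = a) (ha : a < n) (hk : σ.reg 9 = k) (hkT : k < T)
    (hsp : 8 * (σ.reg 8 + nearSum (load n χ a) k) + 8 < 2 ^ w) :
    ∃ σ', Runs w (pushNear v) σ σ' (200 + 61 * nearSum (load n χ a) k) ∧ Pushed n σ σ' ∧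
      σ'.reg 8 = σ.reg 8 + nearSum (load n χ a) k ∧
      ∀ l y, Near k l → y < n → χ a y = l + 1 → OnStack σ' (a * (4 * n) + y) := by
  have hTn := hf.le
  have hlt := hf.lt_pow
  unfold nearSum at hsp ⊢
  obtain ⟨σ1, r1, p1, e1, c1⟩ := pushList_runs hf hs hr.hN hv12 hv ha (l := k) (by omega)
    (e := .reg 9) (by simp [Ex.Wf]) hk (by omega)
  have hk1 := (p1.reg 9 (by omega) (by omega) (by omega) (by omega)).trans hk
  have hv1 := (p1.reg v (by omega) (by omega) (by omega) (by omega)).trans hv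
  have hs1 := p1.stores hs
  have hr1 := p1.ready hr
  obtain ⟨σ2, r2, p2, e2, c2⟩ := pushList_runs hf hs1 hr1.hN hv12 hv1 ha (l := (k - 1) / 2)
    (by omega) (e := parE) (by simp [Ex.Wf, parE, predE]) (eval_parE (by omega) hk1) (by omega)
  have hk2 := (p2.reg 9 (by omega) (by omega) (by omega) (by omega)).trans hk1
  have hv2 := (p2.reg v (by omega) (by omega) (by omega) (by omega)).trans hv1
  have hs2 := p2.stores hs1
  have hr2 := p2.ready hr1
  obtain ⟨σ3, r3, p3, e3, c3⟩ := pushList_runs hf hs2 hr2.hN hv12 hv2 ha (l := 2 * k + 1)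
    (by omega) (e := childE 1) (by simp [Ex.Wf, childE]) (eval_childE (by omega) (by omega) hk2)
    (by omega)
  have hk3 := (p3.reg 9 (by omega) (by omega) (by omega) (by omega)).trans hk2
  have hv3 := (p3.reg v (by omega) (by omega) (by omega) (by omega)).trans hv2
  have hs3 := p3.stores hs2
  have hr3 := p3.ready hr2
  obtain ⟨σ4, r4, p4, e4, c4⟩ := pushList_runs hf hs3 hr3.hN hv12 hv3 ha (l := 2 * k + 2)
    (by omega) (e := childE 2) (by simp [Ex.Wf, childE]) (eval_childE (by omega) (by omega) hk3)
    (by omega)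
  refine ⟨σ4, (r1.seq (r2.seq (r3.seq r4))).mono ?_, p1.trans (p2.trans (p3.trans p4)),
    by omega, ?_⟩
  · simp only [Ex.cost, parE, predE, childE]
    omega
  · rintro l y (rfl | rfl | rfl | rfl) hy hc
    · exact p4.keep _ (p3.keep _ (p2.keep _ (c1 y hy hc)))
    · exact p4.keep _ (p3.keep _ (c2 y hy hc))
    · exact p4.keep _ (c3 y hy hc)
    · exact c4 y hy hc

/-! ### Inspecting an edge -/

/-- The load of the vertex in register `v` and the colour `e`. -/
def loadE (v : ℕ) (e : Ex) : Ex := .load (cntE (.reg v) e)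

/-- `a + b`. -/
def addE (a b : Ex) : Ex := .op .add a b

/-- The sum of the loads of the vertex in register `v` near the colour in register `9`. -/
def nearE (v : ℕ) : Ex :=
  addE (addE (addE (loadE v (.reg 9)) (loadE v parE)) (loadE v (childE 1))) (loadE v (childE 2))

/-- If giving the current edge the colour `e` is an improvement, then store the colour, increased
by one, in register `10`. Register `18` holds the cost of inspection, and register `19` the sum of
the present loads. -/
def checkAlt (e : Ex) : Code :=
  .seq (block [.set 15 e])
    (ite (.reg 15) (.reg 6)
      (ite (addE (addE (loadE 0 (.reg 15)) (loadE 1 (.reg 15)))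
          (addE (.op .div (.reg 18) (.reg 7)) (.const 2))) (.reg 19)
        (block [.set 10 (succE (.reg 15))]) (block []))
      (block []))

/-- Look for an improvement of the current edge. -/
def inspect : Code :=
  .seq (block [.set 19 (addE (loadE 0 (.reg 9)) (loadE 1 (.reg 9))),
      .set 18 (addE (nearE 0) (nearE 1)), .set 10 (.const 0)])
    (.seq (checkAlt parE) (.seq (checkAlt (childE 1)) (checkAlt (childE 2))))

theorem eval_addE {w va vb : ℕ} {σ : State} {a b : Ex} (ha : a.eval w σ = va)
    (hb : b.eval w σ = vb) (h : va + vb < 2 ^ w) : (addE a b).eval w σ = va + vb := by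
  simp only [addE, Ex.eval, WordOp.eval, ha, hb]
  exact Nat.mod_eq_of_lt h

theorem eval_loadE {w n T q : ℕ} {σ : State} {χ : ℕ → ℕ → ℕ} (hf : Fits w n T q)
    (h5 : σ.reg 5 = 4 * n) (hr : Represents n (4 * n) σ.mem χ) {v a l : ℕ} {e : Ex}
    (hv : σ.reg v = a) (he : e.eval w σ = l) (ha : a < n) (hl : l < 4 * n) :
    (loadE v e).eval w σ = load n χ a l := by
  rw [loadE, Ex.eval, eval_cntE hf.room h5 (eval_reg hv) he (by omega) hl]
  exact hr.cnt ha hl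

theorem nearSum_load_le {n : ℕ} (χ : ℕ → ℕ → ℕ) (v k : ℕ) : nearSum (load n χ v) k ≤ 4 * n := by
  have h1 := load_le (n := n) χ v k
  have h2 := load_le (n := n) χ v ((k - 1) / 2)
  have h3 := load_le (n := n) χ v (2 * k + 1)
  have h4 := load_le (n := n) χ v (2 * k + 2)
  unfold nearSum
  omega

theorem eval_nearE {w n T q : ℕ} {σ : State} {χ : ℕ → ℕ → ℕ} (hf : Fits w n T q)
    (h5 : σ.reg 5 = 4 * n) (hr : Represents n (4 * n) σ.mem χ) {v a k : ℕ}
    (hv : σ.reg v = a) (hk : σ.reg 9 = k) (ha : a < n) (hkT : k < T) :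
    (nearE v).eval w σ = nearSum (load n χ a) k := by
  have hT := hf.le
  have hw := hf.lt_pow
  have h := nearSum_load_le (n := n) χ a k
  unfold nearSum at h ⊢
  exact eval_addE (eval_addE (eval_addE (eval_loadE hf h5 hr hv hk ha (by omega))
    (eval_loadE hf h5 hr hv (eval_parE (by omega) hk) ha (by omega)) (by omega))
    (eval_loadE hf h5 hr hv (eval_childE (by omega) (by omega) hk) ha (by omega)) (by omega))
    (eval_loadE hf h5 hr hv (eval_childE (by omega) (by omega) hk) ha (by omega)) (by omega)

theorem checkAlt_runs {w n T q : ℕ} {σ : State} {χ : ℕ → ℕ → ℕ} (hf : Fits w n T q)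
    (hr : Ready n T q σ) (hs : Stores n T σ χ) {u v k l : ℕ} (hu : σ.reg 0 = u) (hv : σ.reg 1 = v)
    (hun : u < n) (hvn : v < n) (h18 : σ.reg 18 = inspectCost n χ u v k)
    (h19 : σ.reg 19 = load n χ u k + load n χ v k) {e : Ex} (hwf : e.Wf) (he : e.eval w σ = l)
    (hl : l < 4 * n) :
    ∃ σ', Runs w (checkAlt e) σ σ' (e.cost + 100) ∧ σ'.mem = σ.mem ∧ σ'.out = σ.out ∧
      (∀ r, r ≠ 10 → r ≠ 15 → σ'.reg r = σ.reg r) ∧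
      ((Improves n T q χ u v k l ∧ σ'.reg 10 = l + 1) ∨
        (¬ Improves n T q χ u v k l ∧ σ'.reg 10 = σ.reg 10)) := by
  have hw := hf.lt_pow
  set σ1 : State := ⟨Function.update σ.reg 15 l, σ.mem, σ.out⟩ with hσ1
  have hreg : ∀ r, r ≠ 15 → σ1.reg r = σ.reg r := fun r h => by simp [hσ1, h]
  have h15 : σ1.reg 15 = l := by simp [hσ1]
  have hrun := block_runs w [.set 15 e] σ (by simp [Stm.Wf, hwf])
  rw [show execBlock w [.set 15 e] σ = σ1 by simp [execBlock, Stm.exec, he, hσ1]] at hrun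
  have hempty := block_runs w [] σ1 (by simp)
  by_cases hlT : l < T
  · have hg : (addE (addE (loadE 0 (.reg 15)) (loadE 1 (.reg 15)))
        (addE (.op .div (.reg 18) (.reg 7)) (.const 2))).eval w σ1 =
        load n χ u l + load n χ v l + (inspectCost n χ u v k / q + 2) := by
      have h5 : σ1.reg 5 = 4 * n := (hreg 5 (by omega)).trans hr.hN
      have hd : (Ex.op .div (.reg 18) (.reg 7)).eval w σ1 = inspectCost n χ u v k / q := by
        simp only [Ex.eval, WordOp.eval]
        rw [hreg 18 (by omega), hreg 7 (by omega), h18, hr.hq]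
      have hA : inspectCost n χ u v k / q ≤ 8 * n := by
        refine (Nat.div_le_self _ _).trans ?_
        have h1 := nearSum_load_le (n := n) χ u k
        have h2 := nearSum_load_le (n := n) χ v k
        unfold inspectCost
        omega
      have h1 := load_le (n := n) χ u l
      have h2 := load_le (n := n) χ v l
      generalize inspectCost n χ u v k / q = d at *
      exact eval_addE (eval_addE
        (eval_loadE hf h5 hs.represents ((hreg 0 (by omega)).trans hu) h15 hun hl)
        (eval_loadE hf h5 hs.represents ((hreg 1 (by omega)).trans hv) h15 hvn hl) (by omega))
        (eval_addE hd (Nat.mod_eq_of_lt (by omega)) (by omega)) (by omega)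
    have h19' : (Ex.reg 19).eval w σ1 = load n χ u k + load n χ v k :=
      (hreg 19 (by omega)).trans h19
    have hwf1 : (addE (addE (loadE 0 (.reg 15)) (loadE 1 (.reg 15)))
        (addE (.op .div (.reg 18) (.reg 7)) (.const 2))).Wf := by
      simp [addE, loadE, cntE, tagE, idxE, Ex.Wf]
    have hlt : (Ex.reg 15).eval w σ1 < (Ex.reg 6).eval w σ1 := by
      simp only [Ex.eval]
      rw [h15, hreg 6 (by omega), hr.hT]
      exact hlT
    by_cases hi : load n χ u l + load n χ v l + (inspectCost n χ u v k / q + 2) <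
        load n χ u k + load n χ v k
    · have hset := block_runs w [.set 10 (succE (.reg 15))] σ1
        (by simp [Stm.Wf, Ex.Wf, succE])
      refine ⟨_, (hrun.seq (Runs.ite_pos (by simp [Ex.Wf]) (by simp [Ex.Wf]) hlt
        (Runs.ite_pos hwf1 (by simp [Ex.Wf]) (by rw [hg, h19']; exact hi) hset))).mono ?_,
        rfl, rfl, ?_, .inl ⟨⟨hlT, by omega⟩, ?_⟩⟩
      · simp [blockCost, Stm.cost, Ex.cost, addE, loadE, cntE, tagE, idxE, succE]
      · intro r h10 h15
        simp [execBlock, Stm.exec, h10, hreg r h15]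
      · have hTn := hf.le
        simp [execBlock, Stm.exec, succE, Ex.eval, WordOp.eval, h15]
        rw [Nat.mod_eq_of_lt (by omega)]
    · refine ⟨_, (hrun.seq (Runs.ite_pos (by simp [Ex.Wf]) (by simp [Ex.Wf]) hlt
        (Runs.ite_neg hwf1 (by simp [Ex.Wf]) (by rw [hg, h19']; exact hi) hempty))).mono ?_,
        rfl, rfl, fun r _ h => hreg r h, .inr ⟨fun h => hi (by have := h.2; omega),
          hreg 10 (by omega)⟩⟩
      simp [blockCost, Stm.cost, Ex.cost, addE, loadE, cntE, tagE, idxE]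
  · refine ⟨_, (hrun.seq (Runs.ite_neg (by simp [Ex.Wf]) (by simp [Ex.Wf]) (by
        simp only [Ex.eval]
        rw [h15, hreg 6 (by omega), hr.hT]
        exact hlT) hempty)).mono ?_,
      rfl, rfl, fun r _ h => hreg r h, .inr ⟨fun h => hlT h.1, hreg 10 (by omega)⟩⟩
    simp [blockCost, Stm.cost, Ex.cost]

theorem inspect_runs {w n T q : ℕ} {σ : State} {χ : ℕ → ℕ → ℕ} (hf : Fits w n T q)
    (hr : Ready n T q σ) (hs : Stores n T σ χ) {u v k : ℕ} (hu : σ.reg 0 = u) (hv : σ.reg 1 = v)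
    (hk : σ.reg 9 = k) (hun : u < n) (hvn : v < n) (hkT : k < T) :
    ∃ σ', Runs w inspect σ σ' 800 ∧ σ'.mem = σ.mem ∧ σ'.out = σ.out ∧
      (∀ r, r ≠ 10 → r ≠ 15 → r ≠ 18 → r ≠ 19 → σ'.reg r = σ.reg r) ∧
      ((σ'.reg 10 = 0 ∧ ∀ l, Near k l → ¬ Improves n T q χ u v k l) ∨
        ∃ l, σ'.reg 10 = l + 1 ∧ Near k l ∧ Improves n T q χ u v k l) := by
  have hw := hf.lt_pow
  have hTn := hf.le
  set cs : List Stm := [.set 19 (addE (loadE 0 (.reg 9)) (loadE 1 (.reg 9))),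
      .set 18 (addE (nearE 0) (nearE 1)), .set 10 (.const 0)] with hcs
  have hrun := block_runs w cs σ (by
    simp [hcs, Stm.Wf, Ex.Wf, addE, nearE, loadE, cntE, tagE, idxE, parE, childE, predE])
  have e1 : (addE (loadE 0 (.reg 9)) (loadE 1 (.reg 9))).eval w σ =
      load n χ u k + load n χ v k := by
    have h1 := load_le (n := n) χ u k
    have h2 := load_le (n := n) χ v k
    exact eval_addE (eval_loadE hf hr.hN hs.represents hu hk hun (by omega))
      (eval_loadE hf hr.hN hs.represents hv hk hvn (by omega)) (by omega)
  set σ0 : State := ⟨Function.update σ.reg 19 (load n χ u k + load n χ v k), σ.mem, σ.out⟩ with hσ0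
  have hreg0 : ∀ r, r ≠ 19 → σ0.reg r = σ.reg r := fun r h => by simp [hσ0, h]
  have e2 : (addE (nearE 0) (nearE 1)).eval w σ0 = inspectCost n χ u v k := by
    have h1 := nearSum_load_le (n := n) χ u k
    have h2 := nearSum_load_le (n := n) χ v k
    have h5 := (hreg0 5 (by omega)).trans hr.hN
    have h9 := (hreg0 9 (by omega)).trans hk
    exact eval_addE (eval_nearE hf h5 hs.represents ((hreg0 0 (by omega)).trans hu) h9 hun hkT)
      (eval_nearE hf h5 hs.represents ((hreg0 1 (by omega)).trans hv) h9 hvn hkT) (by omega)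
  set σ1 : State := ⟨Function.update (Function.update σ0.reg 18 (inspectCost n χ u v k)) 10 0,
    σ.mem, σ.out⟩ with hσ1
  rw [show execBlock w cs σ = σ1 by
    simp only [hcs, execBlock, Stm.exec, e1]
    rw [← hσ0, e2]
    simp [hσ1, hσ0, Ex.eval]] at hrun
  have hreg1 : ∀ r, r ≠ 10 → r ≠ 18 → r ≠ 19 → σ1.reg r = σ.reg r := fun r h1 h2 h3 => by
    simp [hσ1, h1, h2, hreg0 r h3]
  have h10 : σ1.reg 10 = 0 := by simp [hσ1]
  have h18 : σ1.reg 18 = inspectCost n χ u v k := by simp [hσ1]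
  have h19 : σ1.reg 19 = load n χ u k + load n χ v k := by simp [hσ1, hσ0]
  -- the three checks, one after the other
  have step : ∀ σ2 : State, σ2.mem = σ.mem → σ2.out = σ.out →
      (∀ r, r ≠ 10 → r ≠ 15 → σ2.reg r = σ1.reg r) →
      ∀ (e : Ex) (l : ℕ), e.Wf → e.eval w σ2 = l → l < 4 * n → e.cost ≤ 10 →
      ∃ σ', Runs w (checkAlt e) σ2 σ' 110 ∧ σ'.mem = σ.mem ∧ σ'.out = σ.out ∧
        (∀ r, r ≠ 10 → r ≠ 15 → σ'.reg r = σ1.reg r) ∧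
        ((Improves n T q χ u v k l ∧ σ'.reg 10 = l + 1) ∨
          (¬ Improves n T q χ u v k l ∧ σ'.reg 10 = σ2.reg 10)) := by
    intro σ2 hm ho hreg e l hwf he hl hcost
    have hg : ∀ r, r ≠ 10 → r ≠ 15 → r ≠ 18 → r ≠ 19 → σ2.reg r = σ.reg r :=
      fun r h1 h2 h3 h4 => (hreg r h1 h2).trans (hreg1 r h1 h3 h4)
    obtain ⟨σ', r', m', o', f', i'⟩ := checkAlt_runs (σ := σ2) (k := k) hf
      ⟨(hg 5 (by omega) (by omega) (by omega) (by omega)).trans hr.hN,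
        (hg 6 (by omega) (by omega) (by omega) (by omega)).trans hr.hT,
        (hg 7 (by omega) (by omega) (by omega) (by omega)).trans hr.hq,
        (hg 21 (by omega) (by omega) (by omega) (by omega)).trans hr.hzero⟩
      ⟨hs.colouring, by rw [hm]; exact hs.represents, by rw [ho]; exact hs.describes⟩
      ((hg 0 (by omega) (by omega) (by omega) (by omega)).trans hu)
      ((hg 1 (by omega) (by omega) (by omega) (by omega)).trans hv) hun hvn
      ((hreg 18 (by omega) (by omega)).trans h18) ((hreg 19 (by omega) (by omega)).trans h19)
      hwf he hl
    exact ⟨σ', r'.mono (by omega), m'.trans hm, o'.trans ho,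
      fun r h1 h2 => (f' r h1 h2).trans (hreg r h1 h2), i'⟩
  have h9 : ∀ σ2 : State, (∀ r, r ≠ 10 → r ≠ 15 → σ2.reg r = σ1.reg r) → σ2.reg 9 = k :=
    fun σ2 h => (h 9 (by omega) (by omega)).trans
      ((hreg1 9 (by omega) (by omega) (by omega)).trans hk)
  obtain ⟨σa, ra, ma, oa, fa, ia⟩ := step σ1 rfl rfl (fun _ _ _ => rfl) parE ((k - 1) / 2)
    (by simp [Ex.Wf, parE, predE]) (eval_parE (by omega) (h9 σ1 fun _ _ _ => rfl)) (by omega)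
    (by simp [Ex.cost, parE, predE])
  obtain ⟨σb, rb, mb, ob, fb, ib⟩ := step σa ma oa fa (childE 1) (2 * k + 1)
    (by simp [Ex.Wf, childE]) (eval_childE (by omega) (by omega) (h9 σa fa)) (by omega)
    (by simp [Ex.cost, childE])
  obtain ⟨σc, rc, mc, oc, fc, ic⟩ := step σb mb ob fb (childE 2) (2 * k + 2)
    (by simp [Ex.Wf, childE]) (eval_childE (by omega) (by omega) (h9 σb fb)) (by omega)
    (by simp [Ex.cost, childE])
  refine ⟨σc, (hrun.seq (ra.seq (rb.seq rc))).mono ?_, mc, oc,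
    fun r h1 h2 h3 h4 => (fc r h1 h2).trans (hreg1 r h1 h3 h4), ?_⟩
  · simp [hcs, blockCost, Stm.cost, Ex.cost, addE, nearE, loadE, cntE, tagE, idxE, parE, childE,
      predE]
  · rcases ic with ⟨ic, hc⟩ | ⟨ic, hc⟩
    · exact .inr ⟨_, hc, .inr (.inr (.inr rfl)), ic⟩
    rcases ib with ⟨ib, hb⟩ | ⟨ib, hb⟩
    · exact .inr ⟨_, hc.trans hb, .inr (.inr (.inl rfl)), ib⟩
    rcases ia with ⟨ia, ha⟩ | ⟨ia, ha⟩
    · exact .inr ⟨_, hc.trans (hb.trans ha), .inr (.inl rfl), ia⟩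
    refine .inl ⟨by rw [hc, hb, ha, h10], ?_⟩
    rintro l (rfl | rfl | rfl | rfl)
    · intro h
      have := h.2
      generalize inspectCost n χ u v l / q = d at this
      omega
    · exact ia
    · exact ib
    · exact ic

/-! ### Restoring stability -/

/-- Pop an edge from the stack, and read its colour, increased by one. -/
def popEdge : List Stm :=
  [.set 8 (predE (.reg 8)), .set 16 (.load (tagE 7 (.reg 8))),
    .set 0 (.op .div (.reg 16) (.reg 5)), .set 1 (.op .mod (.reg 16) (.reg 5)),
    .set 9 (.load (colE (.reg 0) (.reg 1)))]

/-- Recolour the current edge with the colour, increased by one, in register `10`, and push the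
edges that have to be inspected again. -/
def recolourEdge : Code :=
  .seq (block (.set 10 (predE (.reg 10)) :: (removeEdge ++ addEdge 10)))
    (.seq (pushNear 0) (pushNear 1))

/-- Inspect the topmost edge of the stack. -/
def fixStep : Code :=
  .seq (block popEdge)
    (ite (.const 0) (.reg 9)
      (.seq (block [.set 9 (predE (.reg 9))])
        (.seq inspect (ite (.const 0) (.reg 10) recolourEdge (block []))))
      (block []))

/-- Inspect edges until the stack is empty. -/
def fixLoop : Code := .loop 21 8 fixStep

/-- The invariant of the loop: every violating edge is on the stack. -/
structure Working (n T q : ℕ) (σ : State) (χ : ℕ → ℕ → ℕ) : Prop where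
  ready : Ready n T q σ
  stores : Stores n T σ χ
  valid : ∀ c, OnStack σ c → ∃ x < n, ∃ y < n, c = x * (4 * n) + y
  cover : ∀ u < n, ∀ v < n, Violating n T q χ u v →
    OnStack σ (u * (4 * n) + v) ∨ OnStack σ (v * (4 * n) + u)

/-- The amortised cost of the inspections to come. -/
def credit (n T q : ℕ) (σ : State) (χ : ℕ → ℕ → ℕ) : ℕ :=
  2 * (q * potential n T χ) + σ.reg 8

theorem onStack_pop {σ σ' : State} (h8 : σ.reg 8 = σ'.reg 8 + 1) (hm : σ'.mem = σ.mem) {c : ℕ}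
    (h : OnStack σ c) : c = σ.mem (stkAt (σ'.reg 8)) ∨ OnStack σ' c := by
  obtain ⟨j, hj, hc⟩ := h
  by_cases hj8 : j = σ'.reg 8
  · subst hj8
    exact .inl hc.symm
  · exact .inr ⟨j, by omega, by rw [hm, hc]⟩

theorem onStack_of_pop {σ σ' : State} (h8 : σ.reg 8 = σ'.reg 8 + 1) (hm : σ'.mem = σ.mem) {c : ℕ}
    (h : OnStack σ' c) : OnStack σ c := by
  obtain ⟨j, hj, hc⟩ := h
  exact ⟨j, by omega, by rw [← hm, hc]⟩

theorem popEdge_runs {w n T q : ℕ} {σ : State} {χ : ℕ → ℕ → ℕ} (hf : Fits w n T q)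
    (hr : Ready n T q σ) (hs : Stores n T σ χ) {u v s : ℕ} (h8 : σ.reg 8 = s + 1)
    (htop : σ.mem (stkAt s) = u * (4 * n) + v) (hu : u < n) (hv : v < n)
    (hsp : 8 * s + 8 < 2 ^ w) :
    ∃ σ', Runs w (block popEdge) σ σ' 100 ∧ σ'.mem = σ.mem ∧ σ'.out = σ.out ∧
      (∀ r, r ≠ 0 → r ≠ 1 → r ≠ 8 → r ≠ 9 → r ≠ 16 → σ'.reg r = σ.reg r) ∧
      σ'.reg 0 = u ∧ σ'.reg 1 = v ∧ σ'.reg 8 = s ∧ σ'.reg 9 = χ u v := by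
  have hw := hf.lt_pow
  have hrun := block_runs w popEdge σ (by
    simp [popEdge, Stm.Wf, Ex.Wf, predE, tagE, colE, idxE])
  have h1 : 1 % 2 ^ w = 1 := Nat.mod_eq_of_lt (by omega)
  have e1 : (predE (.reg 8)).eval w σ = s := by
    simp [predE, Ex.eval, WordOp.eval, h8, h1]
  have e2 : (Ex.load (tagE 7 (.reg 8))).eval w ⟨Function.update σ.reg 8 s, σ.mem, σ.out⟩ =
      u * (4 * n) + v := by
    rw [Ex.eval, eval_tagE (by omega) (by simpa [Ex.eval] using hsp)]
    simpa [Ex.eval, stkAt] using htop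
  have hdiv : (u * (4 * n) + v) / (4 * n) = u := by
    rw [mul_comm, Nat.mul_add_div (by omega), Nat.div_eq_of_lt (by omega), add_zero]
  have hmod : (u * (4 * n) + v) % (4 * n) = v := by
    rw [mul_comm, Nat.mul_add_mod, Nat.mod_eq_of_lt (by omega)]
  set R := Function.update (Function.update (Function.update (Function.update σ.reg 8 s) 16
    (u * (4 * n) + v)) 0 u) 1 v with hR
  have e3 : (Ex.load (colE (.reg 0) (.reg 1))).eval w ⟨R, σ.mem, σ.out⟩ = χ u v := by
    rw [Ex.eval, eval_colE (σ := ⟨R, σ.mem, σ.out⟩) hf.room (by simpa [hR] using hr.hN)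
      (eval_reg (v := u) (by simp [hR])) (eval_reg (v := v) (by simp [hR])) (by omega) (by omega)]
    exact hs.represents.col u hu v hv
  have he : execBlock w popEdge σ = ⟨Function.update R 9 (χ u v), σ.mem, σ.out⟩ := by
    simp only [popEdge, execBlock, Stm.exec, e1, e2]
    rw [show (Ex.op .div (.reg 16) (.reg 5)).eval w ⟨Function.update (Function.update σ.reg 8 s) 16
      (u * (4 * n) + v), σ.mem, σ.out⟩ = u by
        simpa [Ex.eval, WordOp.eval, hr.hN] using hdiv]
    rw [show (Ex.op .mod (.reg 16) (.reg 5)).eval w ⟨Function.update (Function.update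
      (Function.update σ.reg 8 s) 16 (u * (4 * n) + v)) 0 u, σ.mem, σ.out⟩ = v by
        simpa [Ex.eval, WordOp.eval, hr.hN] using hmod]
    rw [← hR, e3]
  rw [he] at hrun
  refine ⟨_, hrun.mono (by
    simp [popEdge, blockCost, Stm.cost, Ex.cost, predE, tagE, colE, idxE]), rfl, rfl, ?_, ?_, ?_,
    ?_, ?_⟩
  · intro r h0 h1 h8 h9 h16
    simp [hR, h0, h1, h8, h9, h16]
  all_goals simp [hR]

theorem recolourEdge_runs {w n T q : ℕ} {σ : State} {χ : ℕ → ℕ → ℕ} (hf : Fits w n T q)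
    (hr : Ready n T q σ) (hs : Stores n T σ χ) {u v k k' : ℕ} (hu : σ.reg 0 = u) (hv : σ.reg 1 = v)
    (hk : σ.reg 9 = k) (hk' : σ.reg 10 = k' + 1) (hun : u < n) (hvn : v < n) (huv : u ≠ v)
    (hc : χ u v = k + 1) (hk'T : k' < T)
    (hsp : 8 * (σ.reg 8 + inspectCost n (recolour χ u v (k' + 1)) u v k) + 8 < 2 ^ w) :
    ∃ σ' : State, Runs w recolourEdge σ σ'
        (1000 + 61 * inspectCost n (recolour χ u v (k' + 1)) u v k) ∧
      Ready n T q σ' ∧ Stores n T σ' (recolour χ u v (k' + 1)) ∧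
      σ'.reg 8 = σ.reg 8 + inspectCost n (recolour χ u v (k' + 1)) u v k ∧
      (∀ a < 3, σ'.mem a = σ.mem a) ∧ (∀ c, OnStack σ c → OnStack σ' c) ∧
      (∀ c, OnStack σ' c → OnStack σ c ∨ ∃ x < n, ∃ y < n, c = x * (4 * n) + y) ∧
      ∀ x y l, (x = u ∨ x = v) → Near k l → y < n →
        recolour χ u v (k' + 1) x y = l + 1 → OnStack σ' (x * (4 * n) + y) := by
  have hw := hf.lt_pow
  have hTn := hf.le
  have h1 : 1 % 2 ^ w = 1 := Nat.mod_eq_of_lt (by omega)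
  have hkT : k < T := by have := hs.colouring.le u v; omega
  set σ1 : State := ⟨Function.update σ.reg 10 k', σ.mem, σ.out⟩ with hσ1
  have e1 : (Stm.set 10 (predE (.reg 10))).exec w σ = σ1 := by
    simp [hσ1, Stm.exec, predE, Ex.eval, WordOp.eval, hk', h1]
  have f1 : ∀ r, r ≠ 10 → σ1.reg r = σ.reg r := fun r h => by simp [hσ1, h]
  have hr1 : Ready n T q σ1 := ⟨(f1 5 (by omega)).trans hr.hN, (f1 6 (by omega)).trans hr.hT,
    (f1 7 (by omega)).trans hr.hq, (f1 21 (by omega)).trans hr.hzero⟩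
  have hs1 : Stores n T σ1 χ := ⟨hs.colouring, hs.represents, hs.describes⟩
  obtain ⟨hs2, a2, f2⟩ := execBlock_removeEdge hf hr1 hs1 ((f1 0 (by omega)).trans hu)
    ((f1 1 (by omega)).trans hv) ((f1 9 (by omega)).trans hk) hun hvn huv hc
  set σ2 := execBlock w removeEdge σ1 with hσ2
  have f2' : ∀ r, r ≠ 10 → r ≠ 12 → r ≠ 13 → r ≠ 14 → σ2.reg r = σ.reg r :=
    fun r h1 h2 h3 h4 => (f2 r h2 h3 h4).trans (f1 r h1)
  have hr2 : Ready n T q σ2 := ⟨(f2' 5 (by omega) (by omega) (by omega) (by omega)).trans hr.hN,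
    (f2' 6 (by omega) (by omega) (by omega) (by omega)).trans hr.hT,
    (f2' 7 (by omega) (by omega) (by omega) (by omega)).trans hr.hq,
    (f2' 21 (by omega) (by omega) (by omega) (by omega)).trans hr.hzero⟩
  obtain ⟨hs3, a3, f3⟩ := execBlock_addEdge hf hr2 hs2 (r := 10) (by omega)
    ((f2' 0 (by omega) (by omega) (by omega) (by omega)).trans hu)
    ((f2' 1 (by omega) (by omega) (by omega) (by omega)).trans hv)
    ((f2 10 (by omega) (by omega) (by omega)).trans (by simp [hσ1])) hun hvn huv hk'T
    (by simp [recolour_apply])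
  rw [recolour_recolour] at hs3
  set χ' := recolour χ u v (k' + 1) with hχ'
  set σ3 := execBlock w (addEdge 10) σ2 with hσ3
  have f3' : ∀ r, r ≠ 10 → r ≠ 12 → r ≠ 13 → r ≠ 14 → σ3.reg r = σ.reg r :=
    fun r h1 h2 h3 h4 => (f3 r h2).trans (f2' r h1 h2 h3 h4)
  have hr3 : Ready n T q σ3 := ⟨(f3' 5 (by omega) (by omega) (by omega) (by omega)).trans hr.hN,
    (f3' 6 (by omega) (by omega) (by omega) (by omega)).trans hr.hT,
    (f3' 7 (by omega) (by omega) (by omega) (by omega)).trans hr.hq,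
    (f3' 21 (by omega) (by omega) (by omega) (by omega)).trans hr.hzero⟩
  have hrun := block_runs w (.set 10 (predE (.reg 10)) :: (removeEdge ++ addEdge 10)) σ (by
    simp [removeEdge, removeHalf, addEdge, addHalf, Stm.Wf, Ex.Wf, predE, succE, cntE, lstE, colE,
      posE, tagE, idxE])
  rw [execBlock, e1, execBlock_append, ← hσ2, ← hσ3] at hrun
  have h83 := f3' 8 (by omega) (by omega) (by omega) (by omega)
  obtain ⟨σ4, r4, p4, e4, c4⟩ := pushNear_runs hf hr3 hs3 (v := 0) (by omega)
    ((f3' 0 (by omega) (by omega) (by omega) (by omega)).trans hu) hun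
    ((f3' 9 (by omega) (by omega) (by omega) (by omega)).trans hk) hkT
    (by unfold inspectCost at hsp; omega)
  obtain ⟨σ5, r5, p5, e5, c5⟩ := pushNear_runs hf (p4.ready hr3) (p4.stores hs3) (v := 1)
    (by omega) ((p4.reg 1 (by omega) (by omega) (by omega) (by omega)).trans
      ((f3' 1 (by omega) (by omega) (by omega) (by omega)).trans hv)) hvn
    ((p4.reg 9 (by omega) (by omega) (by omega) (by omega)).trans
      ((f3' 9 (by omega) (by omega) (by omega) (by omega)).trans hk)) hkT
    (by unfold inspectCost at hsp; omega)
  have p := p4.trans p5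
  have a : AgreeAux σ.mem σ3.mem := a2.trans a3
  have hstack : ∀ c, OnStack σ3 c ↔ OnStack σ c := by
    intro c
    unfold OnStack
    rw [h83]
    exact exists_congr fun j => and_congr_right fun _ => by
      rw [a _ (.inl (by unfold stkAt; omega))]
  refine ⟨σ5, (hrun.seq (r4.seq r5)).mono ?_, p.ready hr3, p.stores hs3, ?_, ?_, ?_, ?_, ?_⟩
  · simp [removeEdge, removeHalf, addEdge, addHalf, blockCost, Stm.cost, Ex.cost, predE, succE,
      cntE, lstE, colE, posE, tagE, idxE, inspectCost]
    omega
  · unfold inspectCost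
    omega
  · intro b hb
    rw [p.rep b (by omega), a b (.inr hb)]
  · intro c hc
    exact p.keep c ((hstack c).2 hc)
  · intro c hc
    exact (p.valid c hc).imp (hstack c).1 id
  · rintro x y l (rfl | rfl) hl hy hxy
    · exact p5.keep _ (c4 l y hl hy hxy)
    · exact c5 l y hl hy hxy

/-- One inspection: the credit falls by more than a constant fraction of the time. -/
theorem fixStep_runs {w n T q : ℕ} {σ : State} {χ : ℕ → ℕ → ℕ} (hf : Fits w n T q)
    (hw : Working n T q σ χ) (h8 : 0 < σ.reg 8) (hsp : 8 * credit n T q σ χ + 8 < 2 ^ w) :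
    ∃ σ' χ' c, Runs w fixStep σ σ' c ∧ Working n T q σ' χ' ∧ (∀ a < 3, σ'.mem a = σ.mem a) ∧
      (∀ u v, χ' u v = 0 ↔ χ u v = 0) ∧
      c + 1 + 2500 * credit n T q σ' χ' ≤ 2500 * credit n T q σ χ := by
  obtain ⟨s, hs⟩ : ∃ s, σ.reg 8 = s + 1 := ⟨σ.reg 8 - 1, by omega⟩
  obtain ⟨u, hu, v, hv, htop⟩ := hw.valid _ ⟨s, by omega, rfl⟩
  have hpw := hf.lt_pow
  obtain ⟨σ1, r1, m1, o1, f1, u1, v1, s1, k1⟩ := popEdge_runs hf hw.ready hw.stores hs htop hu hv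
    (by unfold credit at hsp; omega)
  have hr1 : Ready n T q σ1 := ⟨(f1 5 (by omega) (by omega) (by omega) (by omega)
    (by omega)).trans hw.ready.hN, (f1 6 (by omega) (by omega) (by omega) (by omega)
    (by omega)).trans hw.ready.hT, (f1 7 (by omega) (by omega) (by omega) (by omega)
    (by omega)).trans hw.ready.hq, (f1 21 (by omega) (by omega) (by omega) (by omega)
    (by omega)).trans hw.ready.hzero⟩
  have hs1 : Stores n T σ1 χ := ⟨hw.stores.colouring, by rw [m1]; exact hw.stores.represents,
    by rw [o1]; exact hw.stores.describes⟩
  have hsymm := hw.stores.colouring.symm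
  have hpop : ∀ c, OnStack σ c → c = u * (4 * n) + v ∨ OnStack σ1 c := by
    intro c hc
    have := onStack_pop (σ' := σ1) (by omega) m1 hc
    rwa [s1, htop] at this
  have hpop' : ∀ c, OnStack σ1 c → OnStack σ c := fun c hc =>
    onStack_of_pop (σ' := σ1) (by omega) m1 hc
  have htop_iff : ∀ {x y : ℕ}, y < n → x * (4 * n) + y = u * (4 * n) + v → x = u ∧ y = v :=
    fun hy h => (index_inj (by omega) (by omega)).1 h
  -- what remains of the invariant if the popped edge is not violating
  have hkeep : ¬ Violating n T q χ u v → ∀ σ2 : State, σ2.mem = σ1.mem → σ2.out = σ1.out →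
      (∀ r, r = 5 ∨ r = 6 ∨ r = 7 ∨ r = 8 ∨ r = 21 → σ2.reg r = σ1.reg r) →
      Working n T q σ2 χ ∧ (∀ a < 3, σ2.mem a = σ.mem a) ∧
        credit n T q σ2 χ + 1 = credit n T q σ χ := by
    intro hnv σ2 m2 o2 f2
    have hst : ∀ c, OnStack σ2 c ↔ OnStack σ1 c := by
      intro c
      unfold OnStack
      rw [m2, f2 8 (by omega)]
    refine ⟨⟨⟨(f2 5 (by omega)).trans hr1.hN, (f2 6 (by omega)).trans hr1.hT,
      (f2 7 (by omega)).trans hr1.hq, (f2 21 (by omega)).trans hr1.hzero⟩,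
      ⟨hs1.colouring, by rw [m2]; exact hs1.represents, by rw [o2]; exact hs1.describes⟩,
      fun c hc => hw.valid c (hpop' c ((hst c).1 hc)), ?_⟩, fun a _ => by rw [m2, m1], ?_⟩
    · intro x hx y hy hxy
      rw [hst, hst]
      rcases hw.cover x hx y hy hxy with h | h
      · rcases hpop _ h with h | h
        · obtain ⟨rfl, rfl⟩ := htop_iff hy h
          exact absurd hxy hnv
        · exact .inl h
      · rcases hpop _ h with h | h
        · obtain ⟨rfl, rfl⟩ := htop_iff hx h
          exact absurd (hxy.symm hsymm) hnv
        · exact .inr h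
    · unfold credit
      rw [f2 8 (by omega)]
      omega
  have hempty := fun σ2 => block_runs w [] σ2 (by simp)
  have hwf0 : (Ex.const 0).Wf := trivial
  have e0 : ∀ σ2, (Ex.const 0).eval w σ2 = 0 := fun σ2 => Nat.zero_mod _
  rcases Nat.eq_zero_or_pos (χ u v) with h0 | hpos
  · -- the edge has been deleted
    obtain ⟨hw', hm', hc'⟩ := hkeep (by
      rintro ⟨k, k', h1, -⟩
      omega) σ1 rfl rfl (fun _ _ => rfl)
    refine ⟨σ1, χ, _, r1.seq (Runs.ite_neg hwf0 (by simp [Ex.Wf]) (by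
      rw [e0]; simp only [Ex.eval]; omega) (hempty σ1)), hw', hm', fun _ _ => Iff.rfl, ?_⟩
    simp only [Ex.cost, blockCost]
    omega
  · obtain ⟨k, hk⟩ : ∃ k, χ u v = k + 1 := ⟨χ u v - 1, by omega⟩
    have hkT : k < T := by have := hw.stores.colouring.le u v; omega
    have huv : u ≠ v := by
      rintro rfl
      rw [hw.stores.colouring.irrefl] at hk
      omega
    have rk := block_runs w [.set 9 (predE (.reg 9))] σ1 (by simp [Stm.Wf, Ex.Wf, predE])
    set σ2 : State := ⟨Function.update σ1.reg 9 k, σ1.mem, σ1.out⟩ with hσ2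
    rw [show execBlock w [.set 9 (predE (.reg 9))] σ1 = σ2 by
      simp [hσ2, execBlock, Stm.exec, predE, Ex.eval, WordOp.eval, k1, hk,
        Nat.mod_eq_of_lt (by omega : 1 < 2 ^ w)]] at rk
    have f2 : ∀ r, r ≠ 9 → σ2.reg r = σ1.reg r := fun r h => by simp [hσ2, h]
    obtain ⟨σ3, r3, m3, o3, f3, i3⟩ := inspect_runs (σ := σ2) (k := k) hf
      ⟨(f2 5 (by omega)).trans hr1.hN, (f2 6 (by omega)).trans hr1.hT,
        (f2 7 (by omega)).trans hr1.hq, (f2 21 (by omega)).trans hr1.hzero⟩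
      ⟨hs1.colouring, hs1.represents, hs1.describes⟩ ((f2 0 (by omega)).trans u1)
      ((f2 1 (by omega)).trans v1) (by simp [hσ2]) hu hv hkT
    have f3' : ∀ r, r ≠ 9 → r ≠ 10 → r ≠ 15 → r ≠ 18 → r ≠ 19 → σ3.reg r = σ1.reg r :=
      fun r h1 h2 h3 h4 h5 => (f3 r h2 h3 h4 h5).trans (f2 r h1)
    have hcond : (Ex.const 0).eval w σ1 < (Ex.reg 9).eval w σ1 := by
      rw [e0]; simp only [Ex.eval]; omega
    rcases i3 with ⟨h10, hno⟩ | ⟨k', h10, hnear, himp⟩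
    · -- no improvement
      obtain ⟨hw', hm', hc'⟩ := hkeep (by
        rintro ⟨l, l', h1, h2, h3⟩
        obtain rfl : k = l := by omega
        exact hno l' h2 h3) σ3 m3 o3 (fun r h => f3' r (by omega) (by omega) (by omega) (by omega)
          (by omega))
      refine ⟨σ3, χ, _, r1.seq (Runs.ite_pos hwf0 (by simp [Ex.Wf]) hcond (rk.seq (r3.seq
        (Runs.ite_neg hwf0 (by simp [Ex.Wf]) (by rw [e0]; simp only [Ex.eval]; omega)
          (hempty σ3))))), hw', hm', fun _ _ => Iff.rfl, ?_⟩
      simp only [Ex.cost, blockCost, Stm.cost, predE]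
      omega
    · -- recolouring
      have hpot := potential_recolour hw.stores.colouring hf.qpos hu hv huv hk himp
      have hcost := inspectCost_recolour_le (k' := k') hw.stores.colouring hu hv huv hk
      have h83 := f3' 8 (by omega) (by omega) (by omega) (by omega) (by omega)
      have hs3 : Stores n T σ3 χ :=
        ⟨hs1.colouring, by rw [m3]; exact hs1.represents, by rw [o3]; exact hs1.describes⟩
      obtain ⟨σ4, r4, hr4, hs4, e4, a4, keep4, valid4, cover4⟩ := recolourEdge_runs hf
        (σ := σ3) (k := k) (k' := k')
        ⟨(f3' 5 (by omega) (by omega) (by omega) (by omega) (by omega)).trans hr1.hN,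
          (f3' 6 (by omega) (by omega) (by omega) (by omega) (by omega)).trans hr1.hT,
          (f3' 7 (by omega) (by omega) (by omega) (by omega) (by omega)).trans hr1.hq,
          (f3' 21 (by omega) (by omega) (by omega) (by omega) (by omega)).trans hr1.hzero⟩
        hs3 ((f3' 0 (by omega) (by omega) (by omega) (by omega) (by omega)).trans u1)
        ((f3' 1 (by omega) (by omega) (by omega) (by omega) (by omega)).trans v1)
        ((f3 9 (by omega) (by omega) (by omega) (by omega)).trans (by simp [hσ2])) h10 hu hv huv hk
        himp.1 (by unfold credit at hsp; omega)
      have hst : ∀ c, OnStack σ3 c ↔ OnStack σ1 c := by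
        intro c
        unfold OnStack
        rw [h83, m3]
      have hkvu : χ v u = k + 1 := by rw [hsymm, hk]
      have hload := load_recolour_eq (k' := k') hu hv huv hk hkvu
      set χ' := recolour χ u v (k' + 1) with hχ'
      refine ⟨σ4, χ', _, r1.seq (Runs.ite_pos hwf0 (by simp [Ex.Wf]) hcond (rk.seq (r3.seq
        (Runs.ite_pos hwf0 (by simp [Ex.Wf]) (by rw [e0]; simp only [Ex.eval]; omega)
          r4)))), ⟨hr4, hs4, ?_, ?_⟩, ?_, ?_, ?_⟩
      · intro c hc
        rcases valid4 c hc with h | h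
        · exact hw.valid c (hpop' c ((hst c).1 h))
        · exact h
      · intro x hx y hy hxy
        obtain ⟨l, l', hl, -⟩ := id hxy
        by_cases hcx : (x = u ∨ x = v) ∧ Near k l
        · exact .inl (cover4 x y l hcx.1 hcx.2 hy hl)
        by_cases hcy : (y = u ∨ y = v) ∧ Near k l
        · exact .inr (cover4 y x l hcy.1 hcy.2 hx (by rw [hs4.colouring.symm, hl]))
        have hne : ¬ ((x = u ∧ y = v) ∨ (x = v ∧ y = u)) := by
          intro h
          have hl' := hl
          rw [hχ', recolour_apply, if_pos h] at hl'
          obtain rfl : k' = l := by omega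
          exact hcx ⟨by omega, hnear⟩
        have hl0 : χ x y = l + 1 := by
          rwa [hχ', recolour_apply, if_neg hne] at hl
        have hold : Violating n T q χ x y := by
          refine Violating.of_recolour (u := u) (v := v) (k := k) ?_ ?_ ?_ hl hl0 hcx hcy hxy
          · intro w' p hw' hp
            have h1 : p ≠ k := fun e => hp (by rw [e]; exact .inl rfl)
            have h2 : p ≠ k' := fun e => hp (by rw [e]; exact hnear)
            have := hload w' p
            simpa [h1, h2] using this
          · intro w' l hw' hl
            have := hload w' l
            rw [if_neg (by simp [hl])] at this
            omega
          · intro w' l h1 h2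
            have := hload w' l
            simpa [h1, h2] using this
        rcases hw.cover x hx y hy hold with h | h
        · rcases hpop _ h with h | h
          · exact absurd (.inl (htop_iff hy h)) hne
          · exact .inl (keep4 _ ((hst _).2 h))
        · rcases hpop _ h with h | h
          · exact absurd (.inr (htop_iff hx h).symm) hne
          · exact .inr (keep4 _ ((hst _).2 h))
      · intro a ha
        rw [a4 a ha, m3]
        exact congrFun m1 a
      · intro a b
        rw [hχ', recolour_apply]
        split_ifs with h
        · have : χ a b = k + 1 := by
            rcases h with ⟨rfl, rfl⟩ | ⟨rfl, rfl⟩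
            · exact hk
            · exact hkvu
          exact ⟨fun e => e.elim, fun e => by omega⟩
        · rfl
      · simp only [Ex.cost, blockCost, Stm.cost, predE]
        unfold credit
        rw [e4, h83, s1, hs]
        omega

/-- The loop ends in a colouring without violations; its running time is paid by the credit. -/
theorem fixLoop_runs {w n T q : ℕ} (hf : Fits w n T q) : ∀ (d : ℕ) (σ : State) (χ : ℕ → ℕ → ℕ),
    credit n T q σ χ ≤ d → Working n T q σ χ → 8 * credit n T q σ χ + 8 < 2 ^ w →
    ∃ σ' χ' c, Runs w fixLoop σ σ' c ∧ Ready n T q σ' ∧ Stores n T σ' χ' ∧ σ'.reg 8 = 0 ∧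
      (∀ u < n, ∀ v < n, ¬ Violating n T q χ' u v) ∧ (∀ a < 3, σ'.mem a = σ.mem a) ∧
      (∀ u v, χ' u v = 0 ↔ χ u v = 0) ∧
      c + 2500 * (2 * (q * potential n T χ')) ≤ 2500 * credit n T q σ χ + 1 := by
  intro d
  induction d with
  | zero =>
    intro σ χ hd hw hsp
    have h8 : σ.reg 8 = 0 := by unfold credit at hd; omega
    refine ⟨σ, χ, 1, Runs.loop_exit (by omega) (by omega) (by omega), hw.ready, hw.stores, h8, ?_,
      fun _ _ => rfl, fun _ _ => Iff.rfl, by unfold credit; omega⟩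
    intro u hu v hv h
    rcases hw.cover u hu v hv h with ⟨j, hj, -⟩ | ⟨j, hj, -⟩ <;> omega
  | succ d ih =>
    intro σ χ hd hw hsp
    by_cases h8 : σ.reg 8 = 0
    · refine ⟨σ, χ, 1, Runs.loop_exit (by omega) (by omega) (by omega), hw.ready, hw.stores, h8, ?_,
        fun _ _ => rfl, fun _ _ => Iff.rfl, by unfold credit; omega⟩
      intro u hu v hv h
      rcases hw.cover u hu v hv h with ⟨j, hj, -⟩ | ⟨j, hj, -⟩ <;> omega
    · obtain ⟨σ1, χ1, c1, r1, hw1, hm1, hz1, hc1⟩ := fixStep_runs hf hw (by omega) hsp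
      obtain ⟨σ2, χ2, c2, r2, hr2, hs2, h82, hv2, hm2, hz2, hc2⟩ := ih σ1 χ1 (by omega) hw1
        (by omega)
      exact ⟨σ2, χ2, _, Runs.loop_step (by omega) (by omega) (by have := hw.ready.hzero; omega)
        r1 r2, hr2, hs2, h82, hv2, fun a ha => (hm2 a ha).trans (hm1 a ha),
        fun u v => (hz2 u v).trans (hz1 u v), by omega⟩

/-! ### The update programs -/

/-- Push all edges that the change of an edge of the colour in register `9` may have made
violating, and remove all violations. -/
def settle : Code := .seq (pushNear 0) (.seq (pushNear 1) fixLoop)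

/-- Insertion: the new edge gets the colour `0`. -/
def insertCode : Code := .seq (block (.set 9 (.const 0) :: addEdge 9)) settle

/-- Deletion: the colour of the edge is looked up, and the edge is removed. -/
def deleteCode : Code :=
  .seq (block (.set 9 (predE (.load (colE (.reg 0) (.reg 1)))) :: removeEdge)) settle

/-- The invariant that holds between updates. -/
structure Stable (n T q : ℕ) (σ : State) (χ : ℕ → ℕ → ℕ) : Prop where
  ready : Ready n T q σ
  stores : Stores n T σ χ
  empty : σ.reg 8 = 0
  stable : ∀ u < n, ∀ v < n, ¬ Violating n T q χ u v

theorem settle_runs {w n T q : ℕ} {σ : State} {χ : ℕ → ℕ → ℕ} {u v k : ℕ} (hf : Fits w n T q)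
    (hbig : 8 * (2 * (q * n ^ 3) + 8 * n) + 8 < 2 ^ w)
    (hr : Ready n T q σ) (hs : Stores n T σ χ) (h8 : σ.reg 8 = 0)
    (hu : σ.reg 0 = u) (hv : σ.reg 1 = v) (hk : σ.reg 9 = k) (hun : u < n) (hvn : v < n)
    (hkT : k < T)
    (hcover : ∀ x < n, ∀ y < n, ∀ l, χ x y = l + 1 → Violating n T q χ x y →
      ((x = u ∨ x = v) ∧ Near k l) ∨ ((y = u ∨ y = v) ∧ Near k l)) :
    ∃ σ' χ' c, Runs w settle σ σ' c ∧ Stable n T q σ' χ' ∧ (∀ a < 3, σ'.mem a = σ.mem a) ∧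
      (∀ u v, χ' u v = 0 ↔ χ u v = 0) ∧
      c + 5000 * (q * potential n T χ') ≤
        5000 * (q * potential n T χ) + 2600 * inspectCost n χ u v k + 401 := by
  have hlu := nearSum_load_le χ u k (n := n)
  have hlv := nearSum_load_le χ v k (n := n)
  have hpot : q * potential n T χ ≤ q * n ^ 3 := Nat.mul_le_mul_left _ (potential_le χ)
  obtain ⟨σ1, r1, p1, e1, c1⟩ := pushNear_runs hf hr hs (v := 0) (by omega) hu hun hk hkT
    (by omega)
  obtain ⟨σ2, r2, p2, e2, c2⟩ := pushNear_runs hf (p1.ready hr) (p1.stores hs) (v := 1) (by omega)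
    ((p1.reg 1 (by omega) (by omega) (by omega) (by omega)).trans hv) hvn
    ((p1.reg 9 (by omega) (by omega) (by omega) (by omega)).trans hk) hkT (by omega)
  have p := p1.trans p2
  have hcredit : credit n T q σ2 χ = 2 * (q * potential n T χ) + inspectCost n χ u v k := by
    unfold credit inspectCost
    omega
  have hon : ∀ x y l, (x = u ∨ x = v) → Near k l → y < n → χ x y = l + 1 →
      OnStack σ2 (x * (4 * n) + y) := by
    rintro x y l (rfl | rfl) hl hy hxy
    · exact p2.keep _ (c1 l y hl hy hxy)
    · exact c2 l y hl hy hxy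
  have hw : Working n T q σ2 χ := by
    refine ⟨p.ready hr, p.stores hs, fun c hc => ?_, fun x hx y hy hxy => ?_⟩
    · refine (p.valid c hc).resolve_left ?_
      rintro ⟨j, hj, -⟩
      omega
    · obtain ⟨l, l', hl, -⟩ := id hxy
      rcases hcover x hx y hy l hl hxy with h | h
      · exact .inl (hon x y l h.1 h.2 hy hl)
      · exact .inr (hon y x l h.1 h.2 hx (by rw [hs.colouring.symm, hl]))
  obtain ⟨σ3, χ3, c3, r3, hr3, hs3, h83, hv3, hm3, hz3, hc3⟩ := fixLoop_runs hf _ σ2 χ le_rfl hw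
    (by rw [hcredit]; unfold inspectCost; omega)
  refine ⟨σ3, χ3, _, r1.seq (r2.seq r3), ⟨hr3, hs3, h83, hv3⟩, fun a ha => ?_, hz3, ?_⟩
  · rw [hm3 a ha, p.rep a (by omega)]
  · rw [hcredit] at hc3
    unfold inspectCost at *
    omega

theorem insertCode_runs {w n T q : ℕ} {σ : State} {χ : ℕ → ℕ → ℕ} {u v : ℕ} (hf : Fits w n T q)
    (hbig : 8 * (2 * (q * n ^ 3) + 8 * n) + 8 < 2 ^ w)
    (h : Stable n T q σ χ) (hu : σ.reg 0 = u) (hv : σ.reg 1 = v)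
    (hun : u < n) (hvn : v < n) (huv : u ≠ v) (hc : χ u v = 0) {L : ℕ}
    (hL : ∀ w < n, ∀ l, load n χ w l ≤ L) :
    ∃ σ' χ' c, Runs w insertCode σ σ' c ∧ Stable n T q σ' χ' ∧ (∀ a < 3, σ'.mem a = σ.mem a) ∧
      (∀ a b, χ' a b = 0 ↔ recolour χ u v 1 a b = 0) ∧
      c + 5000 * (q * potential n T χ') ≤
        5000 * (q * potential n T χ) + 50000 * (q * (L + 1)) := by
  have hw := hf.lt_pow
  have hcvu : χ v u = 0 := by rw [h.stores.colouring.symm, hc]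
  have hrun := block_runs w (.set 9 (.const 0) :: addEdge 9) σ (by
    simp [addEdge, addHalf, Stm.Wf, Ex.Wf, succE, cntE, lstE, colE, posE, tagE, idxE])
  set σ1 : State := ⟨Function.update σ.reg 9 0, σ.mem, σ.out⟩ with hσ1
  have f1 : ∀ r, r ≠ 9 → σ1.reg r = σ.reg r := fun r hr => by simp [hσ1, hr]
  have hr1 : Ready n T q σ1 := ⟨(f1 5 (by omega)).trans h.ready.hN, (f1 6 (by omega)).trans
    h.ready.hT, (f1 7 (by omega)).trans h.ready.hq, (f1 21 (by omega)).trans h.ready.hzero⟩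
  obtain ⟨hs2, a2, f2⟩ := execBlock_addEdge hf hr1
    ⟨h.stores.colouring, h.stores.represents, h.stores.describes⟩ (r := 9) (k := 0) (by omega)
    ((f1 0 (by omega)).trans hu) ((f1 1 (by omega)).trans hv) (by simp [hσ1]) hun hvn huv hf.pos hc
  rw [execBlock, show Stm.exec w σ (.set 9 (.const 0)) = σ1 by
    simp [hσ1, Stm.exec, Ex.eval]] at hrun
  set σ2 := execBlock w (addEdge 9) σ1 with hσ2
  have hload := load_recolour_of_absent (k := 0) hun hvn huv hc hcvu
  have hpot := potential_of_add hun hvn huv hf.pos hload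
  rw [Nat.zero_add] at *
  set χ1 := recolour χ u v 1 with hχ1
  have hcost : inspectCost n χ1 u v 0 ≤ 8 * (L + 1) := by
    have h1 : ∀ x < n, ∀ l, load n χ1 x l ≤ L + 1 := by
      intro x hx l
      have := hload x l
      have := hL x hx l
      split_ifs at * <;> omega
    unfold inspectCost nearSum
    have := h1 u hun 0
    have := h1 v hvn 0
    have := h1 u hun 1
    have := h1 v hvn 1
    have := h1 u hun 2
    have := h1 v hvn 2
    simp
    omega
  obtain ⟨σ3, χ3, c3, r3, hst3, hm3, hz3, hc3⟩ := settle_runs hf hbig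
    (σ := σ2) (χ := χ1) (u := u) (v := v) (k := 0)
    ⟨(f2 5 (by omega)).trans hr1.hN, (f2 6 (by omega)).trans hr1.hT,
      (f2 7 (by omega)).trans hr1.hq, (f2 21 (by omega)).trans hr1.hzero⟩ hs2
    ((f2 8 (by omega)).trans ((f1 8 (by omega)).trans h.empty))
    ((f2 0 (by omega)).trans ((f1 0 (by omega)).trans hu))
    ((f2 1 (by omega)).trans ((f1 1 (by omega)).trans hv))
    ((f2 9 (by omega)).trans (by simp [hσ1])) hun hvn hf.pos (by
      intro x hx y hy l hl hxy
      by_contra hcon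
      rw [not_or] at hcon
      have hne : ¬ ((x = u ∧ y = v) ∨ (x = v ∧ y = u)) := by
        intro hh
        have hl' := hl
        rw [hχ1, recolour_apply, if_pos hh] at hl'
        obtain rfl : l = 0 := by omega
        exact hcon.1 ⟨by omega, .inl rfl⟩
      have hl0 : χ x y = l + 1 := by
        rwa [hχ1, recolour_apply, if_neg hne] at hl
      refine h.stable x hx y hy (Violating.of_recolour (u := u) (v := v) (k := 0) ?_ ?_ ?_
        hl hl0 hcon.1 hcon.2 hxy)
      · intro w' p hw' hp
        have h1 : p ≠ 0 := fun e => hp (by rw [e]; exact .inl rfl)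
        have := hload w' p
        simpa [h1] using this
      · intro w' p hw' hp
        have := hload w' p
        omega
      · intro w' p h1 h2
        have := hload w' p
        simpa [h1, h2] using this)
  refine ⟨σ3, χ3, _, hrun.seq r3, hst3, fun a ha => ?_, hz3, ?_⟩
  · rw [hm3 a ha, a2 a (.inr ha)]
  · have h1 := hL u hun 0
    have h2 := hL v hvn 0
    have h3 : q * potential n T χ1 ≤ q * potential n T χ + q * (4 * (L + 1)) := by
      rw [← mul_add]
      exact Nat.mul_le_mul_left _ (by omega)
    have h4 : L + 1 ≤ q * (L + 1) := Nat.le_mul_of_pos_left _ hf.qpos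
    have h5 : q * (4 * (L + 1)) = 4 * (q * (L + 1)) := by ring
    simp only [addEdge, addHalf, blockCost, Stm.cost, Ex.cost, succE, cntE, lstE, colE, posE, tagE,
      idxE, List.cons_append, List.nil_append]
    omega

theorem deleteCode_runs {w n T q : ℕ} {σ : State} {χ : ℕ → ℕ → ℕ} {u v : ℕ} (hf : Fits w n T q)
    (hbig : 8 * (2 * (q * n ^ 3) + 8 * n) + 8 < 2 ^ w)
    (h : Stable n T q σ χ) (hu : σ.reg 0 = u) (hv : σ.reg 1 = v)
    (hun : u < n) (hvn : v < n) (hc : χ u v ≠ 0) {L : ℕ}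
    (hL : ∀ w < n, ∀ l, load n χ w l ≤ L) :
    ∃ σ' χ' c, Runs w deleteCode σ σ' c ∧ Stable n T q σ' χ' ∧ (∀ a < 3, σ'.mem a = σ.mem a) ∧
      (∀ a b, χ' a b = 0 ↔ recolour χ u v 0 a b = 0) ∧
      c + 5000 * (q * potential n T χ') ≤
        5000 * (q * potential n T χ) + 50000 * (q * (L + 1)) := by
  have hw := hf.lt_pow
  obtain ⟨k, hk⟩ : ∃ k, χ u v = k + 1 := ⟨χ u v - 1, by omega⟩
  have hkT : k < T := by have := h.stores.colouring.le u v; omega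
  have hkvu : χ v u = k + 1 := by rw [h.stores.colouring.symm, hk]
  have huv : u ≠ v := by
    rintro rfl
    rw [h.stores.colouring.irrefl] at hk
    omega
  have hrun := block_runs w (.set 9 (predE (.load (colE (.reg 0) (.reg 1)))) :: removeEdge) σ (by
    simp [removeEdge, removeHalf, Stm.Wf, Ex.Wf, predE, cntE, lstE, colE, posE, tagE, idxE])
  set σ1 : State := ⟨Function.update σ.reg 9 k, σ.mem, σ.out⟩ with hσ1
  have f1 : ∀ r, r ≠ 9 → σ1.reg r = σ.reg r := fun r hr => by simp [hσ1, hr]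
  have e1 : Stm.exec w σ (.set 9 (predE (.load (colE (.reg 0) (.reg 1))))) = σ1 := by
    have := eval_colE hf.room h.ready.hN (eval_reg hu) (eval_reg hv) (by omega) (by omega)
    simp only [hσ1, Stm.exec, predE, Ex.eval, this, WordOp.eval,
      Nat.mod_eq_of_lt (by omega : 1 < 2 ^ w)]
    rw [h.stores.represents.col u hun v hvn, hk, Nat.add_sub_cancel]
  have hr1 : Ready n T q σ1 := ⟨(f1 5 (by omega)).trans h.ready.hN, (f1 6 (by omega)).trans
    h.ready.hT, (f1 7 (by omega)).trans h.ready.hq, (f1 21 (by omega)).trans h.ready.hzero⟩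
  obtain ⟨hs2, a2, f2⟩ := execBlock_removeEdge hf hr1
    ⟨h.stores.colouring, h.stores.represents, h.stores.describes⟩ (k := k)
    ((f1 0 (by omega)).trans hu) ((f1 1 (by omega)).trans hv) (by simp [hσ1]) hun hvn huv hk
  rw [execBlock, e1] at hrun
  set σ2 := execBlock w removeEdge σ1 with hσ2
  have hload := load_eq_recolour_zero hun hvn huv hk hkvu
  set χ1 := recolour χ u v 0 with hχ1
  have hpot : potential n T χ1 ≤ potential n T χ := potential_mono fun x l => by
    have := hload x l
    omega
  have hcost : inspectCost n χ1 u v k ≤ 8 * L := by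
    have h1 : ∀ x < n, ∀ l, load n χ1 x l ≤ L := by
      intro x hx l
      have := hload x l
      have := hL x hx l
      omega
    unfold inspectCost nearSum
    have := h1 u hun k
    have := h1 v hvn k
    have := h1 u hun ((k - 1) / 2)
    have := h1 v hvn ((k - 1) / 2)
    have := h1 u hun (2 * k + 1)
    have := h1 v hvn (2 * k + 1)
    have := h1 u hun (2 * k + 2)
    have := h1 v hvn (2 * k + 2)
    omega
  obtain ⟨σ3, χ3, c3, r3, hst3, hm3, hz3, hc3⟩ := settle_runs hf hbig
    (σ := σ2) (χ := χ1) (u := u) (v := v) (k := k)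
    ⟨(f2 5 (by omega) (by omega) (by omega)).trans hr1.hN,
      (f2 6 (by omega) (by omega) (by omega)).trans hr1.hT,
      (f2 7 (by omega) (by omega) (by omega)).trans hr1.hq,
      (f2 21 (by omega) (by omega) (by omega)).trans hr1.hzero⟩ hs2
    ((f2 8 (by omega) (by omega) (by omega)).trans ((f1 8 (by omega)).trans h.empty))
    ((f2 0 (by omega) (by omega) (by omega)).trans ((f1 0 (by omega)).trans hu))
    ((f2 1 (by omega) (by omega) (by omega)).trans ((f1 1 (by omega)).trans hv))
    ((f2 9 (by omega) (by omega) (by omega)).trans (by simp [hσ1])) hun hvn hkT (by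
      intro x hx y hy l hl hxy
      by_contra hcon
      rw [not_or] at hcon
      have hl0 : χ x y = l + 1 := by
        rw [hχ1, recolour_apply] at hl
        split_ifs at hl
        exact hl
      refine h.stable x hx y hy (Violating.of_recolour (u := u) (v := v) (k := k) ?_ ?_ ?_
        hl hl0 hcon.1 hcon.2 hxy)
      · intro w' p hw' hp
        have h1 : p ≠ k := fun e => hp (by rw [e]; exact .inl rfl)
        have := hload w' p
        simpa [h1] using this.symm
      · intro w' p hw' hp
        have := hload w' p
        simp only [hp, and_false, if_false] at this
        omega
      · intro w' p h1 h2
        have := hload w' p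
        simpa [h1, h2] using this.symm)
  refine ⟨σ3, χ3, _, hrun.seq r3, hst3, fun a ha => ?_, hz3, ?_⟩
  · rw [hm3 a ha, a2 a (.inr ha)]
  · have h3 : q * potential n T χ1 ≤ q * potential n T χ := Nat.mul_le_mul_left _ hpot
    have h4 : L + 1 ≤ q * (L + 1) := Nat.le_mul_of_pos_left _ hf.qpos
    simp only [removeEdge, removeHalf, blockCost, Stm.cost, Ex.cost, predE, cntE, lstE, colE, posE,
      tagE, idxE, List.cons_append, List.nil_append]
    omega

/-! ### The initialisation -/

/-- The product of the registers `6` and `m`. -/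
def mulE (m : ℕ) : Ex := .op .mul (.reg 6) (.reg m)

/-- Multiply register `6` by register `m`, and count the multiplications in register `c`, as long
as the product with register `7` remains below register `12`. -/
def grow (m c : ℕ) : Code :=
  .seq (block [.set 13 (.op .mul (mulE m) (.reg 7))])
    (.loop 13 12 (block [.set 6 (mulE m), .set c (succE (.reg c)),
      .set 13 (.op .mul (mulE m) (.reg 7))]))

/-- The initialisation. It determines the numbers `i` and `j` of splittings, in the registers `10`
and `11`, and the number `t₁ ^ i * t₂ ^ j` of colours, in register `6`, such that the average degree
`Δ / (t₁ ^ i * t₂ ^ j)` is between `t₂ ^ 7` and `t₂ ^ 8`, or there is one colour only. -/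
def initCode : Code :=
  .seq (block [.set 5 (.op .mul (.const 4) (.reg 0)),
      .set 7 (.op .mul (.op .mul (.op .mul (.reg 3) (.reg 3)) (.op .mul (.reg 3) (.reg 3)))
        (.op .mul (.op .mul (.reg 3) (.reg 3)) (.reg 3))),
      .set 6 (.const 1), .set 12 (succE (.reg 1))])
    (.seq (grow 2 10) (.seq (grow 3 11)
      (block [.store (.const 0) (.op .add (.reg 10) (.reg 11)), .store (.const 1) (.reg 10),
        .store (.const 2) (.reg 11)])))

theorem growLoop_runs {w m c t q D : ℕ} (hm : m < 5) (hc : 9 < c) (hc' : c < 12) (ht : 2 ≤ t)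
    (hq : 0 < q) (hD : D * t * q < 2 ^ w) : ∀ (d : ℕ) (σ : State) (T : ℕ), D ≤ T + d → 0 < T →
    T ≤ D → σ.reg 6 = T → σ.reg m = t → σ.reg 7 = q → σ.reg 12 = D → σ.reg 13 = T * t * q →
    σ.reg c ≤ T →
    ∃ σ' e, Runs w (.loop 13 12 (block [.set 6 (mulE m), .set c (succE (.reg c)),
        .set 13 (.op .mul (mulE m) (.reg 7))])) σ σ' (60 * e + 1) ∧
      σ'.reg 6 = T * t ^ e ∧ σ'.reg c = σ.reg c + e ∧ D ≤ T * t ^ e * t * q ∧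
      (e = 0 ∨ T * t ^ e * q < D) ∧ σ'.mem = σ.mem ∧ σ'.out = σ.out ∧
      ∀ r, r ≠ 6 → r ≠ c → r ≠ 13 → σ'.reg r = σ.reg r := by
  intro d
  induction d with
  | zero =>
    intro σ T hDT hT hTD h6 hmt h7 h12 h13 hcT
    have h1 : T * 1 * 1 ≤ T * t * q := Nat.mul_le_mul (Nat.mul_le_mul_left _ (by omega)) hq
    refine ⟨σ, 0, (Runs.loop_exit (by omega) (by omega) (by omega)).mono (by omega), by simp [h6],
      rfl, by simp; omega, .inl rfl, rfl, rfl, fun _ _ _ _ => rfl⟩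
  | succ d ih =>
    intro σ T hDT hT hTD h6 hmt h7 h12 h13 hcT
    by_cases hlt : T * t * q < D
    · have h1 : T * t * 1 ≤ T * t * q := Nat.mul_le_mul_left _ hq
      have h2 : T * 2 ≤ T * t := Nat.mul_le_mul_left _ ht
      have h3 : T * t * t * q ≤ D * t * q :=
        Nat.mul_le_mul_right _ (Nat.mul_le_mul_right _ (by omega))
      have h4 : T * t * t * 1 ≤ T * t * t * q := Nat.mul_le_mul_left _ hq
      have h5 : T * t * 1 ≤ T * t * t := Nat.mul_le_mul_left _ (by omega)
      have hrun := block_runs w [.set 6 (mulE m), .set c (succE (.reg c)),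
        .set 13 (.op .mul (mulE m) (.reg 7))] σ (by
          simp [Stm.Wf, Ex.Wf, mulE, succE]; omega)
      have he : execBlock w [.set 6 (mulE m), .set c (succE (.reg c)),
          .set 13 (.op .mul (mulE m) (.reg 7))] σ =
          ⟨Function.update (Function.update (Function.update σ.reg 6 (T * t)) c (σ.reg c + 1)) 13
            (T * t * t * q), σ.mem, σ.out⟩ := by
        have hm6 : m ≠ 6 := by omega
        have hmc : m ≠ c := by omega
        have hc6 : c ≠ 6 := by omega
        have hc7 : (7 : ℕ) ≠ c := by omega
        simp [execBlock, Stm.exec, mulE, succE, Ex.eval, WordOp.eval, h6, hmt, h7, hm6, hmc, hc6,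
          hc6.symm, hc7, Nat.mod_eq_of_lt (by omega : 1 < 2 ^ w),
          Nat.mod_eq_of_lt (by omega : T * t < 2 ^ w),
          Nat.mod_eq_of_lt (by omega : σ.reg c + 1 < 2 ^ w),
          Nat.mod_eq_of_lt (by omega : T * t * t * q < 2 ^ w)]
      rw [he] at hrun
      obtain ⟨σ', e, r', g1, g2, g3, g4, g5, g6, g7⟩ := ih ⟨Function.update (Function.update
        (Function.update σ.reg 6 (T * t)) c (σ.reg c + 1)) 13 (T * t * t * q), σ.mem, σ.out⟩
        (T * t) (by omega) (by omega)
        (by omega) (by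
          simp only
          rw [Function.update_of_ne (by omega), Function.update_of_ne (by omega),
            Function.update_self]) (by
          simp only
          rw [Function.update_of_ne (by omega), Function.update_of_ne (by omega),
            Function.update_of_ne (by omega), hmt]) (by
          simp only
          rw [Function.update_of_ne (by omega), Function.update_of_ne (by omega),
            Function.update_of_ne (by omega), h7]) (by
          simp only
          rw [Function.update_of_ne (by omega), Function.update_of_ne (by omega),
            Function.update_of_ne (by omega), h12]) (by simp) (by
          simp only
          rw [Function.update_of_ne (by omega), Function.update_self]
          omega)
      have hpow : T * t ^ (e + 1) = T * t * t ^ e := by ring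
      refine ⟨σ', e + 1, (Runs.loop_step (by omega) (by omega) (by omega) hrun r').mono ?_,
        by rw [g1, hpow], ?_, by rw [hpow]; exact g3, .inr ?_, g5, g6, ?_⟩
      · simp only [blockCost, Stm.cost, Ex.cost, mulE, succE]
        omega
      · rw [g2]
        simp only
        rw [Function.update_of_ne (by omega), Function.update_self]
        omega
      · rcases g4 with rfl | g4
        · simpa using hlt
        · rwa [hpow]
      · intro r h1 h2 h3
        rw [g7 r h1 h2 h3]
        simp [h1, h2, h3]
    · exact ⟨σ, 0, (Runs.loop_exit (by omega) (by omega) (by omega)).mono (by omega), by simp [h6],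
        rfl, by simp; omega, .inl rfl, rfl, rfl, fun _ _ _ _ => rfl⟩

theorem grow_runs {w m c t q D T : ℕ} {σ : State} (hm : m < 5) (hc : 9 < c) (hc' : c < 12)
    (ht : 2 ≤ t) (hq : 0 < q) (hD : D * t * q < 2 ^ w) (hT : 0 < T) (hTD : T ≤ D)
    (h6 : σ.reg 6 = T) (hmt : σ.reg m = t) (h7 : σ.reg 7 = q) (h12 : σ.reg 12 = D)
    (hcT : σ.reg c ≤ T) :
    ∃ σ' e, Runs w (grow m c) σ σ' (60 * e + 30) ∧
      σ'.reg 6 = T * t ^ e ∧ σ'.reg c = σ.reg c + e ∧ D ≤ T * t ^ e * t * q ∧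
      (e = 0 ∨ T * t ^ e * q < D) ∧ σ'.mem = σ.mem ∧ σ'.out = σ.out ∧
      ∀ r, r ≠ 6 → r ≠ c → r ≠ 13 → σ'.reg r = σ.reg r := by
  have h3 : T * t * q ≤ D * t * q := Nat.mul_le_mul_right _ (Nat.mul_le_mul_right _ hTD)
  have h4 : T * t * 1 ≤ T * t * q := Nat.mul_le_mul_left _ hq
  have hrun := block_runs w [.set 13 (.op .mul (mulE m) (.reg 7))] σ (by
    simp [Stm.Wf, Ex.Wf, mulE]; omega)
  have he : execBlock w [.set 13 (.op .mul (mulE m) (.reg 7))] σ =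
      ⟨Function.update σ.reg 13 (T * t * q), σ.mem, σ.out⟩ := by
    simp [execBlock, Stm.exec, mulE, Ex.eval, WordOp.eval, h6, hmt, h7,
      Nat.mod_eq_of_lt (by omega : T * t < 2 ^ w), Nat.mod_eq_of_lt (by omega : T * t * q < 2 ^ w)]
  rw [he] at hrun
  obtain ⟨σ', e, r', g1, g2, g3, g4, g5, g6, g7⟩ := growLoop_runs hm hc hc' ht hq hD D
    ⟨Function.update σ.reg 13 (T * t * q), σ.mem, σ.out⟩ T (by omega) hT hTD (by simpa using h6)
    (by simp only; rw [Function.update_of_ne (by omega), hmt]) (by simpa using h7)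
    (by simpa using h12) (by simp) (by simp only; rwa [Function.update_of_ne (by omega)])
  refine ⟨σ', e, (hrun.seq r').mono ?_, g1, ?_, g3, g4, g5, g6, ?_⟩
  · simp only [blockCost, Stm.cost, Ex.cost, mulE]
    omega
  · rw [g2]
    simp only
    rw [Function.update_of_ne (by omega)]
  · intro r h1 h2 h3
    rw [g7 r h1 h2 h3]
    simp [h3]

theorem Represents.of_eq_zero {n N : ℕ} {m : ℕ → ℕ} (h : ∀ a, 3 ≤ a → m a = 0) :
    Represents n N m fun _ _ => 0 where
  col v _ x _ := h _ (by unfold colAt; omega)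
  lst v _ l _ i hi := by
    rw [h _ (by unfold cntAt; omega)] at hi
    omega
  pos v _ x _ l _ h := absurd h (by omega)

theorem Describes.nil (n : ℕ) : Describes n [] fun _ _ => 0 := by
  intro g u v
  simp

/-- The properties of the parameters computed by the initialisation. The third one limits the
number of splittings into `t₂` graphs: the splittings into `t₁` graphs have stopped only when one
more of them would have been too many. -/
structure Parameters (Δ t₁ t₂ i j : ℕ) : Prop where
  upper : Δ < t₁ ^ i * t₂ ^ j * t₂ ^ 8
  lower : (i = 0 ∧ j = 0) ∨ t₁ ^ i * t₂ ^ j * t₂ ^ 7 ≤ Δ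
  second : j = 0 ∨ t₂ ^ j < t₁

theorem initCode_runs {w n Δ t₁ t₂ x : ℕ} (hn : 0 < n) (hΔ : Δ ≤ n) (ht₁ : 2 ≤ t₁) (ht₂ : 2 ≤ t₂)
    (hw : 8 * n + (n + 1) * t₁ * t₂ ^ 7 + (n + 1) * t₂ * t₂ ^ 7 < 2 ^ w) :
    ∃ σ i j, Runs w initCode (startState w [n, Δ, t₁, t₂, x]) σ (60 * (i + j) + 200) ∧
      Parameters Δ t₁ t₂ i j ∧
      Stable n (t₁ ^ i * t₂ ^ j) (t₂ ^ 7) σ (fun _ _ => 0) ∧ σ.out = [] ∧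
      σ.mem 0 = i + j ∧ σ.mem 1 = i ∧ σ.mem 2 = j := by
  have hq : 0 < t₂ ^ 7 := Nat.pow_pos (by omega)
  have hD1 : (Δ + 1) * t₁ * t₂ ^ 7 ≤ (n + 1) * t₁ * t₂ ^ 7 := by gcongr
  have hD2 : (Δ + 1) * t₂ * t₂ ^ 7 ≤ (n + 1) * t₂ * t₂ ^ 7 := by gcongr
  have ht1w : t₁ ≤ (n + 1) * t₁ * t₂ ^ 7 := by
    calc t₁ = 1 * t₁ * 1 := by ring
      _ ≤ _ := by gcongr <;> omega
  have ht2w : t₂ ^ 7 ≤ (n + 1) * t₂ * t₂ ^ 7 := by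
    calc t₂ ^ 7 = 1 * 1 * t₂ ^ 7 := by ring
      _ ≤ _ := by gcongr <;> omega
  have hp : ∀ k, k ≤ 7 → t₂ ^ k < 2 ^ w := fun k hk =>
    (Nat.pow_le_pow_right (by omega) hk).trans_lt (by omega)
  have hrun := block_runs w [.set 5 (.op .mul (.const 4) (.reg 0)),
      .set 7 (.op .mul (.op .mul (.op .mul (.reg 3) (.reg 3)) (.op .mul (.reg 3) (.reg 3)))
        (.op .mul (.op .mul (.reg 3) (.reg 3)) (.reg 3))),
      .set 6 (.const 1), .set 12 (succE (.reg 1))] (startState w [n, Δ, t₁, t₂, x]) (by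
    simp [Stm.Wf, Ex.Wf, succE])
  set σ0 := startState w [n, Δ, t₁, t₂, x] with hσ0
  have r0 : σ0.reg 0 = n := by simp [hσ0, startState, Nat.mod_eq_of_lt (by omega : n < 2 ^ w)]
  have r1 : σ0.reg 1 = Δ := by simp [hσ0, startState, Nat.mod_eq_of_lt (by omega : Δ < 2 ^ w)]
  have r2 : σ0.reg 2 = t₁ := by simp [hσ0, startState, Nat.mod_eq_of_lt (by omega : t₁ < 2 ^ w)]
  have r3 : σ0.reg 3 = t₂ := by
    have := hp 1 (by omega)
    rw [pow_one] at this
    simp [hσ0, startState, Nat.mod_eq_of_lt this]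
  have rz : ∀ r, 5 ≤ r → σ0.reg r = 0 := by
    intro r hr
    simp only [hσ0, startState]
    rw [List.getD_eq_default _ _ (by simpa using hr), Nat.zero_mod]
  have m0 : ∀ a, σ0.mem a = 0 := fun _ => rfl
  have o0 : σ0.out = [] := rfl
  clear_value σ0
  have he : execBlock w [.set 5 (.op .mul (.const 4) (.reg 0)),
      .set 7 (.op .mul (.op .mul (.op .mul (.reg 3) (.reg 3)) (.op .mul (.reg 3) (.reg 3)))
        (.op .mul (.op .mul (.reg 3) (.reg 3)) (.reg 3))),
      .set 6 (.const 1), .set 12 (succE (.reg 1))] σ0 =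
      ⟨Function.update (Function.update (Function.update (Function.update σ0.reg 5 (4 * n)) 7
        (t₂ ^ 7)) 6 1) 12 (Δ + 1), σ0.mem, σ0.out⟩ := by
    have p2 : t₂ * t₂ = t₂ ^ 2 := by ring
    have p3 : t₂ ^ 2 * t₂ = t₂ ^ 3 := by ring
    have p4 : t₂ ^ 2 * t₂ ^ 2 = t₂ ^ 4 := by ring
    have p7 : t₂ ^ 4 * t₂ ^ 3 = t₂ ^ 7 := by ring
    simp [execBlock, Stm.exec, succE, Ex.eval, WordOp.eval, r0, r1, r3, p2, p3, p4, p7,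
      Nat.mod_eq_of_lt (hp 2 (by omega)), Nat.mod_eq_of_lt (hp 3 (by omega)),
      Nat.mod_eq_of_lt (hp 4 (by omega)), Nat.mod_eq_of_lt (hp 7 (by omega)),
      Nat.mod_eq_of_lt (by omega : 4 < 2 ^ w), Nat.mod_eq_of_lt (by omega : 4 * n < 2 ^ w),
      Nat.mod_eq_of_lt (by omega : 1 < 2 ^ w), Nat.mod_eq_of_lt (by omega : Δ + 1 < 2 ^ w)]
  rw [he] at hrun
  set σ1 : State := ⟨Function.update (Function.update (Function.update (Function.update σ0.reg 5
    (4 * n)) 7 (t₂ ^ 7)) 6 1) 12 (Δ + 1), σ0.mem, σ0.out⟩ with hσ1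
  have f1 : ∀ r, r ≠ 5 → r ≠ 6 → r ≠ 7 → r ≠ 12 → σ1.reg r = σ0.reg r := fun r h1 h2 h3 h4 => by
    simp [hσ1, h1, h2, h3, h4]
  obtain ⟨σ2, i, q2, a6, a10, aD, alt, am, ao, af⟩ := grow_runs (w := w) (σ := σ1)
    (m := 2) (c := 10) (T := 1) (D := Δ + 1) (q := t₂ ^ 7) (by omega) (by omega)
    (by omega) ht₁ hq (by omega)
    one_pos (by omega) (by simp [hσ1]) ((f1 2 (by omega) (by omega) (by omega) (by omega)).trans r2)
    (by simp [hσ1]) (by simp [hσ1]) (by simp [hσ1, rz])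
  rw [one_mul] at a6 aD alt
  have hpos1 : 0 < t₁ ^ i := Nat.pow_pos (by omega)
  have hle1 : t₁ ^ i ≤ Δ + 1 := by
    rcases alt with rfl | h
    · simp
    · have : t₁ ^ i * 1 ≤ t₁ ^ i * t₂ ^ 7 := Nat.mul_le_mul_left _ hq
      omega
  obtain ⟨σ3, j, q3, b6, b11, bD, blt, bm, bo, bf⟩ := grow_runs (w := w) (σ := σ2)
    (m := 3) (c := 11) (T := t₁ ^ i) (D := Δ + 1) (q := t₂ ^ 7) (by omega) (by omega)
    (by omega) ht₂ hq (by omega)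
    hpos1 hle1 a6 ((af 3 (by omega) (by omega) (by omega)).trans
      ((f1 3 (by omega) (by omega) (by omega) (by omega)).trans r3))
    ((af 7 (by omega) (by omega) (by omega)).trans (by simp [hσ1]))
    ((af 12 (by omega) (by omega) (by omega)).trans (by simp [hσ1]))
    (by rw [af 11 (by omega) (by omega) (by omega)]; simp [hσ1, rz])
  have c10 : σ3.reg 10 = i := by
    rw [bf 10 (by omega) (by omega) (by omega), a10]
    simp [hσ1, rz]
  have c11 : σ3.reg 11 = j := by
    rw [b11, af 11 (by omega) (by omega) (by omega)]
    simp [hσ1, rz]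
  have hi : i < t₁ ^ i := Nat.lt_pow_self (by omega)
  have hj : j < t₂ ^ j := Nat.lt_pow_self (by omega)
  have hle2 : t₁ ^ i * t₂ ^ j ≤ Δ + 1 := by
    rcases blt with rfl | h
    · simpa using hle1
    · have : t₁ ^ i * t₂ ^ j * 1 ≤ t₁ ^ i * t₂ ^ j * t₂ ^ 7 := Nat.mul_le_mul_left _ hq
      omega
  have hj' : t₂ ^ j ≤ t₁ ^ i * t₂ ^ j := Nat.le_mul_of_pos_left _ hpos1
  have hij : i + j < 2 ^ w := by omega
  have hrun4 := block_runs w [.store (.const 0) (.op .add (.reg 10) (.reg 11)),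
    .store (.const 1) (.reg 10), .store (.const 2) (.reg 11)] σ3 (by simp [Stm.Wf, Ex.Wf])
  have he4 : execBlock w [.store (.const 0) (.op .add (.reg 10) (.reg 11)),
    .store (.const 1) (.reg 10), .store (.const 2) (.reg 11)] σ3 =
    ⟨σ3.reg, Function.update (Function.update (Function.update σ3.mem 0 (i + j)) 1 i) 2 j,
      σ3.out⟩ := by
    simp [execBlock, Stm.exec, Ex.eval, WordOp.eval, c10, c11, Nat.mod_eq_of_lt hij,
      Nat.mod_eq_of_lt (by omega : 1 < 2 ^ w), Nat.mod_eq_of_lt (by omega : 2 < 2 ^ w)]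
  rw [he4] at hrun4
  have hz3 : ∀ r, 5 ≤ r → r ≠ 5 → r ≠ 6 → r ≠ 7 → r ≠ 10 → r ≠ 11 → r ≠ 12 → r ≠ 13 →
      σ3.reg r = 0 := by
    intro r h h1 h2 h3 h4 h5 h6 h7
    rw [bf r h2 h5 h7, af r h2 h4 h7, f1 r h1 h2 h3 h6, rz r h]
  refine ⟨_, i, j, (hrun.seq (q2.seq (q3.seq hrun4))).mono ?_, ⟨?_, ?_, ?_⟩,
    ⟨⟨?_, b6, ?_, ?_⟩, ⟨⟨fun _ _ => rfl, fun _ => rfl, fun _ _ => Nat.zero_le _⟩, ?_, ?_⟩, ?_, ?_⟩,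
    ?_, ?_, ?_, ?_⟩
  · simp only [blockCost, Stm.cost, Ex.cost, succE]
    omega
  · calc Δ < t₁ ^ i * t₂ ^ j * t₂ * t₂ ^ 7 := by omega
      _ = _ := by ring
  · rcases blt with rfl | h
    · rcases alt with rfl | h
      · exact .inl ⟨rfl, rfl⟩
      · refine .inr ?_
        simpa using Nat.le_of_lt_succ h
    · exact .inr (Nat.le_of_lt_succ h)
  · refine blt.imp id fun h => ?_
    have h1 : t₁ ^ i * t₂ ^ 7 * t₂ ^ j < t₁ ^ i * t₂ ^ 7 * t₁ := by
      calc _ = t₁ ^ i * t₂ ^ j * t₂ ^ 7 := by ring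
        _ < Δ + 1 := h
        _ ≤ _ := aD
        _ = _ := by ring
    exact Nat.lt_of_mul_lt_mul_left h1
  · simp only
    rw [bf 5 (by omega) (by omega) (by omega), af 5 (by omega) (by omega) (by omega)]
    simp [hσ1]
  · simp only
    rw [bf 7 (by omega) (by omega) (by omega), af 7 (by omega) (by omega) (by omega)]
    simp [hσ1]
  · exact hz3 21 (by omega) (by omega) (by omega) (by omega) (by omega) (by omega) (by omega)
      (by omega)
  · refine Represents.of_eq_zero fun a ha => ?_
    have e0 : a ≠ 0 := by omega
    have e1 : a ≠ 1 := by omega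
    have e2 : a ≠ 2 := by omega
    simp [e0, e1, e2, bm, am, hσ1, m0]
  · simpa [bo, ao, hσ1, o0] using Describes.nil n
  · exact hz3 8 (by omega) (by omega) (by omega) (by omega) (by omega) (by omega) (by omega)
      (by omega)
  · rintro u - v - ⟨k, k', h, -⟩
    exact (Nat.succ_ne_zero k).symm h
  · simp [bo, ao, hσ1, o0]
  · simp
  · simp
  · simp

/-! ### Processing a sequence of updates -/

/-- The algorithm. -/
def algorithm : DynAlg := ⟨initCode, insertCode, deleteCode⟩

theorem Stable.of_sim {n T q : ℕ} {s σ : State} {χ : ℕ → ℕ → ℕ} (h : Stable n T q σ χ)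
    (hs : Sim s σ) : Stable n T q s χ where
  ready := ⟨(hs.1 5 (by omega)).trans h.ready.hN, (hs.1 6 (by omega)).trans h.ready.hT,
    (hs.1 7 (by omega)).trans h.ready.hq, (hs.1 21 (by omega)).trans h.ready.hzero⟩
  stores := ⟨h.stores.colouring, by rw [hs.2.1]; exact h.stores.represents,
    by rw [hs.2.2]; exact h.stores.describes⟩
  empty := (hs.1 8 (by omega)).trans h.empty
  stable := h.stable

/-- Registers `0` and `1` are not part of the invariant. -/
theorem Stable.setEdge {n T q : ℕ} {s : State} {χ : ℕ → ℕ → ℕ} (h : Stable n T q s χ) (u v : ℕ) :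
    Stable n T q { s with reg := Function.update (Function.update s.reg 0 u) 1 v } χ where
  ready := ⟨h.ready.hN, h.ready.hT, h.ready.hq, h.ready.hzero⟩
  stores := ⟨h.stores.colouring, h.stores.represents, h.stores.describes⟩
  empty := h.empty
  stable := h.stable

theorem card_filter_range (n : ℕ) (p : ℕ → Prop) [DecidablePred p] :
    ((Finset.range n).filter p).card = (Finset.univ.filter fun x : Fin n => p x).card := by
  rw [← Finset.card_map Fin.valEmbedding]
  congr 1
  ext x
  simp only [Finset.mem_filter, Finset.mem_range, Finset.mem_map, Finset.mem_univ, true_and,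
    Fin.valEmbedding_apply]
  constructor
  · rintro ⟨h, hp⟩
    exact ⟨⟨x, h⟩, hp, rfl⟩
  · rintro ⟨y, hp, rfl⟩
    exact ⟨y.2, hp⟩

theorem degreeLE_iff {n : ℕ} {G : SimpleGraph (Fin n)} {p : ℕ → ℕ → Prop}
    [∀ v, DecidablePred (p v)] (h : ∀ u v : Fin n, G.Adj u v ↔ p u v) (d : ℝ) :
    DegreeLE G d ↔ ∀ v < n, (((Finset.range n).filter (p v)).card : ℝ) ≤ d := by
  classical
  have key : ∀ v : Fin n, G.degree v =
      ((Finset.range n).filter (p v)).card := by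
    intro v
    rw [card_filter_range, ← SimpleGraph.card_neighborFinset_eq_degree]
    congr 1
    ext x
    simp [h]
  unfold DegreeLE
  constructor
  · intro hG v hv
    rw [← key ⟨v, hv⟩]
    convert hG ⟨v, hv⟩
  · intro hp v
    have := hp v v.2
    rw [← key v] at this
    convert this

theorem graphAfter_append {V : Type} (us : List (EdgeUpdate V)) (u : EdgeUpdate V) :
    graphAfter (us ++ [u]) = u.apply (graphAfter us) := by
  simp [graphAfter]

theorem admissible_of_append {V : Type} [Fintype V] {D : ℕ} {us : List (EdgeUpdate V)}
    {u : EdgeUpdate V} (h : Admissible D (us ++ [u])) :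
    Admissible D us ∧ u.Legal (graphAfter us) := by
  refine ⟨⟨fun k hk => ?_, fun k hk => ?_⟩, ?_⟩
  · have := h.1 k (by simp; omega)
    rwa [List.getElem_append_left hk, List.take_append_of_le_length hk.le] at this
  · have := h.2 k (by simp; omega)
    rwa [List.take_append_of_le_length hk] at this
  · have := h.1 us.length (by simp)
    simpa using this

theorem degreeLE_of_admissible {V : Type} [Fintype V] {D : ℕ} {us : List (EdgeUpdate V)}
    (h : Admissible D us) : DegreeLE (graphAfter us) D := by
  simpa using h.2 us.length le_rfl

theorem apply_insert_adj {n : ℕ} {G : SimpleGraph (Fin n)} {χ : ℕ → ℕ → ℕ}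
    (h : ∀ a b : Fin n, G.Adj a b ↔ χ a b ≠ 0) {u v : Fin n} (huv : u ≠ v) (a b : Fin n) :
    ((EdgeUpdate.insert u v).apply G).Adj a b ↔ recolour χ u v 1 a b ≠ 0 := by
  have huv' : (u : ℕ) ≠ v := fun e => huv (Fin.ext e)
  simp only [EdgeUpdate.apply, SimpleGraph.sup_adj, SimpleGraph.edge_adj, recolour_apply, h,
    Fin.ext_iff]
  split_ifs <;> (simp_all; try omega)

theorem apply_delete_adj {n : ℕ} {G : SimpleGraph (Fin n)} {χ : ℕ → ℕ → ℕ}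
    (h : ∀ a b : Fin n, G.Adj a b ↔ χ a b ≠ 0) (u v : Fin n) (a b : Fin n) :
    ((EdgeUpdate.delete u v).apply G).Adj a b ↔ recolour χ u v 0 a b ≠ 0 := by
  simp only [EdgeUpdate.apply, SimpleGraph.deleteEdges_adj, Set.mem_singleton_iff, Sym2.eq_iff,
    recolour_apply, h, Fin.ext_iff]
  split_ifs <;> simp_all

/-- If all loads of stable colourings are bounded by `L`, the amortised cost of an update is
`50000 * q * (L + 1)`. -/
theorem exists_run {w n T q D L : ℕ} (hf : Fits w n T q)
    (hbig : 8 * (2 * (q * n ^ 3) + 8 * n) + 8 < 2 ^ w)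
    (hL : ∀ χ, IsColouring T χ → (∀ u < n, ∀ v < n, ¬ Violating n T q χ u v) →
      (∀ v < n, ((Finset.range n).filter fun x => χ v x ≠ 0).card ≤ D) →
      ∀ v < n, ∀ l, load n χ v l ≤ L)
    {s₀ : State} (h₀ : Stable n T q s₀ fun _ _ => 0) (hout : s₀.out = [])
    (us : List (EdgeUpdate (Fin n))) (hus : Admissible D us) :
    ∃ s Tm χ, algorithm.Run w s₀ us s Tm ∧ Stable n T q s χ ∧ (∀ a < 3, s.mem a = s₀.mem a) ∧
      (∀ a b : Fin n, (graphAfter us).Adj a b ↔ χ a b ≠ 0) ∧ s.out.length ≤ Tm ∧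
      Tm + 5000 * (q * potential n T χ) ≤ us.length * (50000 * (q * (L + 1))) := by
  induction us using List.reverseRecOn with
  | nil =>
    refine ⟨s₀, 0, fun _ _ => 0, .nil, h₀, fun _ _ => rfl, ?_, by simp [hout], ?_⟩
    · simp [graphAfter]
    · simp [potential, load]
  | append_singleton us u ih =>
    obtain ⟨hus', hleg⟩ := admissible_of_append hus
    obtain ⟨s, Tm, χ, hrun, hst, hmem, hadj, hlen, hT⟩ := ih hus'
    have hL' : ∀ v < n, ∀ l, load n χ v l ≤ L := hL χ hst.stores.colouring hst.stable (by
      have := (degreeLE_iff (p := fun a b => χ a b ≠ 0) hadj D).1 (degreeLE_of_admissible hus')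
      exact_mod_cast this)
    -- both kinds of updates end in the same way
    have key : ∀ (σ' : State) (χ' : ℕ → ℕ → ℕ) (c : ℕ),
        Runs w (algorithm.code u) (passEdge s u) σ' c → Stable n T q σ' χ' →
        (∀ a < 3, σ'.mem a = s.mem a) →
        (∀ a b : Fin n, (u.apply (graphAfter us)).Adj a b ↔ χ' a b ≠ 0) →
        c + 5000 * (q * potential n T χ') ≤
          5000 * (q * potential n T χ) + 50000 * (q * (L + 1)) →
        ∃ s Tm χ, algorithm.Run w s₀ (us ++ [u]) s Tm ∧ Stable n T q s χ ∧
          (∀ a < 3, s.mem a = s₀.mem a) ∧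
          (∀ a b : Fin n, (graphAfter (us ++ [u])).Adj a b ↔ χ a b ≠ 0) ∧ s.out.length ≤ Tm ∧
          Tm + 5000 * (q * potential n T χ) ≤
            (us ++ [u]).length * (50000 * (q * (L + 1))) := by
      intro σ' χ' c hr hst' hmem' hadj' hc
      obtain ⟨s', k, hexec, hk, hsim⟩ := hr _ (Sim.refl _)
      refine ⟨s', Tm + k, χ', hrun.snoc hexec, hst'.of_sim hsim, fun a ha => ?_, ?_, ?_, ?_⟩
      · rw [hsim.2.1, hmem' a ha, hmem a ha]
      · rwa [graphAfter_append]
      · have := Exec.out_length_le hexec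
        have e : (passEdge s u).out = s.out := by cases u <;> rfl
        rw [e] at this
        omega
      · rw [List.length_append, List.length_singleton, add_mul]
        omega
    cases u with
    | insert u v =>
      obtain ⟨huv, hnadj⟩ := hleg
      have hc : χ u v = 0 := by
        by_contra hne
        exact hnadj ((hadj u v).2 hne)
      obtain ⟨σ', χ', c, hr, hst', hmem', hz, hcost⟩ := insertCode_runs hf hbig
        (hst.setEdge u v) (by simp) (by simp) u.2 v.2 (fun e => huv (Fin.ext e)) hc hL'
      refine key σ' χ' c hr hst' hmem' (fun a b => ?_) hcost
      rw [apply_insert_adj hadj huv, ne_eq, ne_eq, hz]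
    | delete u v =>
      obtain ⟨σ', χ', c, hr, hst', hmem', hz, hcost⟩ := deleteCode_runs hf hbig
        (hst.setEdge u v) (by simp) (by simp) u.2 v.2 ((hadj u v).1 hleg) hL'
      refine key σ' χ' c hr hst' hmem' (fun a b => ?_) hcost
      rw [apply_delete_adj hadj, ne_eq, ne_eq, hz]

/-! ### The hierarchy of a colouring -/

/-- The graph on `0, …, n - 1` of the edges whose colour in `χ` satisfies `P`. -/
def classGraph (n : ℕ) (χ : ℕ → ℕ → ℕ) (P : ℕ → Prop) : SimpleGraph (Fin n) :=
  SimpleGraph.fromRel fun u v => χ u v ≠ 0 ∧ P (χ u v - 1)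

theorem classGraph_adj {n T : ℕ} {χ : ℕ → ℕ → ℕ} (hχ : IsColouring T χ) {P : ℕ → Prop}
    (u v : Fin n) : (classGraph n χ P).Adj u v ↔ χ u v ≠ 0 ∧ P (χ u v - 1) := by
  rw [classGraph, SimpleGraph.fromRel_adj, hχ.symm v u, or_self, and_iff_right_iff_imp]
  rintro ⟨h, -⟩ rfl
  exact h (hχ.irrefl _)

theorem card_filter_div_le {n R p : ℕ} (χ : ℕ → ℕ → ℕ) {M : ℝ} (hR : 0 < R) {v : ℕ}
    (hM : ∀ l, (load n χ v l : ℝ) ≤ M) :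
    (((Finset.range n).filter fun x => χ v x ≠ 0 ∧ (χ v x - 1) / R = p).card : ℝ) ≤ R * M := by
  have h1 : ((Finset.range n).filter fun x => χ v x ≠ 0 ∧ (χ v x - 1) / R = p) ⊆
      (Finset.range R).biUnion fun r => (Finset.range n).filter fun x => χ v x = p * R + r + 1 := by
    intro x
    simp only [Finset.mem_biUnion, Finset.mem_filter, Finset.mem_range]
    rintro ⟨hx, h0, hp⟩
    refine ⟨(χ v x - 1) % R, Nat.mod_lt _ hR, hx, ?_⟩
    have := Nat.div_add_mod (χ v x - 1) R
    rw [hp, mul_comm] at this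
    omega
  have h2 := (Finset.card_le_card h1).trans Finset.card_biUnion_le
  calc (((Finset.range n).filter fun x => χ v x ≠ 0 ∧ (χ v x - 1) / R = p).card : ℝ)
      ≤ ((∑ r ∈ Finset.range R, load n χ v (p * R + r) : ℕ) : ℝ) := by exact_mod_cast h2
    _ = ∑ r ∈ Finset.range R, (load n χ v (p * R + r) : ℝ) := by push_cast; rfl
    _ ≤ ∑ _r ∈ Finset.range R, M := Finset.sum_le_sum fun r _ => hM _
    _ = R * M := by simp

/-- The colour classes of an edge colouring with `t 0 * ⋯ * t (h - 1)` colours are the bottom level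
of a hierarchy: the classes of level `k` consist of the edges whose colours have the same first `k`
digits in the mixed radix representation with the bases `t`. -/
theorem exists_isHierarchy {n h T : ℕ} {χ : ℕ → ℕ → ℕ} {t : ℕ → ℕ} (hχ : IsColouring T χ)
    (hT : ∏ l ∈ Finset.range h, t l = T) (ht : ∀ k < h, 0 < t k) {G : SimpleGraph (Fin n)}
    (hG : ∀ a b : Fin n, G.Adj a b ↔ χ a b ≠ 0) {D : ℕ → ℝ} {M : ℝ}
    (hM : ∀ v < n, ∀ l, (load n χ v l : ℝ) ≤ M)
    (hD : ∀ k ≤ h, (T : ℝ) * M ≤ (∏ l ∈ Finset.range k, t l : ℕ) * D k) :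
    ∃ H : ℕ → ℕ → SimpleGraph (Fin n), IsHierarchy G h t D H ∧
      ∀ g (a b : Fin n), (H h g).Adj a b ↔ χ a b = g + 1 := by
  let R : ℕ → ℕ := fun k => ∏ l ∈ Finset.Ico k h, t l
  have hRpos : ∀ k, 0 < R k := fun k =>
    Finset.prod_pos fun l hl => ht l (Finset.mem_Ico.1 hl).2
  have hPpos : ∀ k ≤ h, 0 < ∏ l ∈ Finset.range k, t l := fun k hk =>
    Finset.prod_pos fun l hl => ht l (by have := Finset.mem_range.1 hl; omega)
  have hPR : ∀ k ≤ h, (∏ l ∈ Finset.range k, t l) * R k = T := fun k hk => by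
    rw [← hT]
    exact Finset.prod_range_mul_prod_Ico _ hk
  have hRs : ∀ k < h, R k = R (k + 1) * t k := fun k hk => by
    rw [mul_comm]
    exact Finset.prod_eq_prod_Ico_succ_bot hk _
  refine ⟨fun k p => classGraph n χ fun x => x / R k = p, ⟨?_, ?_, ?_⟩, ?_⟩
  · ext a b
    rw [classGraph_adj hχ, hG, and_iff_left_iff_imp]
    intro h0
    have h1 := hPR 0 (Nat.zero_le _)
    rw [Finset.prod_range_zero, one_mul] at h1
    rw [h1]
    have := hχ.le a b
    exact Nat.div_eq_of_lt (by omega)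
  · intro k hk p _
    have hdiv : ∀ x, x / R k = x / R (k + 1) / t k := fun x => by
      rw [hRs k hk, Nat.div_div_eq_div_mul]
    constructor
    · intro κ _ κ' _ hne
      rw [Function.onFun, Set.disjoint_left]
      intro e
      induction e with | _ a b
      simp only [SimpleGraph.mem_edgeSet, classGraph_adj hχ]
      rintro ⟨-, h1⟩ ⟨-, h2⟩
      exact hne (by omega)
    · ext e
      induction e with | _ a b
      simp only [Set.mem_iUnion, SimpleGraph.mem_edgeSet, classGraph_adj hχ, Set.mem_ofPred_eq,
        exists_prop, hdiv]
      constructor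
      · rintro ⟨κ, hκ, h0, h1⟩
        refine ⟨h0, ?_⟩
        rw [h1, mul_comm, Nat.mul_add_div (ht k hk), Nat.div_eq_of_lt hκ, add_zero]
      · rintro ⟨h0, h1⟩
        refine ⟨(χ a b - 1) / R (k + 1) % t k, Nat.mod_lt _ (ht k hk), h0, ?_⟩
        rw [← h1, mul_comm]
        exact (Nat.div_add_mod _ _).symm
  · intro k hk p _
    rw [degreeLE_iff (p := fun a b => χ a b ≠ 0 ∧ (χ a b - 1) / R k = p)
      (fun u v => classGraph_adj hχ u v)]
    intro v hv
    refine (card_filter_div_le χ (hRpos k) (hM v hv)).trans ?_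
    have h1 : (0 : ℝ) < (∏ l ∈ Finset.range k, t l : ℕ) := by exact_mod_cast hPpos k hk
    refine le_of_mul_le_mul_left ?_ h1
    rw [← mul_assoc, ← Nat.cast_mul, hPR k hk]
    exact hD k hk
  · intro g a b
    rw [classGraph_adj hχ]
    have : R h = 1 := by simp [R]
    rw [this, Nat.div_one]
    omega

theorem prod_range_ite (t₁ t₂ i j : ℕ) :
    ∏ l ∈ Finset.range (i + j), (if l < i then t₁ else t₂) = t₁ ^ i * t₂ ^ j := by
  rw [Finset.prod_range_add]
  congr 1
  · rw [Finset.prod_congr rfl fun l hl => if_pos (Finset.mem_range.1 hl)]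
    simp
  · simp

theorem partitionsEdges_of_colour {n : ℕ} {χ : ℕ → ℕ → ℕ} {G : SimpleGraph (Fin n)}
    {F : ℕ → SimpleGraph (Fin n)} (hG : ∀ a b : Fin n, G.Adj a b ↔ χ a b ≠ 0)
    (hF : ∀ g (a b : Fin n), (F g).Adj a b ↔ χ a b = g + 1) : PartitionsEdges G Set.univ F := by
  constructor
  · intro g _ g' _ hne
    rw [Function.onFun, Set.disjoint_left]
    intro e
    induction e with | _ a b
    simp only [SimpleGraph.mem_edgeSet, hF]
    omega
  · ext e
    induction e with | _ a b
    simp only [Set.mem_iUnion, SimpleGraph.mem_edgeSet, hF, hG, Set.mem_univ, exists_prop, true_and]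
    exact ⟨fun ⟨g, h⟩ => by omega, fun h => ⟨χ a b - 1, by omega⟩⟩

theorem eq_bot_of_colour {n T : ℕ} {χ : ℕ → ℕ → ℕ} (hχ : IsColouring T χ)
    {F : ℕ → SimpleGraph (Fin n)} (hF : ∀ g (a b : Fin n), (F g).Adj a b ↔ χ a b = g + 1) {g : ℕ}
    (hg : T ≤ g) : F g = ⊥ := by
  ext a b
  rw [hF, SimpleGraph.bot_adj, iff_false]
  have := hχ.le a b
  omega

theorem encard_le_of_colour {n T : ℕ} {χ : ℕ → ℕ → ℕ} (hχ : IsColouring T χ)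
    {F : ℕ → SimpleGraph (Fin n)} (hF : ∀ g (a b : Fin n), (F g).Adj a b ↔ χ a b = g + 1) :
    {g | F g ≠ ⊥}.encard ≤ T := by
  have h : {g | F g ≠ ⊥} ⊆ (Finset.range T : Set ℕ) := by
    intro g hg
    rw [Finset.coe_range, Set.mem_Iio]
    by_contra hT
    exact hg (eq_bot_of_colour hχ hF (not_lt.1 hT))
  refine (Set.encard_le_encard h).trans ?_
  rw [Set.encard_coe_eq_coe_finsetCard, Finset.card_range]

/-! ### The bound for the maximum degrees -/

theorem mul_succ_pow_three_le {t : ℝ} (ht : 45 ≤ t) : 10 ^ 6 * (t + 1) ^ 3 ≤ t ^ 7 := by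
  have h1 : (t + 1) ^ 3 ≤ (46 / 45 * t) ^ 3 := pow_le_pow_left₀ (by linarith) (by linarith) 3
  have h2 : (45 : ℝ) ^ 4 ≤ t ^ 4 := pow_le_pow_left₀ (by norm_num) ht 4
  have h3 : 0 < t ^ 3 := by positivity
  calc 10 ^ 6 * (t + 1) ^ 3 ≤ 10 ^ 6 * (46 / 45 * t) ^ 3 := by linarith
    _ = t ^ 3 * (10 ^ 6 * (46 / 45) ^ 3) := by ring
    _ ≤ t ^ 3 * t ^ 4 := by
        refine mul_le_mul_of_nonneg_left (le_trans ?_ h2) h3.le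
        norm_num
    _ = t ^ 7 := by ring

/-- The error term in the comparison of loads is a small fraction of `ε * L`, as `m` is at most of
the order of `ε * t`, and `L ≥ t ^ 7` outweighs `t ^ 3`. The factor `272` makes `2 * m * k` less
than `ε * L / 100`, up to lower order terms. -/
theorem le_of_error {ε t m k s L d : ℝ} (hε : 0 < ε) (hε1 : ε ≤ 1) (ht : 45 ≤ t) (hm : 0 ≤ m)
    (hm' : m ≤ 1.1 * (ε * (t + 1))) (hk : k ≤ L / (272 * (t + 1)) + 1) (hs : s ≤ 2 + 8 * L / t ^ 7)
    (hL : t ^ 7 ≤ L) (h : L ≤ d + 2 * m * (k + 272 * (t + 1) * m * s)) :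
    L ≤ (1 + ε / 16) * d := by
  have hcube := mul_succ_pow_three_le ht
  have ht1 : 0 < t + 1 := by linarith
  have ht7 : 0 < t ^ 7 := by positivity
  have hL0 : 0 < L := by linarith
  have hεL : 0 < ε * L := mul_pos hε hL0
  have hm2 : m ^ 2 ≤ 1.21 * (ε * (t + 1) ^ 2) := by
    calc m ^ 2 ≤ (1.1 * (ε * (t + 1))) ^ 2 := pow_le_pow_left₀ hm hm' 2
      _ = 1.21 * (ε * (t + 1) ^ 2) * ε := by ring
      _ ≤ 1.21 * (ε * (t + 1) ^ 2) * 1 := by gcongr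
      _ = _ := by ring
  have e1 : 2 * m * (L / (272 * (t + 1))) ≤ 2.2 / 272 * (ε * L) := by
    calc 2 * m * (L / (272 * (t + 1)))
        ≤ 2 * (1.1 * (ε * (t + 1))) * (L / (272 * (t + 1))) := by gcongr
      _ = 2.2 / 272 * (ε * L) := by field_simp; ring
  have e2 : 2 * m ≤ 2.2 / 10 ^ 6 * (ε * L) := by
    have h1 : t + 1 ≤ (t + 1) ^ 3 := by
      nlinarith [sq_nonneg t, mul_pos ht1 ht1]
    have h2 : t + 1 ≤ L / 10 ^ 6 := by linarith
    calc 2 * m ≤ 2.2 * (ε * (t + 1)) := by linarith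
      _ ≤ 2.2 * (ε * (L / 10 ^ 6)) := by gcongr
      _ = _ := by ring
  have e3 : 2 * m * (272 * (t + 1) * m * s) ≤ 1 / 100 * (ε * L) := by
    have hq : 8 * L / t ^ 7 = 8 * (L / t ^ 7) := by ring
    have h1 : 2 ≤ 2 * (L / t ^ 7) := by
      have : 1 ≤ L / t ^ 7 := (one_le_div ht7).2 hL
      linarith
    calc 2 * m * (272 * (t + 1) * m * s)
        = 544 * (t + 1) * m ^ 2 * s := by ring
      _ ≤ 544 * (t + 1) * m ^ 2 * (10 * (L / t ^ 7)) := by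
          refine mul_le_mul_of_nonneg_left ?_ (by positivity)
          linarith
      _ ≤ 544 * (t + 1) * (1.21 * (ε * (t + 1) ^ 2)) * (10 * (L / t ^ 7)) := by gcongr
      _ = 6582.4 * (t + 1) ^ 3 / t ^ 7 * (ε * L) := by ring
      _ ≤ 1 / 100 * (ε * L) := by
          refine mul_le_mul_of_nonneg_right ?_ hεL.le
          rw [div_le_iff₀ ht7]
          have : 0 ≤ (t + 1) ^ 3 := by positivity
          linarith
  have e4 : 2 * m * (k + 272 * (t + 1) * m * s) ≤ 1 / 20 * (ε * L) := by
    have h1 : 2 * m * k ≤ 2 * m * (L / (272 * (t + 1)) + 1) := by gcongr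
    linarith
  have hd : (1 - ε / 20) * L ≤ d := by linarith
  have h1 : 1 ≤ (1 + ε / 16) * (1 - ε / 20) := by nlinarith
  calc L = 1 * L := (one_mul L).symm
    _ ≤ (1 + ε / 16) * (1 - ε / 20) * L := by gcongr
    _ = (1 + ε / 16) * ((1 - ε / 20) * L) := by ring
    _ ≤ _ := by gcongr

/-- In a stable colouring of a graph of maximum degree at most `Δ`, every load is at most
`(1 + ε / 16) * (Δ / T)`: the smallest load at a vertex is at most the average `Δ / T`, and the
largest one is compared with it along the colour tree. -/
theorem load_le_average {n T t Δ : ℕ} {ε : ℝ} (hε : 0 < ε) (hε1 : ε ≤ 1) (ht : 45 ≤ t)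
    (hm : ((Nat.log 2 n + 1 : ℕ) : ℝ) ≤ 1.1 * (ε * (t + 1))) (hT : 0 < T) (hTn : T ≤ n)
    (hΔ : T = 1 ∨ T * t ^ 7 ≤ Δ) {χ : ℕ → ℕ → ℕ} (hχ : IsColouring T χ)
    (hstable : ∀ u < n, ∀ v < n, ¬ Violating n T (t ^ 7) χ u v)
    (hdeg : ∀ v < n, ((Finset.range n).filter fun x => χ v x ≠ 0).card ≤ Δ)
    {v : ℕ} (hv : v < n) (l : ℕ) : (load n χ v l : ℝ) ≤ (1 + ε / 16) * (Δ / T) := by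
  have hT' : (0 : ℝ) < T := by exact_mod_cast hT
  have hsum : ∀ v < n, ∑ l ∈ Finset.range T, load n χ v l ≤ Δ := fun v hv =>
    (sum_load_le χ v).trans (hdeg v hv)
  have hav : (0 : ℝ) ≤ Δ / T := by positivity
  have hfac : (Δ : ℝ) / T ≤ (1 + ε / 16) * (Δ / T) := le_mul_of_one_le_left hav (by linarith)
  obtain ⟨⟨x, a⟩, hxa, hmax⟩ := Finset.exists_max_image (Finset.range n ×ˢ Finset.range T)
    (fun p => load n χ p.1 p.2) ⟨(v, 0), by simp [hv, hT]⟩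
  simp only [Finset.mem_product, Finset.mem_range] at hxa hmax
  obtain ⟨hx, ha⟩ := hxa
  set L := load n χ x a with hL
  have hLmax : ∀ v < n, ∀ l, load n χ v l ≤ L := by
    intro v hv l
    by_cases hl : l < T
    · exact hmax (v, l) ⟨hv, hl⟩
    · rw [load_eq_zero hχ (not_lt.1 hl)]
      exact Nat.zero_le _
  refine (Nat.cast_le.2 (hLmax v hv l)).trans ?_
  -- a load above the average is at least `t ^ 7`, which `le_of_error` needs
  by_cases hLd : (L : ℝ) ≤ Δ / T
  · exact hLd.trans hfac
  rw [not_le] at hLd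
  have hLpos : 0 < L := by
    have : (0 : ℝ) < L := hav.trans_lt hLd
    exact_mod_cast this
  rcases hΔ with rfl | hΔ
  · have h1 := hsum x hx
    obtain rfl : a = 0 := by omega
    rw [Finset.sum_range_one] at h1
    rw [Nat.cast_one, div_one] at hLd
    exact absurd (Nat.cast_le.2 h1) (not_le.2 hLd)
  have hLq : ((t : ℝ)) ^ 7 ≤ L := by
    have h1 : (T : ℝ) * t ^ 7 ≤ Δ := by exact_mod_cast hΔ
    have h2 : (t : ℝ) ^ 7 ≤ Δ / T := by
      rw [le_div_iff₀ hT', mul_comm]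
      exact h1
    linarith
  obtain ⟨b, hb, hmin⟩ := Finset.exists_min_image (Finset.range T) (fun l => load n χ x l)
    ⟨0, by simpa using hT⟩
  have hbΔ : (load n χ x b : ℝ) ≤ Δ / T := by
    rw [le_div_iff₀ hT', mul_comm]
    have : T * load n χ x b ≤ Δ := by
      calc T * load n χ x b = ∑ _l ∈ Finset.range T, load n χ x b := by simp
        _ ≤ ∑ l ∈ Finset.range T, load n χ x l := Finset.sum_le_sum hmin
        _ ≤ Δ := hsum x hx
    exact_mod_cast this
  set m := Nat.log 2 n + 1 with hmdef
  have hn2 : n < 2 ^ m := Nat.lt_pow_succ_log_self (by omega) n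
  have hy : 0 < 272 * (t + 1) := by omega
  have key := load_le_of_stable hχ hstable hLmax (y := 272 * (t + 1)) (m := m)
    (k := L / (272 * (t + 1)) + 1) (Nat.succ_pos _) hLpos
    (by have := Nat.lt_mul_div_succ L hy; omega) hn2
    (hTn.trans_lt (hn2.trans (Nat.pow_lt_pow_right (by omega) (by omega)))) hx ha
    (Finset.mem_range.1 hb)
  refine le_of_error (k := ((L / (272 * (t + 1)) + 1 : ℕ) : ℝ)) (s := ((2 + 8 * L / t ^ 7 : ℕ) : ℝ))
    (m := m) (t := t) hε hε1 (by exact_mod_cast ht) (Nat.cast_nonneg _) hm ?_ ?_ hLq ?_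
  · have : ((L / (272 * (t + 1)) : ℕ) : ℝ) ≤ (L : ℝ) / ((272 * (t + 1) : ℕ) : ℝ) := Nat.cast_div_le
    push_cast at this ⊢
    linarith
  · have : ((8 * L / t ^ 7 : ℕ) : ℝ) ≤ ((8 * L : ℕ) : ℝ) / ((t ^ 7 : ℕ) : ℝ) := Nat.cast_div_le
    rw [Nat.cast_add]
    push_cast at this ⊢
    linarith
  · have h1 : (L : ℝ) ≤ ((load n χ x b + 2 * m * (L / (272 * (t + 1)) + 1 +
        272 * (t + 1) * m * (2 + 8 * L / t ^ 7)) : ℕ) : ℝ) := Nat.cast_le.2 key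
    have h2 : (L : ℝ) ≤ load n χ x b + 2 * m * (((L / (272 * (t + 1)) + 1 : ℕ) : ℝ) +
        272 * (t + 1) * m * ((2 + 8 * L / t ^ 7 : ℕ) : ℝ)) := by
      rw [Nat.cast_add, Nat.cast_mul, Nat.cast_add, Nat.cast_mul _ (2 + 8 * L / t ^ 7)] at h1
      push_cast at h1 ⊢
      exact h1
    linarith

/-! ### Numerical estimates -/

section Numerics

open Real

variable {n Δ : ℕ} {ε : ℝ}

theorem rpow_logb_natCast (hn : 2 ≤ n) : (2 : ℝ) ^ logb 2 n = n :=
  rpow_logb (by norm_num) (by norm_num) (by positivity)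

theorem one_le_logb (hn : 2 ≤ n) : 1 ≤ logb 2 n := by
  rw [le_logb_iff_rpow_le (by norm_num) (by positivity), rpow_one]
  exact_mod_cast hn

/-- The assumption on `Δ` forces `n` to be large. -/
theorem le_logb (hn : 2 ≤ n) (hε : 0 < ε) (hε1 : ε ≤ 1)
    (hΔ : 10 ^ 7 * logb 2 n ^ 5 / ε ^ 3 ≤ (Δ : ℝ)) (hΔn : Δ ≤ n) : 45 ≤ logb 2 n := by
  have h1 := one_le_logb hn
  set ℓ := logb 2 n with hℓ
  have hpow : 10 ^ 7 * ℓ ^ 5 ≤ (2 : ℝ) ^ ℓ := by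
    rw [hℓ, rpow_logb_natCast hn]
    have h2 : (Δ : ℝ) ≤ n := by exact_mod_cast hΔn
    have h3 : 10 ^ 7 * logb 2 n ^ 5 ≤ 10 ^ 7 * logb 2 n ^ 5 / ε ^ 3 :=
      le_div_self (by positivity) (by positivity) (pow_le_one₀ hε.le hε1)
    linarith
  have key : ∀ (a b : ℕ), (2 : ℝ) ^ b ≤ 10 ^ 7 * (a : ℝ) ^ 5 → (a : ℝ) ≤ ℓ → (b : ℝ) ≤ ℓ := by
    intro a b hab ha
    have h2 : (a : ℝ) ^ 5 ≤ ℓ ^ 5 := pow_le_pow_left₀ (Nat.cast_nonneg _) ha 5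
    have h3 : (2 : ℝ) ^ (b : ℝ) ≤ 2 ^ ℓ := by
      rw [rpow_natCast]
      linarith
    exact (rpow_le_rpow_left_iff (by norm_num)).1 h3
  have h23 := key 1 23 (by norm_num) (by simpa using h1)
  exact_mod_cast key 23 45 (by norm_num) h23

theorem natLog_le_logb (hn : 2 ≤ n) : (Nat.log 2 n : ℝ) ≤ logb 2 n := by
  rw [le_logb_iff_rpow_le (by norm_num) (by positivity), rpow_natCast]
  exact_mod_cast Nat.pow_log_le_self 2 (by omega)

theorem five_le_sqrt {ℓ : ℝ} (hℓ : 45 ≤ ℓ) : 5 ≤ √ℓ :=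
  le_sqrt_of_sq_le (by linarith)

theorem le_floor_two_rpow {ℓ : ℝ} (hℓ : 45 ≤ ℓ) :
    (2 : ℝ) ^ (9 * √ℓ) ≤ (⌊(2 : ℝ) ^ (10 * √ℓ)⌋₊ : ℝ) := by
  have h5 := five_le_sqrt hℓ
  have h1 := Nat.lt_floor_add_one ((2 : ℝ) ^ (10 * √ℓ))
  have h2 : (2 : ℝ) ^ (10 * √ℓ) = 2 ^ (9 * √ℓ) * 2 ^ √ℓ := by
    rw [← rpow_add (by norm_num)]
    ring_nf
  have h3 : (2 : ℝ) ≤ 2 ^ √ℓ := by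
    calc (2 : ℝ) = 2 ^ (1 : ℝ) := (rpow_one _).symm
      _ ≤ _ := rpow_le_rpow_of_exponent_le (by norm_num) (by linarith)
  have h4 : (1 : ℝ) ≤ 2 ^ (9 * √ℓ) := one_le_rpow (by norm_num) (by positivity)
  nlinarith

theorem two_rpow_floor_le {ℓ : ℝ} : (⌊(2 : ℝ) ^ (10 * √ℓ)⌋₊ : ℝ) ≤ 2 ^ (10 * √ℓ) :=
  Nat.floor_le (by positivity)

theorem floor_two_rpow_le_sq (hn : 2 ≤ n) (hℓ : 45 ≤ logb 2 n) :
    ⌊(2 : ℝ) ^ (10 * √(logb 2 n))⌋₊ ≤ n ^ 2 := by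
  have h5 := five_le_sqrt hℓ
  have hs := sq_sqrt (by linarith : 0 ≤ logb 2 n)
  have h1 : (2 : ℝ) ^ (10 * √(logb 2 n)) ≤ n ^ 2 := by
    calc (2 : ℝ) ^ (10 * √(logb 2 n)) ≤ 2 ^ (logb 2 n * 2) :=
          rpow_le_rpow_of_exponent_le (by norm_num) (by nlinarith)
      _ = n ^ 2 := by
          rw [rpow_mul (by norm_num), rpow_logb_natCast hn]
          norm_cast
  exact_mod_cast two_rpow_floor_le.trans h1

theorem floor_logb_div_pow_le (hn : 2 ≤ n) (hε : 0 < ε)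
    (hΔ : 10 ^ 7 * logb 2 n ^ 5 / ε ^ 3 ≤ (Δ : ℝ)) (hΔn : Δ ≤ n) :
    ⌊logb 2 n / ε⌋₊ ^ 3 ≤ n := by
  have h1 := one_le_logb hn
  have h2 : (⌊logb 2 n / ε⌋₊ : ℝ) ≤ logb 2 n / ε := Nat.floor_le (by positivity)
  have h3 : (⌊logb 2 n / ε⌋₊ : ℝ) ^ 3 ≤ n := by
    calc (⌊logb 2 n / ε⌋₊ : ℝ) ^ 3 ≤ (logb 2 n / ε) ^ 3 := pow_le_pow_left₀ (by positivity) h2 3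
      _ = logb 2 n ^ 3 / ε ^ 3 := div_pow _ _ _
      _ ≤ 10 ^ 7 * logb 2 n ^ 5 / ε ^ 3 := by
          gcongr
          have : logb 2 n ^ 3 ≤ logb 2 n ^ 5 := pow_le_pow_right₀ h1 (by omega)
          have : 0 ≤ logb 2 n ^ 5 := by positivity
          linarith
      _ ≤ Δ := hΔ
      _ ≤ n := by exact_mod_cast hΔn
  exact_mod_cast h3

theorem le_floor_logb_div {ℓ : ℝ} (hε : 0 < ε) (hε1 : ε ≤ 1) (hℓ : 45 ≤ ℓ) : 45 ≤ ⌊ℓ / ε⌋₊ := by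
  refine Nat.le_floor ?_
  push_cast
  exact hℓ.trans (le_div_self (by linarith) hε hε1)

theorem natLog_add_one_le (hn : 2 ≤ n) (hε : 0 < ε) (hℓ : 45 ≤ logb 2 n) :
    ((Nat.log 2 n + 1 : ℕ) : ℝ) ≤ 1.1 * (ε * (⌊logb 2 n / ε⌋₊ + 1)) := by
  have h1 := natLog_le_logb hn
  have h2 := Nat.lt_floor_add_one (logb 2 n / ε)
  rw [div_lt_iff₀ hε] at h2
  push_cast
  linarith

/-- There are at most `√(log n)` splittings into `t₁` graphs, as `t₁ ^ i ≤ n`, and at most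
`2 * √(log n)` splittings into `t₂` graphs, as `32 ^ j ≤ t₂ ^ j < t₁`. -/
theorem depth_le {t₁ t₂ i j : ℕ} (hn : 2 ≤ n) (hℓ : 45 ≤ logb 2 n)
    (ht₁ : t₁ = ⌊(2 : ℝ) ^ (10 * √(logb 2 n))⌋₊) (ht₂ : 45 ≤ t₂) (hΔn : Δ ≤ n)
    (hp : Parameters Δ t₁ t₂ i j) : ((i + j : ℕ) : ℝ) ≤ 4 * √(logb 2 n) := by
  have hlow := le_floor_two_rpow hℓ
  have hupp := two_rpow_floor_le (ℓ := logb 2 n)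
  rw [← ht₁] at hlow hupp
  have hs := sq_sqrt (by linarith : 0 ≤ logb 2 n)
  have h5 := five_le_sqrt hℓ
  set r := √(logb 2 n) with hr
  have hi : (i : ℝ) ≤ r := by
    rcases hp.lower with ⟨rfl, -⟩ | h
    · rw [Nat.cast_zero]
      linarith
    · have h1 : t₁ ^ i ≤ n := by
        refine le_trans ?_ (h.trans hΔn)
        rw [mul_assoc]
        exact Nat.le_mul_of_pos_right _ (by positivity)
      have h2 : (2 : ℝ) ^ (9 * r * i) ≤ 2 ^ logb 2 n := by
        rw [rpow_logb_natCast hn, rpow_mul (by norm_num), rpow_natCast]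
        calc ((2 : ℝ) ^ (9 * r)) ^ i ≤ (t₁ : ℝ) ^ i := pow_le_pow_left₀ (by positivity) hlow i
          _ ≤ n := by exact_mod_cast h1
      have h3 := (rpow_le_rpow_left_iff (by norm_num)).1 h2
      have h4 : (0 : ℝ) ≤ i := Nat.cast_nonneg _
      nlinarith
  have hj : (j : ℝ) ≤ 2 * r := by
    rcases hp.second with rfl | h
    · rw [Nat.cast_zero]
      linarith
    · have h2 : (2 : ℝ) ^ (5 * j : ℝ) ≤ 2 ^ (10 * r) := by
        rw [rpow_mul (by norm_num), rpow_natCast]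
        calc ((2 : ℝ) ^ (5 : ℝ)) ^ j ≤ (t₂ : ℝ) ^ j := by
              refine pow_le_pow_left₀ (by positivity) ?_ j
              have : (45 : ℝ) ≤ t₂ := by exact_mod_cast ht₂
              norm_num
              linarith
          _ ≤ t₁ := by exact_mod_cast h.le
          _ ≤ _ := hupp
      have h3 := (rpow_le_rpow_left_iff (by norm_num)).1 h2
      linarith
  push_cast
  linarith

/-- Each of the three factors of the exponent of `subpolyBound` is at least `1`, so that their
product bounds each of them, and also the sum of the two logarithms. -/
theorem two_rpow_le_subpolyBound {a : ℝ} {c : ℕ} (hc : c ≠ 0) (hε : 0 < ε) (hε1 : ε ≤ 1)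
    (hℓ : 1 ≤ logb 2 n)
    (ha : a ≤ 20 * (1 + √(logb 2 n) + (logb 2 (logb 2 n) + logb 2 ε⁻¹))) :
    (2 : ℝ) ^ a ≤ subpolyBound 40 c n ε := by
  unfold subpolyBound
  refine rpow_le_rpow_of_exponent_le (by norm_num) (ha.trans ?_)
  have hx : 0 ≤ logb 2 (logb 2 n) := logb_nonneg (by norm_num) hℓ
  have hy : 0 ≤ logb 2 ε⁻¹ := logb_nonneg (by norm_num) ((one_le_inv₀ hε).2 hε1)
  set x := logb 2 (logb 2 n)
  set y := logb 2 ε⁻¹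
  have hr : 1 ≤ √(logb 2 n) := one_le_sqrt.2 hℓ
  set r := √(logb 2 n)
  have hxy : 0 ≤ x * y := mul_nonneg hx hy
  have h1 : 1 + x ≤ (1 + x) ^ c := le_self_pow₀ (by linarith) hc
  have h2 : 1 + y ≤ (1 + y) ^ c := le_self_pow₀ (by linarith) hc
  have h3 : r * ((1 + x) * (1 + y)) ≤ r * ((1 + x) ^ c * (1 + y) ^ c) := by gcongr
  have h4 : r ≤ r * ((1 + x) * (1 + y)) := le_mul_of_one_le_right (by linarith) (by nlinarith)
  have h5 : 1 * ((1 + x) * (1 + y)) ≤ r * ((1 + x) * (1 + y)) := by gcongr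
  have h6 : 40 * r * (1 + x) ^ c * (1 + y) ^ c = 40 * (r * ((1 + x) ^ c * (1 + y) ^ c)) := by ring
  rw [h6]
  linarith

theorem succ_pow_le_two_pow (n b : ℕ) : (n + 1) ^ b ≤ 2 ^ (b * (Nat.log 2 n + 1)) := by
  rw [mul_comm, pow_mul]
  exact Nat.pow_le_pow_left (Nat.lt_pow_succ_log_self (by omega) n) b

/-- Words of `12 * (⌊log₂ n⌋ + 1)` bits are long enough for all numbers that occur. -/
theorem room_of_word {n t₁ t₂ w : ℕ} (hn : 1000 ≤ n) (ht₁ : t₁ ≤ n ^ 2) (ht₂ : t₂ ^ 3 ≤ n)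
    (hw : (n + 1) ^ 12 ≤ 2 ^ w) :
    8 * (4 * n * (4 * n) * (4 * n)) < 2 ^ w ∧
      8 * n + (n + 1) * t₁ * t₂ ^ 7 + (n + 1) * t₂ * t₂ ^ 7 < 2 ^ w ∧
      8 * (2 * (t₂ ^ 7 * n ^ 3) + 8 * n) + 8 < 2 ^ w := by
  have h9 : t₂ ^ 9 ≤ n ^ 3 := by
    calc t₂ ^ 9 = (t₂ ^ 3) ^ 3 := by ring
      _ ≤ n ^ 3 := Nat.pow_le_pow_left ht₂ 3
  have hp : ∀ a ≤ 9, 0 < a → t₂ ^ a ≤ n ^ 3 := fun a ha ha' => by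
    rcases Nat.eq_zero_or_pos t₂ with rfl | h
    · rw [zero_pow (by omega)]
      exact Nat.zero_le _
    · exact (Nat.pow_le_pow_right h ha).trans h9
  have hx : ∀ a b, a ≤ b → (n + 1) ^ a ≤ (n + 1) ^ b := fun a b h =>
    Nat.pow_le_pow_right (by omega) h
  have h7 : 1000 * (n + 1) ^ 6 ≤ (n + 1) ^ 12 := by
    calc 1000 * (n + 1) ^ 6 ≤ (n + 1) * (n + 1) ^ 6 := Nat.mul_le_mul_right _ (by omega)
      _ = (n + 1) ^ 7 := by ring
      _ ≤ _ := hx _ _ (by omega)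
  have hn6 : n ≤ (n + 1) ^ 6 := by
    calc n ≤ (n + 1) ^ 1 := by rw [pow_one]; omega
      _ ≤ _ := hx _ _ (by omega)
  have hn3 : n ^ 3 ≤ (n + 1) ^ 6 :=
    (Nat.pow_le_pow_left (by omega) 3).trans (hx _ _ (by omega))
  have hn33 : n ^ 3 * n ^ 3 ≤ (n + 1) ^ 6 := by
    calc n ^ 3 * n ^ 3 = n ^ 6 := by ring
      _ ≤ _ := Nat.pow_le_pow_left (by omega) 6
  refine ⟨?_, ?_, ?_⟩
  · have : 8 * (4 * n * (4 * n) * (4 * n)) = 512 * n ^ 3 := by ring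
    omega
  · have h1 : (n + 1) * t₁ * t₂ ^ 7 ≤ (n + 1) ^ 6 := by
      calc (n + 1) * t₁ * t₂ ^ 7 ≤ (n + 1) * (n + 1) ^ 2 * (n + 1) ^ 3 := by
            refine Nat.mul_le_mul (Nat.mul_le_mul_left _ (ht₁.trans ?_))
              ((hp 7 (by omega) (by omega)).trans ?_)
            · exact Nat.pow_le_pow_left (by omega) 2
            · exact Nat.pow_le_pow_left (by omega) 3
        _ = _ := by ring
    have h2 : (n + 1) * t₂ * t₂ ^ 7 ≤ (n + 1) ^ 6 := by
      calc (n + 1) * t₂ * t₂ ^ 7 = (n + 1) * t₂ ^ 8 := by ring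
        _ ≤ (n + 1) * (n + 1) ^ 3 := Nat.mul_le_mul_left _ ((hp 8 (by omega) (by omega)).trans
            (Nat.pow_le_pow_left (by omega) 3))
        _ = (n + 1) ^ 4 := by ring
        _ ≤ _ := hx _ _ (by omega)
    omega
  · have h1 : t₂ ^ 7 * n ^ 3 ≤ (n + 1) ^ 6 :=
      (Nat.mul_le_mul_right _ (hp 7 (by omega) (by omega))).trans hn33
    have h2 : 0 < (n + 1) ^ 6 := by positivity
    omega

theorem thousand_le_of_logb (hn : 2 ≤ n) (hℓ : 45 ≤ logb 2 n) : 1000 ≤ n := by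
  have h : (2 : ℝ) ^ (45 : ℝ) ≤ n := by
    rw [← rpow_logb_natCast hn]
    exact rpow_le_rpow_of_exponent_le (by norm_num) hℓ
  have h2 : (1000 : ℝ) ≤ n := by
    refine le_trans ?_ h
    norm_num
  exact_mod_cast h2

theorem floor_logb_div_pow_le_two_rpow (hε : 0 < ε) (hℓ : 1 ≤ logb 2 n) (a : ℕ) :
    (⌊logb 2 n / ε⌋₊ : ℝ) ^ a ≤ 2 ^ (a * (logb 2 (logb 2 n) + logb 2 ε⁻¹)) := by
  have h1 : (2 : ℝ) ^ (logb 2 (logb 2 n) + logb 2 ε⁻¹) = logb 2 n / ε := by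
    rw [rpow_add (by norm_num), rpow_logb (by norm_num) (by norm_num) (by linarith),
      rpow_logb (by norm_num) (by norm_num) (by positivity), div_eq_mul_inv]
  rw [mul_comm, rpow_mul (by norm_num), h1, rpow_natCast]
  exact pow_le_pow_left₀ (by positivity) (Nat.floor_le (by positivity)) a

theorem init_time_le {h c : ℕ} (hc : c ≠ 0) (hε : 0 < ε) (hε1 : ε ≤ 1) (hℓ : 45 ≤ logb 2 n)
    (hh : (h : ℝ) ≤ 4 * √(logb 2 n)) : ((60 * h + 200 : ℕ) : ℝ) ≤ subpolyBound 40 c n ε := by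
  have h5 := five_le_sqrt hℓ
  have hx : 0 ≤ logb 2 (logb 2 n) := logb_nonneg (by norm_num) (by linarith)
  have hy : 0 ≤ logb 2 ε⁻¹ := logb_nonneg (by norm_num) ((one_le_inv₀ hε).2 hε1)
  refine le_trans ?_ (two_rpow_le_subpolyBound (a := 9 + √(logb 2 n)) hc hε hε1 (by linarith)
    (by linarith))
  have h1 : √(logb 2 n) ≤ 2 ^ √(logb 2 n) := by
    have := one_add_mul_self_le_rpow_one_add (s := 1) (by norm_num) (p := √(logb 2 n)) (by linarith)
    norm_num at this
    linarith
  rw [rpow_add (by norm_num)]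
  push_cast
  norm_num
  linarith

/-- The time of an update is `O(t₂ ^ 15)`, where `log t₂ ≤ log log n + log ε⁻¹`. -/
theorem update_time_le {c : ℕ} (hc : c ≠ 0) (hε : 0 < ε) (hε1 : ε ≤ 1) (hℓ : 1 ≤ logb 2 n)
    {t : ℕ} (ht : t = ⌊logb 2 n / ε⌋₊) (htpos : 0 < t) :
    ((50000 * (t ^ 7 * (2 * t ^ 8 + 1)) : ℕ) : ℝ) ≤ subpolyBound 40 c n ε := by
  have hr : 0 ≤ √(logb 2 n) := sqrt_nonneg _
  have hx : 0 ≤ logb 2 (logb 2 n) := logb_nonneg (by norm_num) hℓ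
  have hy : 0 ≤ logb 2 ε⁻¹ := logb_nonneg (by norm_num) ((one_le_inv₀ hε).2 hε1)
  refine le_trans ?_ (two_rpow_le_subpolyBound
    (a := 18 + (15 : ℕ) * (logb 2 (logb 2 n) + logb 2 ε⁻¹)) hc hε hε1 hℓ (by push_cast; linarith))
  have h1 : 50000 * (t ^ 7 * (2 * t ^ 8 + 1)) ≤ 2 ^ 18 * t ^ 15 := by
    have h2 : 1 ≤ t ^ 8 := Nat.one_le_pow _ _ htpos
    calc 50000 * (t ^ 7 * (2 * t ^ 8 + 1)) ≤ 50000 * (t ^ 7 * (3 * t ^ 8)) := by gcongr; omega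
      _ = 150000 * t ^ 15 := by ring
      _ ≤ _ := Nat.mul_le_mul_right _ (by norm_num)
  have h3 := floor_logb_div_pow_le_two_rpow hε hℓ 15
  rw [← ht] at h3
  calc ((50000 * (t ^ 7 * (2 * t ^ 8 + 1)) : ℕ) : ℝ) ≤ ((2 ^ 18 * t ^ 15 : ℕ) : ℝ) :=
        Nat.cast_le.2 h1
    _ = 2 ^ (18 : ℝ) * (t : ℝ) ^ 15 := by push_cast; norm_num
    _ ≤ 2 ^ (18 : ℝ) * 2 ^ ((15 : ℕ) * (logb 2 (logb 2 n) + logb 2 ε⁻¹)) := by gcongr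
    _ = _ := by rw [← rpow_add (by norm_num)]

end Numerics

end DegreeSplitting

/-! ### The dynamic splitting algorithm -/

open DegreeSplitting

/-- One program, one word-length factor `b` and constants `C`, `c` serve all inputs. Words have
`b (⌊log₂ n⌋ + 1)` bits; the inputs of the program are `n`, `Δmax`, `t₁`, `t₂` and `⌈1 / ε⌉`. The
parameters `h`, `i`, `j` are kept in the memory cells `0`, `1`, `2`. The recourse is the number of
edge insertions into and edge deletions from graphs of the maintained family. -/
theorem theorem1p3 :
    ∃ (A : DynAlg) (b : ℕ) (C : ℝ) (c : ℕ),
      ∀ (n : ℕ) (ε : ℝ) (Δmax : ℕ), 2 ≤ n → 0 < ε → ε < 1 →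
        10 ^ 7 * Real.logb 2 n ^ 5 / ε ^ 3 ≤ (Δmax : ℝ) → Δmax ≤ n →
      ∀ (t₁ t₂ w : ℕ), t₁ = ⌊(2 : ℝ) ^ (10 * √(Real.logb 2 n))⌋₊ →
        t₂ = ⌊Real.logb 2 n / ε⌋₊ → w = b * (Nat.log 2 n + 1) →
      ∃ (h i j : ℕ), h = i + j ∧ (h : ℝ) ≤ 4 * √(Real.logb 2 n) ∧
        (1 + ε / 16) * (Δmax / (t₁ ^ i * t₂ ^ j : ℝ)) ≤ C * (Real.logb 2 n / ε) ^ c ∧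
      ∃ (s₀ : State) (T₀ : ℕ),
        Exec w A.init (startState w [n, Δmax, t₁, t₂, ⌈1 / ε⌉₊]) s₀ T₀ ∧
        (T₀ : ℝ) ≤ subpolyBound C c n ε ∧
        ∀ us : List (EdgeUpdate (Fin n)), Admissible Δmax us →
          ∃ (s : State) (T : ℕ), A.Run w s₀ us s T ∧
            -- amortised update time and amortised recourse
            (T : ℝ) ≤ us.length * subpolyBound C c n ε ∧
            (s.out.length : ℝ) ≤ us.length * subpolyBound C c n ε ∧
            -- the maintained parameters and the maintained family of graphs
            s.mem 0 = h ∧ s.mem 1 = i ∧ s.mem 2 = j ∧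
            PartitionsEdges (graphAfter us) Set.univ (s.family n) ∧
            {g | s.family n g ≠ ⊥}.encard ≤ (t₁ ^ i * t₂ ^ j : ℕ) ∧
            (∀ g, DegreeLE (s.family n g) ((1 + ε / 16) * (Δmax / (t₁ ^ i * t₂ ^ j : ℝ)))) ∧
            -- it is the bottom level of a hierarchy of `i` splittings into `t₁` and then `j`
            -- splittings into `t₂` graphs
            ∃ H : ℕ → ℕ → SimpleGraph (Fin n),
              IsHierarchy (graphAfter us) h (fun k => if k < i then t₁ else t₂)
                (fun k => (1 + ε / 16) *
                  (Δmax / ((∏ l ∈ Finset.range k, if l < i then t₁ else t₂ : ℕ) : ℝ))) H ∧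
              (∀ g < t₁ ^ i * t₂ ^ j, s.family n g = H h g) ∧
              ∀ g, t₁ ^ i * t₂ ^ j ≤ g → s.family n g = ⊥ := by
  refine ⟨algorithm, 12, 40, 8, ?_⟩
  intro n ε Δ hn hε hε1' hΔ hΔn t₁ t₂ w ht₁ ht₂ hw
  have hε1 : ε ≤ 1 := hε1'.le
  have hℓ := le_logb hn hε hε1 hΔ hΔn
  have h45 : 45 ≤ t₂ := by rw [ht₂]; exact le_floor_logb_div hε hε1 hℓ
  have ht₁2 : 2 ≤ t₁ := by
    have h1 := le_floor_two_rpow hℓ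
    rw [← ht₁] at h1
    have h2 : (2 : ℝ) ≤ 2 ^ (9 * √(Real.logb 2 n)) := by
      calc (2 : ℝ) = 2 ^ (1 : ℝ) := (Real.rpow_one _).symm
        _ ≤ _ := Real.rpow_le_rpow_of_exponent_le (by norm_num) (by linarith [five_le_sqrt hℓ])
    exact_mod_cast h2.trans h1
  have hpow : (n + 1) ^ 12 ≤ 2 ^ w := by rw [hw]; exact succ_pow_le_two_pow n 12
  obtain ⟨hroom, hinit, hbig⟩ := room_of_word (t₁ := t₁) (t₂ := t₂) (thousand_le_of_logb hn hℓ)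
    (by rw [ht₁]; exact floor_two_rpow_le_sq hn hℓ)
    (by rw [ht₂]; exact floor_logb_div_pow_le hn hε hΔ hΔn) hpow
  obtain ⟨σ, i, j, hrun, hp, hst, hout, hm0, hm1, hm2⟩ := initCode_runs (x := ⌈1 / ε⌉₊)
    (by omega : 0 < n) hΔn ht₁2 (by omega) hinit
  obtain ⟨s₀, T₀, hexec, hT₀, hsim⟩ := hrun _ (Sim.refl _)
  have hdepth := depth_le hn hℓ ht₁ h45 hΔn hp
  set T := t₁ ^ i * t₂ ^ j with hT
  have hTpos : 0 < T := by positivity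
  have hTcast : (T : ℝ) = (t₁ : ℝ) ^ i * (t₂ : ℝ) ^ j := by rw [hT]; push_cast; rfl
  have hlower : T = 1 ∨ T * t₂ ^ 7 ≤ Δ := hp.lower.imp (fun h => by simp [hT, h.1, h.2]) id
  have hTn : T ≤ n := by
    rcases hlower with h | h
    · omega
    · have : T * 1 ≤ T * t₂ ^ 7 := Nat.mul_le_mul_left _ (Nat.one_le_pow _ _ (by omega))
      omega
  have hT' : (0 : ℝ) < T := by exact_mod_cast hTpos
  -- by the choice of `T`, the bound for the degrees on the bottom level is polylogarithmic
  have hM : (1 + ε / 16) * (Δ / T) ≤ 2 * (t₂ : ℝ) ^ 8 := by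
    have h1 : (Δ : ℝ) / T ≤ (t₂ : ℝ) ^ 8 := by
      rw [div_le_iff₀ hT', mul_comm]
      exact_mod_cast hp.upper.le
    have h2 : (0 : ℝ) ≤ Δ / T := by positivity
    nlinarith
  have hfits : Fits w n T (t₂ ^ 7) := ⟨hroom, hTn, hTpos, by positivity⟩
  have hload : ∀ χ, IsColouring T χ → (∀ u < n, ∀ v < n, ¬ Violating n T (t₂ ^ 7) χ u v) →
      (∀ v < n, ((Finset.range n).filter fun x => χ v x ≠ 0).card ≤ Δ) →
      ∀ v < n, ∀ l, (load n χ v l : ℝ) ≤ (1 + ε / 16) * (Δ / T) := fun χ hχ hs hd v hv l =>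
    load_le_average hε hε1 h45 (by rw [ht₂]; exact natLog_add_one_le hn hε hℓ) hTpos hTn hlower hχ
      hs hd hv l
  refine ⟨i + j, i, j, rfl, hdepth, ?_⟩
  rw [← hTcast]
  refine ⟨?_, s₀, T₀, hexec, ?_, ?_⟩
  · refine hM.trans ?_
    have h1 : (t₂ : ℝ) ≤ Real.logb 2 n / ε := by
      rw [ht₂]
      exact Nat.floor_le (by positivity)
    have h2 : (t₂ : ℝ) ^ 8 ≤ (Real.logb 2 n / ε) ^ 8 := pow_le_pow_left₀ (by positivity) h1 8
    have h3 : (0 : ℝ) ≤ (t₂ : ℝ) ^ 8 := by positivity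
    linarith
  · exact (Nat.cast_le.2 hT₀).trans (init_time_le (by norm_num) hε hε1 hℓ hdepth)
  · intro us hus
    have hst₀ := hst.of_sim hsim
    obtain ⟨s, Tm, χ, hR, hS, hmem, hadj, hlen, hTm⟩ := exists_run (L := 2 * t₂ ^ 8) hfits hbig
      (fun χ hχ hs hd v hv l => by exact_mod_cast (hload χ hχ hs hd v hv l).trans hM)
      hst₀ (by rw [hsim.2.2, hout]) us hus
    have hdeg := (degreeLE_iff (p := fun a b => χ a b ≠ 0) hadj Δ).1 (degreeLE_of_admissible hus)
    have hχ := hS.stores.colouring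
    have hload' := hload χ hχ hS.stable fun v hv => by exact_mod_cast hdeg v hv
    have hfam : ∀ g (a b : Fin n), (s.family n g).Adj a b ↔ χ a b = g + 1 := hS.stores.describes
    have hB := update_time_le (n := n) (c := 8) (by norm_num) hε hε1 (by linarith) ht₂ (by omega)
    have htime : (Tm : ℝ) ≤ us.length * subpolyBound 40 8 n ε := by
      calc (Tm : ℝ) ≤ ((us.length * (50000 * (t₂ ^ 7 * (2 * t₂ ^ 8 + 1))) : ℕ) : ℝ) :=
            Nat.cast_le.2 (by omega)
        _ = us.length * ((50000 * (t₂ ^ 7 * (2 * t₂ ^ 8 + 1)) : ℕ) : ℝ) := Nat.cast_mul _ _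
        _ ≤ _ := by gcongr
    have ht : ∀ k < i + j, 0 < if k < i then t₁ else t₂ := fun k _ => by split_ifs <;> omega
    obtain ⟨H, hH, hbot⟩ := exists_isHierarchy (D := fun k => (1 + ε / 16) *
      (Δ / ((∏ l ∈ Finset.range k, if l < i then t₁ else t₂ : ℕ) : ℝ))) hχ
      (prod_range_ite t₁ t₂ i j) ht hadj hload' (fun k hk => le_of_eq (by
        have : (0 : ℝ) < ((∏ l ∈ Finset.range k, if l < i then t₁ else t₂ : ℕ) : ℝ) := by
          exact_mod_cast Finset.prod_pos fun l hl =>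
            ht l (by have := Finset.mem_range.1 hl; omega)
        field_simp))
    refine ⟨s, Tm, hR, htime, (Nat.cast_le.2 hlen).trans htime, ?_, ?_, ?_,
      partitionsEdges_of_colour hadj hfam, encard_le_of_colour hχ hfam, ?_, H, hH, ?_,
      fun g hg => eq_bot_of_colour hχ hfam hg⟩
    · rw [hmem 0 (by omega), hsim.2.1, hm0]
    · rw [hmem 1 (by omega), hsim.2.1, hm1]
    · rw [hmem 2 (by omega), hsim.2.1, hm2]
    · intro g
      exact (degreeLE_iff (p := fun a b => χ a b = g + 1) (hfam g) _).2 fun v hv => hload' v hv g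
    · intro g _
      ext a b
      rw [hfam, hbot]
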